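/- **Rank-one extraction in a symmetry block.** Let $2\le s_1<\dots<s_N$ be integers, $s=\gcd(s_1,\dots,s_N)$, and for $\zeta\in\mathbb C^N$ put $F(y,x;\zeta)=y-1-\sum_{n=1}^N\zeta_n x^{s_n}y^{s_n}$. Let $U(\cdot;\zeta)$ be the unique germ analytic at $x=0$ with $U(0;\zeta)=1$ and $F(U(x;\zeta),x;\zeta)=0$, let $\rho_*(\zeta)$ be the radius of the largest disk about $0$ on which $U(\cdot;\zeta)$ is analytic, and let $R_p(m;\zeta)=[x^{ms}]\,U(x;\zeta)^p$. *Dominance.* The boundary is dominant with representative $x_*$ if $|x_*|=\rho_*(\zeta)$ and the singular points of $U(\cdot;\zeta)$ on $|x|=\rho_*(\zeta)$ are exactly $e^{2\pi i j/s}x_*$, $0\le j<s$. The branch value at $x_*$ is $\lambda=\lim_{x\to x_*}U(x;\zeta)$; the pair $(\lambda,x_*)$ is simple if $F=\partial_yF=0$ and $\partial_y^2F\ne0$ at $(\lambda,x_*;\zeta)$. A simple critical point is a $\zeta_c$ with $\rho_*(\zeta_c)=1$ and a dominant boundary whose pair $(\lambda_c,x_{*,c})$ is simple. *Standing hypotheses.*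 Let $\varepsilon\mapsto\zeta(\varepsilon)$, $0\le\varepsilon<\varepsilon_1$, be a $C^1$ path such that $\zeta(0)=\zeta_c$ is a simple critical point, $\rho_*(\zeta(\varepsilon))=1+\varepsilon$ for $0<\varepsilon<\varepsilon_1$, and the boundary is dominant with simple pair $(\lambda(\varepsilon),x_*(\varepsilon))$, where $x_*(\varepsilon)$ is $C^1$ on $[0,\varepsilon_1)$ with $x_*(0)=x_{*,c}$. Write $z_*(\varepsilon)=x_*(\varepsilon)^s$ and $\widehat U(x^s;\varepsilon)=U(x;\zeta(\varepsilon))$. Assume that there are $\varepsilon'>0$, $\phi\in(0,\pi/2)$, $\eta_0,C_0,c_0>0$ and $M$ such that for all $0<\varepsilon<\varepsilon'$, with $$\Omega_\varepsilon=\{z:\ |z|<|z_*(\varepsilon)|+\eta_0/2,\ z\neq z_*(\varepsilon),\ |\arg(z/z_*(\varepsilon)-1)|>\phi\},$$ (U1) $\widehat U(\cdot;\varepsilon)$ continues analytically to $\Omega_\varepsilon$ and continuously to $\overline{\Omega_\varepsilon}$, with $|\widehat U|\le M$ on $\partial\Omega_\varepsilon$; (U2) for $z\in\Omega_\varepsilon$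 with $\delta=1-z/z_*(\varepsilon)$, $|\delta|<\eta_0$ (principal powers), $$\bigl|\widehat U(z;\varepsilon)-\lambda(\varepsilon)-s^{-1/2}\kappa(\varepsilon)\delta^{1/2}-c(\varepsilon)\delta-d(\varepsilon)\delta^{3/2}\bigr|\le C_0|\delta|^2,$$ where $|\lambda(\varepsilon)|,|\kappa(\varepsilon)|\ge c_0$ and $|\lambda(\varepsilon)|+|\kappa(\varepsilon)|+|c(\varepsilon)|+|d(\varepsilon)|\le C_0$. *Renormalized Gram block.* Put $\rho_*(\varepsilon)=1+\varepsilon$, $\rho(\varepsilon)=\tfrac12(1+\rho_*(\varepsilon))$, $\eta(\varepsilon)=(\rho(\varepsilon)\rho_*(\varepsilon))^{-2s}$ and $L(\varepsilon)=\sum_{m\ge0}\eta(\varepsilon)^m/(m+1)$. Fix $\beta>0$ and $\alpha>\max\{M_0,L_0\}$, where, for all small $\varepsilon>0$, $|U(x;\zeta(\varepsilon))|\le M_0$ on $|x|=\rho(\varepsilon)$ and $|\lambda(\varepsilon)|\le L_0$. Fix $q\in\{1,\dots,s\}$, and put $p_j=q+js$, $w_j=p_j^{3/2+\beta}\alpha^{p_j}$.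 Let $\widetilde V^{(q)}(\varepsilon)$ be the operator on $\ell^2(\mathbb N_0)$ with matrix entries $$\widetilde V^{(q)}_{jk}(\varepsilon)=\frac{p_j}{w_k\sqrt{p_k}}\,R_{p_k}(j-k;\zeta(\varepsilon))\quad(j\ge k),\qquad \widetilde V^{(q)}_{jk}(\varepsilon)=0\quad(j<k),$$ and $\widetilde G^{(q)}(\varepsilon)=\widetilde V^{(q)}(\varepsilon)^*\widetilde V^{(q)}(\varepsilon)$. For $u,v\in\ell^2$ let $(u\otimes v)\xi=\langle v,\xi\rangle u$, the inner product being linear in the second slot. *Conclusion.* There exist $\varepsilon_0>0$, vectors $\widetilde d^{(q)}(\varepsilon)\in\ell^2(\mathbb N_0)$ and bounded operators $\widetilde C^{(q)}(\varepsilon)$ such that for $0<\varepsilon<\varepsilon_0$ the operator $\widetilde V^{(q)}(\varepsilon)$ is bounded and $$\widetilde G^{(q)}(\varepsilon)=L(\varepsilon)\,\widetilde d^{(q)}(\varepsilon)\otimes\widetilde d^{(q)}(\varepsilon)+\widetilde C^{(q)}(\varepsilon),\qquad \sup_{0<\varepsilon<\varepsilon_0}\|\widetilde C^{(q)}(\varepsilon)\|<\infty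 .$$ Moreover $\kappa(\varepsilon)\to\kappa_c$ as $\varepsilon\downarrow0$ for some $\kappa_c\ne0$; for $p\ge1$ and $0<\varepsilon<\varepsilon_0$ the limit $A_p(\varepsilon)=\lim_{m\to\infty}R_p(m;\zeta(\varepsilon))\,x_*(\varepsilon)^{ms}\,m^{3/2}$ exists, with $$A_p(\varepsilon)=-\frac{s^{-1/2}}{2\sqrt\pi}\,p\,\kappa(\varepsilon)\lambda(\varepsilon)^{p-1}\ \longrightarrow\ A_p^{(c)}=-\frac{s^{-1/2}}{2\sqrt\pi}\,p\,\kappa_c\lambda_c^{p-1}\qquad(\varepsilon\downarrow0);$$ and $$\widetilde d^{(q)}(\varepsilon)\to\widetilde d^{(q)}_c\neq0\ \text{ in }\ell^2(\mathbb N_0),\qquad \widetilde d^{(q)}(\varepsilon)(j)=e^{-ij\varphi(\varepsilon)}\frac{s}{\sqrt{p_j}}\frac{\overline{A_{p_j}(\varepsilon)}}{w_j},\qquad \widetilde d^{(q)}_c(j)=e^{-ij\varphi_c}\frac{s}{\sqrt{p_j}}\frac{\overline{A^{(c)}_{p_j}}}{w_j},$$ where $e^{i\varphi(\varepsilon)}=z_*(\varepsilon)/|z_*(\varepsilon)|$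 and $e^{i\varphi_c}=x_{*,c}^{\,s}$. -/

import Mathlib

open Filter Topology Metric
open scoped ENNReal NNReal

noncomputable section

namespace TodaGram

/-- The Hilbert space `ℓ²(ℕ₀)` of square summable complex sequences. -/
abbrev EllTwo : Type := lp (fun _ : ℕ => ℂ) 2

/-! ### The inverse-map equation and its Taylor branch -/

/-- The symmetry index `s = gcd(s₁, …, s_N)`; `e n` is the exponent `s_n`. -/
def symIndex {N : ℕ} (e : Fin N → ℕ) : ℕ := Finset.univ.gcd e

/-- The polynomial `F(y, x; ζ) = y - 1 - ∑ₙ ζₙ x^{sₙ} y^{sₙ}`. -/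
def charPoly {N : ℕ} (e : Fin N → ℕ) (ζ : Fin N → ℂ) (y x : ℂ) : ℂ :=
  y - 1 - ∑ n, ζ n * x ^ e n * y ^ e n

/-- `g` represents the Taylor branch `U(·; ζ)`: it is analytic at `0`, equals `1` there, and solves
`F(g(x), x; ζ) = 0` near `0`. -/
def IsTaylorBranch {N : ℕ} (e : Fin N → ℕ) (ζ : Fin N → ℂ) (g : ℂ → ℂ) : Prop :=
  AnalyticAt ℂ g 0 ∧ g 0 = 1 ∧ ∀ᶠ x in 𝓝 (0 : ℂ), charPoly e ζ (g x) x = 0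

theorem exists_isTaylorBranch {N : ℕ} (e : Fin N → ℕ) (he : ∀ n, e n ≠ 0) (ζ : Fin N → ℂ) :
    ∃ g, IsTaylorBranch e ζ g := by
  set P : ℂ → ℂ := fun v => 1 + ∑ n, ζ n * v ^ e n with hP
  have hPd : Differentiable ℂ P := by rw [hP]; fun_prop
  have hP0 : P 0 = 1 := by simp [hP, he]
  set h : ℂ → ℂ := fun v => v / P v with hh
  have hPa : AnalyticAt ℂ P 0 := hPd.analyticAt 0
  have hha : AnalyticAt ℂ h 0 := analyticAt_id.div hPa (by rw [hP0]; exact one_ne_zero)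
  have h0 : h 0 = 0 := by simp [hh]
  have hd : deriv h 0 = 1 := by
    have := ((hasDerivAt_id (0 : ℂ)).div (hPd 0).hasDerivAt (by rw [hP0]; exact one_ne_zero)).deriv
    have h2 : deriv h 0 = deriv (id / P) 0 := rfl
    rw [h2, this]
    simp [hP0]
  have hd' : deriv h 0 ≠ 0 := by rw [hd]; exact one_ne_zero
  set r : ℂ → ℂ := hha.hasStrictDerivAt.localInverse _ _ _ hd' with hr
  have hra : AnalyticAt ℂ r 0 := by
    have := hha.analyticAt_localInverse hd'
    rwa [h0] at this
  have hr0 : r 0 = 0 := by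
    have : r (h 0) = 0 :=
      (HasStrictDerivAt.eventually_left_inverse hha.hasStrictDerivAt hd').self_of_nhds
    rwa [h0] at this
  have hright : ∀ᶠ x in 𝓝 (0 : ℂ), h (r x) = x := by
    have := HasStrictDerivAt.eventually_right_inverse hha.hasStrictDerivAt hd'
    rwa [h0] at this
  have hPra : AnalyticAt ℂ (fun x => P (r x)) 0 := by
    apply AnalyticAt.fun_comp _ hra
    rw [hr0]; exact hPa
  refine ⟨fun x => P (r x), hPra, by simp only [hr0, hP0], ?_⟩
  have hne : ∀ᶠ x in 𝓝 (0 : ℂ), P (r x) ≠ 0 :=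
    hPra.continuousAt.eventually_ne (by rw [hr0, hP0]; exact one_ne_zero)
  filter_upwards [hright, hne] with x hx hx'
  have hxr : x * P (r x) = r x := by
    have h3 : r x / P (r x) = x := hx
    rw [div_eq_iff hx'] at h3
    exact h3.symm
  have hsum : ∑ n, ζ n * x ^ e n * P (r x) ^ e n = ∑ n, ζ n * (r x) ^ e n := by
    refine Finset.sum_congr rfl fun n _ => ?_
    rw [mul_assoc, ← mul_pow, hxr]
  simp only [charPoly, hsum]
  simp only [hP]
  ring

/-- Two representatives of the Taylor branch agree near `0`. -/
theorem IsTaylorBranch.eventuallyEq {N : ℕ} {e : Fin N → ℕ} (he : ∀ n, e n ≠ 0)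
    {ζ : Fin N → ℂ} {g₁ g₂ : ℂ → ℂ} (h₁ : IsTaylorBranch e ζ g₁) (h₂ : IsTaylorBranch e ζ g₂) :
    g₁ =ᶠ[𝓝 0] g₂ := by
  set k : ℂ → ℂ := fun x => ∑ n, ζ n * x ^ e n *
    ∑ i ∈ Finset.range (e n), g₁ x ^ i * g₂ x ^ (e n - 1 - i) with hk
  have hkc : ContinuousAt k 0 := by
    have a := h₁.1.continuousAt
    have b := h₂.1.continuousAt
    rw [hk]; fun_prop
  have hk0 : k 0 = 0 := by simp [hk, he]
  have hne : ∀ᶠ x in 𝓝 (0 : ℂ), k x ≠ 1 :=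
    hkc.eventually_ne (by rw [hk0]; exact zero_ne_one)
  filter_upwards [h₁.2.2, h₂.2.2, hne] with x e₁ e₂ hx
  have hsum : k x * (g₁ x - g₂ x) =
      ∑ n, ζ n * x ^ e n * g₁ x ^ e n - ∑ n, ζ n * x ^ e n * g₂ x ^ e n := by
    rw [hk, Finset.sum_mul, ← Finset.sum_sub_distrib]
    refine Finset.sum_congr rfl fun n _ => ?_
    rw [mul_assoc, (Commute.all (g₁ x) (g₂ x)).geom_sum₂_mul]
    ring
  simp only [charPoly] at e₁ e₂
  have : (k x - 1) * (g₁ x - g₂ x) = 0 := by linear_combination hsum + e₂ - e₁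
  rcases mul_eq_zero.1 this with h | h
  · exact absurd (sub_eq_zero.1 h) hx
  · exact sub_eq_zero.1 h

open Classical in
/-- A representative of the germ at `0` of the Taylor branch `U(·; ζ)`; by `exists_isTaylorBranch`
and `IsTaylorBranch.eventuallyEq` the germ exists and is unique when the exponents are positive. -/
def taylorBranch {N : ℕ} (e : Fin N → ℕ) (ζ : Fin N → ℂ) : ℂ → ℂ :=
  if h : ∃ g, IsTaylorBranch e ζ g then h.choose else 1

theorem taylorBranch_spec {N : ℕ} (e : Fin N → ℕ) (he : ∀ n, e n ≠ 0) (ζ : Fin N → ℂ) :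
    IsTaylorBranch e ζ (taylorBranch e ζ) := by
  have h := exists_isTaylorBranch e he ζ
  rw [taylorBranch, dif_pos h]
  exact h.choose_spec

/-- The coefficient `R_p(m; ζ) = [x^{ms}] U(x; ζ)^p`. -/
def branchCoeff {N : ℕ} (e : Fin N → ℕ) (ζ : Fin N → ℂ) (p m : ℕ) : ℂ :=
  iteratedDeriv (m * symIndex e) (fun x => taylorBranch e ζ x ^ p) 0 /
    ((m * symIndex e).factorial : ℂ)

/-! ### Radius of analyticity, dominant orbit, critical points -/

/-- `g` is an analytic continuation of the Taylor branch to the set `D` (in all uses `D` is a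
connected open set containing `0`, or empty). -/
def IsTaylorSheetOn {N : ℕ} (e : Fin N → ℕ) (ζ : Fin N → ℂ) (D : Set ℂ) (g : ℂ → ℂ) : Prop :=
  IsTaylorBranch e ζ g ∧ AnalyticOnNhd ℂ g D

/-- The radius `ρ_*(ζ) ∈ [0, ∞]` of the largest disk around `0` on which the Taylor branch is
analytic. -/
def analyticRadius {N : ℕ} (e : Fin N → ℕ) (ζ : Fin N → ℂ) : ℝ≥0∞ :=
  ⨆ (r : ℝ≥0) (_ : ∃ g, IsTaylorSheetOn e ζ (ball 0 (r : ℝ)) g), (r : ℝ≥0∞)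

/-- `ξ` (a point of the boundary circle of the disk of analyticity) is a singular point of the
Taylor sheet: the branch does not continue analytically from the disk across `ξ`. -/
def IsSingularPoint {N : ℕ} (e : Fin N → ℕ) (ζ : Fin N → ℂ) (ξ : ℂ) : Prop :=
  ¬ ∃ r > 0, ∃ g, IsTaylorSheetOn e ζ (ball 0 ‖ξ‖ ∪ ball ξ r) g

/-- The analytic boundary is dominant modulo the `s`-symmetry, with representative `x`: one has
`|x| = ρ_*(ζ)`, and the singular points of the Taylor sheet on the circle of radius `ρ_*(ζ)` are
exactly the points `e^{2πij/s} x`, `0 ≤ j < s`. -/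
def HasDominantOrbit {N : ℕ} (e : Fin N → ℕ) (ζ : Fin N → ℂ) (x : ℂ) : Prop :=
  analyticRadius e ζ = ENNReal.ofReal ‖x‖ ∧
    ∀ ξ : ℂ, ‖ξ‖ = ‖x‖ →
      (IsSingularPoint e ζ ξ ↔ ∃ j < symIndex e,
        ξ = Complex.exp (2 * Real.pi * Complex.I * (j : ℂ) / (symIndex e : ℂ)) * x)

/-- `lam` is the finite branch value of the Taylor sheet at the boundary point `x`, i.e. the limit
of `U(·; ζ)` at `x`. -/
def IsBranchValue {N : ℕ} (e : Fin N → ℕ) (ζ : Fin N → ℂ) (x lam : ℂ) : Prop :=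
  ∃ g, IsTaylorSheetOn e ζ (ball 0 ‖x‖) g ∧ Tendsto g (𝓝[ball 0 ‖x‖] x) (𝓝 lam)

/-- `(lam, x)` solves the characteristic system `F = ∂_y F = 0` and is simple: `∂_y² F ≠ 0`. -/
def IsSimpleCharacteristic {N : ℕ} (e : Fin N → ℕ) (ζ : Fin N → ℂ) (x lam : ℂ) : Prop :=
  charPoly e ζ lam x = 0 ∧
    deriv (fun y => charPoly e ζ y x) lam = 0 ∧
    iteratedDeriv 2 (fun y => charPoly e ζ y x) lam ≠ 0

/-- `ζ` is a simple critical point, with representative `x` of the dominant orbit and branch value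
`lam`: `ρ_*(ζ) = 1`, there is a unique dominant `s`-orbit, and `(lam, x)` is a simple solution of the
characteristic system. -/
def IsSimpleCritical {N : ℕ} (e : Fin N → ℕ) (ζ : Fin N → ℂ) (x lam : ℂ) : Prop :=
  analyticRadius e ζ = 1 ∧ HasDominantOrbit e ζ x ∧ IsBranchValue e ζ x lam ∧
    IsSimpleCharacteristic e ζ x lam

/-! ### The critical approach -/

/-- The indented disk `{|w| < |z| + η, w ≠ z, |arg(w/z - 1)| > φ}`: a disk slightly larger than
`|w| ≤ |z|`, with the outward sector of half-opening `φ` and apex `z` removed. -/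
def indentedDisk (z : ℂ) (φ η : ℝ) : Set ℂ :=
  {w | ‖w‖ < ‖z‖ + η ∧ w ≠ z ∧ φ < |Complex.arg (w / z - 1)|}

/-- Uniform square-root continuation along the path `ζ(ε)`.  Here `xs ε` is the representative
dominant singularity, `lam ε` the branch value, `κ ε` the square-root coefficient (in the
`x`-variable), `z_*(ε) = (xs ε)^s`, and `W` is the Taylor sheet written in the variable `z = x^s`. -/
def UniformSqrtContinuation {N : ℕ} (e : Fin N → ℕ) (ζ : ℝ → Fin N → ℂ)
    (xs lam κ : ℝ → ℂ) : Prop :=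
  ∃ ε₀ φ η₀ M C₀ c₀ : ℝ, 0 < ε₀ ∧ 0 < φ ∧ φ < Real.pi / 2 ∧ 0 < η₀ ∧ 0 < C₀ ∧ 0 < c₀ ∧
    ∀ ε ∈ Set.Ioo 0 ε₀, ∃ (W : ℂ → ℂ) (c d : ℂ),
      (∀ᶠ x in 𝓝 (0 : ℂ), W (x ^ symIndex e) = taylorBranch e (ζ ε) x) ∧
      DiffContOnCl ℂ W (indentedDisk (xs ε ^ symIndex e) φ (η₀ / 2)) ∧
      (∀ z ∈ frontier (indentedDisk (xs ε ^ symIndex e) φ (η₀ / 2)), ‖W z‖ ≤ M) ∧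
      c₀ ≤ ‖lam ε‖ ∧ c₀ ≤ ‖κ ε‖ ∧ ‖lam ε‖ + ‖κ ε‖ + ‖c‖ + ‖d‖ ≤ C₀ ∧
      ∀ z ∈ indentedDisk (xs ε ^ symIndex e) φ (η₀ / 2), ∀ δ : ℂ,
        δ = 1 - z / xs ε ^ symIndex e → ‖δ‖ < η₀ →
        ‖W z - (lam ε + ((Real.sqrt (symIndex e))⁻¹ : ℝ) * κ ε * δ ^ (1 / 2 : ℂ) + c * δ
            + d * δ ^ (3 / 2 : ℂ))‖ ≤ C₀ * ‖δ‖ ^ 2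

/-- The standing hypotheses on the critical approach `ε ↦ ζ(ε)`, `0 ≤ ε < ε₁`, with
`ρ_*(ζ(ε)) = 1 + ε`. -/
structure CriticalApproach {N : ℕ} (e : Fin N → ℕ) (ζ : ℝ → Fin N → ℂ)
    (xs lam κ : ℝ → ℂ) (ε₁ : ℝ) : Prop where
  eps_pos : 0 < ε₁
  path_contDiff : ContDiffOn ℝ 1 ζ (Set.Ico 0 ε₁)
  rep_contDiff : ContDiffOn ℝ 1 xs (Set.Ico 0 ε₁)
  critical : IsSimpleCritical e (ζ 0) (xs 0) (lam 0)
  radius : ∀ ε ∈ Set.Ioo 0 ε₁, analyticRadius e (ζ ε) = ENNReal.ofReal (1 + ε)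
  dominant : ∀ ε ∈ Set.Ioo 0 ε₁, HasDominantOrbit e (ζ ε) (xs ε)
  branchValue : ∀ ε ∈ Set.Ioo 0 ε₁, IsBranchValue e (ζ ε) (xs ε) (lam ε)
  simple : ∀ ε ∈ Set.Ioo 0 ε₁, IsSimpleCharacteristic e (ζ ε) (xs ε) (lam ε)
  continuation : UniformSqrtContinuation e ζ xs lam κ

/-- The radius `ρ_*(ζ)` as a real number. -/
def rhoStar {N : ℕ} (e : Fin N → ℕ) (ζ : Fin N → ℂ) : ℝ := (analyticRadius e ζ).toReal

/-- The midpoint radius `ρ = (1 + ρ_*) / 2`. -/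
def midRadius {N : ℕ} (e : Fin N → ℕ) (ζ : Fin N → ℂ) : ℝ := (1 + rhoStar e ζ) / 2

/-- `η = (ρ ρ_*)^{-2s}`, where `ρ` is the midpoint radius. -/
def etaCut {N : ℕ} (e : Fin N → ℕ) (ζ : Fin N → ℂ) : ℝ :=
  ((midRadius e ζ * rhoStar e ζ) ^ (2 * symIndex e))⁻¹

/-- The logarithmic scale `L = ∑_{m ≥ 0} η^m / (m + 1)`. -/
def logScale {N : ℕ} (e : Fin N → ℕ) (ζ : Fin N → ℂ) : ℝ :=
  ∑' m : ℕ, etaCut e ζ ^ m / ((m : ℝ) + 1)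

/-! ### Renormalized Gram blocks -/

/-- The exponential weight `α` is admissible: `α > max {M₀, L₀}`, where, for all small `ε > 0`,
`M₀` bounds `|U(·; ζ(ε))|` on the midpoint circle and `L₀` bounds the branch value `lam ε`. -/
def AdmissibleWeight {N : ℕ} (e : Fin N → ℕ) (ζ : ℝ → Fin N → ℂ) (lam : ℝ → ℂ) (α : ℝ) : Prop :=
  ∃ M₀ L₀ ε₀ : ℝ, 0 < ε₀ ∧ max M₀ L₀ < α ∧ ∀ ε ∈ Set.Ioo 0 ε₀,
    (∃ g, IsTaylorSheetOn e (ζ ε) (ball 0 (rhoStar e (ζ ε))) g ∧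
      ∀ x ∈ sphere (0 : ℂ) (midRadius e (ζ ε)), ‖g x‖ ≤ M₀) ∧
    ‖lam ε‖ ≤ L₀

/-- `p_j = q + j s`. -/
def blockIndex (s q j : ℕ) : ℕ := q + j * s

/-- The weight `w_j = p_j^{3/2+β} α^{p_j}`. -/
def weight (s q : ℕ) (β α : ℝ) (j : ℕ) : ℝ :=
  (blockIndex s q j : ℝ) ^ (3 / 2 + β) * α ^ blockIndex s q j

/-- The Gram vector entry `v^{(p)}_j`, for `p ≡ q` modulo `s`. -/
def gramVector {N : ℕ} (e : Fin N → ℕ) (ζ : Fin N → ℂ) (q p j : ℕ) : ℂ :=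
  if p ≤ blockIndex (symIndex e) q j then
    ((blockIndex (symIndex e) q j / Real.sqrt p : ℝ) : ℂ) *
      branchCoeff e ζ p ((blockIndex (symIndex e) q j - p) / symIndex e)
  else 0

/-- `T` is the bounded extension to `ℓ²(ℕ₀)` of the renormalized synthesis operator
`Ṽ = V 𝒲⁻¹`, whose `k`-th column is `v^{(p_k)} / w_k`.  (A bounded operator is determined by its
values on the standard basis.) -/
def IsRenormalizedSynthesis {N : ℕ} (e : Fin N → ℕ) (ζ : Fin N → ℂ) (q : ℕ) (β α : ℝ)
    (T : EllTwo →L[ℂ] EllTwo) : Prop :=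
  ∀ k j : ℕ, T (lp.single 2 k (1 : ℂ)) j =
    gramVector e ζ q (blockIndex (symIndex e) q k) j / (weight (symIndex e) q β α k : ℂ)

/-- `G` is the renormalized Gram block `G̃ = Ṽ* Ṽ`. -/
def IsRenormalizedGram {N : ℕ} (e : Fin N → ℕ) (ζ : Fin N → ℂ) (q : ℕ) (β α : ℝ)
    (G : EllTwo →L[ℂ] EllTwo) : Prop :=
  ∃ T : EllTwo →L[ℂ] EllTwo, IsRenormalizedSynthesis e ζ q β α T ∧
    G = (ContinuousLinearMap.adjoint T).comp T

/-- The transfer amplitude `-(s^{-1/2} / (2√π)) p κ λ^{p-1}`, for `p ≥ 1`. -/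
def transferAmplitude (s : ℕ) (κ lam : ℂ) (p : ℕ) : ℂ :=
  -((((Real.sqrt s)⁻¹ / (2 * Real.sqrt Real.pi) : ℝ) : ℂ)) * p * κ * lam ^ (p - 1)

/-- `A` is the amplitude in `R_p(m; ζ) ~ A m^{-3/2} x^{-ms}`, `m → ∞`. -/
def HasTransferAsymptotics {N : ℕ} (e : Fin N → ℕ) (ζ : Fin N → ℂ) (x : ℂ) (p : ℕ)
    (A : ℂ) : Prop :=
  Tendsto (fun m : ℕ => branchCoeff e ζ p m * x ^ (m * symIndex e) *
    (((m : ℝ) ^ (3 / 2 : ℝ) : ℝ) : ℂ)) atTop (𝓝 A)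

/-- The spike entry `e^{-ijϕ} (s / √p_j) conj(A_{p_j}) / w_j`, where `e^{iϕ} = z / |z|`. -/
def spikeEntry (s q : ℕ) (β α : ℝ) (z : ℂ) (A : ℕ → ℂ) (j : ℕ) : ℂ :=
  (starRingEnd ℂ (z / (‖z‖ : ℂ))) ^ j * ((s / Real.sqrt (blockIndex s q j) : ℝ) : ℂ) *
    starRingEnd ℂ (A (blockIndex s q j)) / (weight s q β α j : ℂ)

end TodaGram

end

/-!
The columns of the synthesis operator are all close to multiples of one common sequence
`h_j = z_*^{-j} (j+1)^{-1/2}`, whose squared norm is the divergent factor `L(ε)` up to a bounded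
amount.  If `T = h ⊗ d + E` with `E` small, then
`T* T = ‖h‖² d ⊗ d + d ⊗ E*h + E*h ⊗ d + E* E`, so it suffices that `E` is bounded and that its
columns have bounded overlaps with `h` although `‖h‖` diverges (`exists_gram_decomposition`).  Both
follow once the `k`-th column of `E` is `O(B_k / (j+1))` with `∑ B_k < ∞`, that is, once each
column of `T` is known with half a power of decay to spare, with a loss in `k` that the exponential
weight `α^{p_k}` absorbs (`norm_column_sub_le`, `exists_renormalizedGram`).

The analytic input is therefore a transfer estimate with an error `O(ν^p (m+1)^{-2})` for the
coefficients of all powers `U^p`, uniform in `ε`, with a fixed `ν < α`.  No contour integral is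
needed: since the square-root expansion is given up to `O(δ²)`, subtracting from the `p`-th power
its explicit part in `1, δ^{1/2}, δ, δ^{3/2}` leaves a function which is `O(ν^p δ²)` on the indented
disk.  Cauchy's estimate on disks of radius proportional to `|δ|` bounds its second derivative on
the unit disk, hence its coefficients by a multiple of `(m+1)^{-2}`
(`exists_norm_taylorCoeff_le`).  The explicit part is handled by Wallis' inequalities
(`norm_taylorCoeff_sqrt_add_le`).  The growth in `p` is controlled by a submultiplicative majorant
norm on jets (`exists_jet_pow`) near the singular point, and away from it by the Schwarz lemma,
which carries the bound `M₀` on the midpoint circle to a slightly larger domain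
(`exists_norm_le_of_circle`).

The limits of `λ(ε)` and `κ(ε)` do not require solving the characteristic system.  The Taylor
coefficients of `U` depend continuously on `ζ`, so the sheets converge inside the open disk, and the
uniform expansion reads off `λ` and `κ` from the value of the sheet at one point close to the
singularity, with an error as small as desired
(`CriticalApproach.tendsto_lam_kappa`).
-/

namespace TodaGram

/-! ### Taylor coefficients -/

/-- The `n`-th Taylor coefficient of `f` at the origin. -/
noncomputable def taylorCoeff (f : ℂ → ℂ) (n : ℕ) : ℂ := iteratedDeriv n f 0 / (n.factorial : ℂ)

theorem hasSum_taylorCoeff {f : ℂ → ℂ} (hf : AnalyticAt ℂ f 0) :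
    ∀ᶠ x in 𝓝 (0 : ℂ), HasSum (fun n => taylorCoeff f n * x ^ n) (f x) := by
  have := hasFPowerSeriesAt_iff.1 hf.hasFPowerSeriesAt
  filter_upwards [this] with x hx
  simpa [taylorCoeff, mul_comm] using hx

theorem hasSum_taylorCoeff_of_ball {f : ℂ → ℂ} {r : ℝ} (hf : DifferentiableOn ℂ f (ball 0 r))
    {x : ℂ} (hx : x ∈ ball (0 : ℂ) r) : HasSum (fun n => taylorCoeff f n * x ^ n) (f x) := by
  have := Complex.hasSum_taylorSeries_on_ball hf hx
  refine this.congr_fun ?_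
  intro n
  simp [taylorCoeff]; ring

theorem taylorCoeff_eq_of_hasSum {f : ℂ → ℂ} {a : ℕ → ℂ}
    (h : ∀ᶠ x in 𝓝 (0 : ℂ), HasSum (fun n => a n * x ^ n) (f x)) (n : ℕ) :
    taylorCoeff f n = a n := by
  have h1 : HasFPowerSeriesAt f (FormalMultilinearSeries.ofScalars ℂ a) 0 := by
    rw [hasFPowerSeriesAt_iff]
    filter_upwards [h] with x hx
    simpa [mul_comm] using hx
  have h2 := h1.eq_formalMultilinearSeries h1.analyticAt.hasFPowerSeriesAt
  have h3 := congrArg (fun p => FormalMultilinearSeries.coeff p n) h2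
  simpa [taylorCoeff] using h3.symm

theorem taylorCoeff_congr {f g : ℂ → ℂ} (h : f =ᶠ[𝓝 0] g) (n : ℕ) :
    taylorCoeff f n = taylorCoeff g n := by
  rw [taylorCoeff, taylorCoeff, h.iteratedDeriv_eq n]

theorem taylorCoeff_add {f g : ℂ → ℂ} (hf : AnalyticAt ℂ f 0) (hg : AnalyticAt ℂ g 0) (n : ℕ) :
    taylorCoeff (fun x => f x + g x) n = taylorCoeff f n + taylorCoeff g n := by
  apply taylorCoeff_eq_of_hasSum
  filter_upwards [hasSum_taylorCoeff hf, hasSum_taylorCoeff hg] with x h1 h2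
  simpa [add_mul] using h1.add h2

theorem taylorCoeff_const_mul (c : ℂ) (f : ℂ → ℂ) (n : ℕ) :
    taylorCoeff (fun x => c * f x) n = c * taylorCoeff f n := by
  rw [taylorCoeff, taylorCoeff, iteratedDeriv_const_mul_field, mul_div_assoc]

theorem taylorCoeff_comp_const_mul {f : ℂ → ℂ} (hf : AnalyticAt ℂ f 0) (z : ℂ) (n : ℕ) :
    taylorCoeff (fun x => f (z * x)) n = z ^ n * taylorCoeff f n := by
  apply taylorCoeff_eq_of_hasSum
  have ht : Tendsto (fun x : ℂ => z * x) (𝓝 0) (𝓝 0) := by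
    have : Continuous (fun x : ℂ => z * x) := by fun_prop
    simpa using this.tendsto 0
  filter_upwards [ht.eventually (hasSum_taylorCoeff hf)] with x hx
  refine hx.congr_fun ?_
  intro n; ring

theorem taylorCoeff_comp_pow {f : ℂ → ℂ} (hf : AnalyticAt ℂ f 0) {s : ℕ} (hs : s ≠ 0) (n : ℕ) :
    taylorCoeff (fun x => f (x ^ s)) (n * s) = taylorCoeff f n := by
  have ht : Tendsto (fun x : ℂ => x ^ s) (𝓝 0) (𝓝 0) := by
    have : Continuous (fun x : ℂ => x ^ s) := by fun_prop
    simpa [hs] using this.tendsto 0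
  have hinj : Function.Injective (fun n : ℕ => n * s) := fun a b h =>
    Nat.eq_of_mul_eq_mul_right (Nat.pos_of_ne_zero hs) h
  rw [taylorCoeff_eq_of_hasSum (a := fun k => if s ∣ k then taylorCoeff f (k / s) else 0)]
  · simp [Nat.pos_of_ne_zero hs]
  · filter_upwards [ht.eventually (hasSum_taylorCoeff hf)] with x hx
    rw [← hinj.hasSum_iff]
    · refine hx.congr_fun ?_
      intro n
      simp [Nat.pos_of_ne_zero hs, ← pow_mul, mul_comm]
    · intro k hk
      have : ¬ s ∣ k := fun ⟨c, hc⟩ => hk ⟨c, by simp [hc, mul_comm]⟩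
      simp [this]

/-! ### Binomial coefficients of the square root -/

theorem iteratedDeriv_one_sub_cpow (a : ℂ) (n : ℕ) :
    iteratedDeriv n (fun u : ℂ => (1 - u) ^ a) =ᶠ[𝓝 0]
      fun u => (∏ i ∈ Finset.range n, ((i : ℂ) - a)) * (1 - u) ^ (a - n) := by
  induction n with
  | zero => exact Eventually.of_forall fun u => by simp
  | succ n ih =>
    rw [iteratedDeriv_succ]
    refine ih.deriv.trans ?_
    filter_upwards [ball_mem_nhds (0 : ℂ) one_pos] with u hu
    have hs : 1 - u ∈ Complex.slitPlane := by
      have := Complex.mem_slitPlane_of_norm_lt_one (z := -u) (by simpa using hu)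
      simpa [sub_eq_add_neg] using this
    have h1 : HasDerivAt (fun u : ℂ => 1 - u) (-1) u := by
      simpa using (hasDerivAt_id u).const_sub 1
    have h2 := (h1.cpow_const (c := a - n) hs).const_mul (∏ i ∈ Finset.range n, ((i : ℂ) - a))
    rw [h2.deriv, Finset.prod_range_succ]
    have : a - (n : ℂ) - 1 = a - ((n + 1 : ℕ) : ℂ) := by push_cast; ring
    rw [this]; ring

theorem taylorCoeff_one_sub_cpow (a : ℂ) (n : ℕ) :
    taylorCoeff (fun u : ℂ => (1 - u) ^ a) n =
      (∏ i ∈ Finset.range n, ((i : ℂ) - a)) / (n.factorial : ℂ) := by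
  rw [taylorCoeff, (iteratedDeriv_one_sub_cpow a n).self_of_nhds]
  simp

/-- The normalized central binomial coefficient `4⁻ⁿ (2n choose n) = ∏_{i<n} (2i+1)/(2i+2)`. -/
noncomputable def wallisRatio (n : ℕ) : ℝ := ∏ i ∈ Finset.range n, ((2 * i + 1 : ℝ) / (2 * i + 2))

theorem wallisRatio_pos (n : ℕ) : 0 < wallisRatio n :=
  Finset.prod_pos fun i _ => by positivity

theorem wallisRatio_le_one (n : ℕ) : wallisRatio n ≤ 1 :=
  Finset.prod_le_one (fun i _ => by positivity) fun i _ => by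
    rw [div_le_one (by positivity)]; linarith

theorem wallisRatio_sq_mul_W (n : ℕ) :
    wallisRatio n ^ 2 * (2 * n + 1) * Real.Wallis.W n = 1 := by
  induction n with
  | zero => simp [wallisRatio, Real.Wallis.W]
  | succ n ih =>
    rw [Real.Wallis.W_succ]
    have : wallisRatio (n + 1) = wallisRatio n * ((2 * n + 1 : ℝ) / (2 * n + 2)) := by
      rw [wallisRatio, wallisRatio, Finset.prod_range_succ]
    rw [this]
    push_cast
    have h1 : (2 * (n : ℝ) + 1) ≠ 0 := by positivity
    have h2 : (2 * (n : ℝ) + 2) ≠ 0 := by positivity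
    have h3 : (2 * (n : ℝ) + 3) ≠ 0 := by positivity
    have e : (wallisRatio n * ((2 * n + 1 : ℝ) / (2 * n + 2))) ^ 2 * (2 * ((n : ℝ) + 1) + 1) *
        (Real.Wallis.W n * ((2 * n + 2) / (2 * n + 1) * ((2 * n + 2) / (2 * n + 3)))) =
        wallisRatio n ^ 2 * (2 * n + 1) * Real.Wallis.W n := by
      field_simp
      ring
    rw [e, ih]

theorem taylorCoeff_sqrt_succ (n : ℕ) :
    taylorCoeff (fun u : ℂ => (1 - u) ^ (1 / 2 : ℂ)) (n + 1) =
      ((-(wallisRatio n / (2 * (n + 1))) : ℝ) : ℂ) := by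
  rw [taylorCoeff_one_sub_cpow]
  induction n with
  | zero => simp [wallisRatio]
  | succ n ih =>
    rw [Finset.prod_range_succ, Nat.factorial_succ]
    have : wallisRatio (n + 1) = wallisRatio n * ((2 * n + 1 : ℝ) / (2 * n + 2)) := by
      rw [wallisRatio, wallisRatio, Finset.prod_range_succ]
    rw [this]
    have h0 : ((n + 1).factorial : ℂ) ≠ 0 := by exact_mod_cast Nat.factorial_ne_zero _
    have h1 : ((n : ℂ) + 1 + 1) ≠ 0 := by exact_mod_cast Nat.succ_ne_zero (n + 1)
    have h2 : ((n : ℂ) + 1) ≠ 0 := by exact_mod_cast Nat.succ_ne_zero n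
    rw [div_eq_iff h0] at ih
    rw [ih]
    have h3 : (2 * (n : ℂ) + 2) ≠ 0 := by
      have : (2 * (n : ℂ) + 2) = 2 * ((n : ℂ) + 1) := by ring
      rw [this]; exact mul_ne_zero two_ne_zero h2
    push_cast
    field_simp
    ring

theorem norm_taylorCoeff_sqrt_le (n : ℕ) :
    ‖taylorCoeff (fun u : ℂ => (1 - u) ^ (1 / 2 : ℂ)) n‖ ≤ 1 / (n + 1) := by
  rcases n with _ | n
  · rw [taylorCoeff_one_sub_cpow]; simp
  · rw [taylorCoeff_sqrt_succ, Complex.norm_real, norm_neg, Real.norm_eq_abs,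
      abs_of_nonneg (by have := wallisRatio_pos n; positivity)]
    have := wallisRatio_le_one n
    rw [div_le_div_iff₀ (by positivity) (by positivity)]
    push_cast
    have hn : (0 : ℝ) ≤ n := Nat.cast_nonneg n
    nlinarith [wallisRatio_pos n]

theorem norm_taylorCoeff_three_halves_le (n : ℕ) :
    ‖taylorCoeff (fun u : ℂ => (1 - u) ^ (3 / 2 : ℂ)) n‖ ≤ 6 / ((n : ℝ) + 1) ^ 2 := by
  rcases n with _ | n
  · rw [taylorCoeff_one_sub_cpow]; simp
  · have h : taylorCoeff (fun u : ℂ => (1 - u) ^ (3 / 2 : ℂ)) (n + 1) =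
        -(3 / 2) / (n + 1) * taylorCoeff (fun u : ℂ => (1 - u) ^ (1 / 2 : ℂ)) n := by
      rw [taylorCoeff_one_sub_cpow, taylorCoeff_one_sub_cpow, Finset.prod_range_succ',
        Nat.factorial_succ]
      have : ∀ i : ℕ, ((i + 1 : ℕ) : ℂ) - 3 / 2 = (i : ℂ) - 1 / 2 := by
        intro i; push_cast; ring
      simp only [this]
      have h0 : (n.factorial : ℂ) ≠ 0 := by exact_mod_cast Nat.factorial_ne_zero _
      have h2 : ((n : ℂ) + 1) ≠ 0 := by exact_mod_cast Nat.succ_ne_zero n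
      push_cast
      field_simp
      ring_nf
    have h2 : ‖(-(3 / 2) / (n + 1) : ℂ)‖ = 3 / 2 / ((n : ℝ) + 1) := by
      rw [norm_div, norm_neg]
      congr 1
      · norm_num
      · exact_mod_cast Complex.norm_natCast (n + 1)
    rw [h, norm_mul, h2]
    refine (mul_le_mul_of_nonneg_left (norm_taylorCoeff_sqrt_le n) (by positivity)).trans ?_
    rw [div_mul_div_comm, div_le_div_iff₀ (by positivity) (by positivity)]
    push_cast
    have hn : (0 : ℝ) ≤ n := Nat.cast_nonneg n
    nlinarith

/-- The decay profile `(m+1)^{-3/2}` of the coefficients of a square-root singularity. -/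
noncomputable def sqrtDecay (m : ℕ) : ℝ := 1 / (((m : ℝ) + 1) * Real.sqrt (m + 1))

theorem abs_wallisRatio_sub_le (n : ℕ) :
    |wallisRatio n - 1 / (Real.sqrt Real.pi * Real.sqrt (n + 2))| ≤ 16 / ((n : ℝ) + 2) := by
  have hn : (0 : ℝ) ≤ n := Nat.cast_nonneg n
  set x := wallisRatio n with hx
  set P := Real.sqrt Real.pi with hP
  set S := Real.sqrt ((n : ℝ) + 2) with hS
  have hx0 : 0 < x := wallisRatio_pos n
  have hP1 : 1 ≤ P := Real.one_le_sqrt.2 (by linarith [Real.pi_gt_three])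
  have hS1 : 1 ≤ S := Real.one_le_sqrt.2 (by linarith)
  have hP2 : P ^ 2 = Real.pi := Real.sq_sqrt Real.pi_pos.le
  have hS2 : S ^ 2 = n + 2 := Real.sq_sqrt (by linarith)
  have hW := wallisRatio_sq_mul_W n
  have hW1 := Real.Wallis.W_le n
  have hW2 := Real.Wallis.le_W n
  have hWpos := Real.Wallis.W_pos n
  rw [← hP2] at hW1 hW2
  have hx2 : x ^ 2 = 1 / ((2 * n + 1) * Real.Wallis.W n) := by
    rw [eq_div_iff (by positivity)]; linear_combination hW
  have hlow : 1 / (P * S) ≤ x := by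
    refine le_of_sq_le_sq ?_ hx0.le
    rw [hx2, div_pow, mul_pow, hS2, one_pow]
    refine one_div_le_one_div_of_le (by positivity) ?_
    nlinarith [mul_le_mul_of_nonneg_left hW1 (by positivity : (0 : ℝ) ≤ 2 * n + 1),
      sq_nonneg P]
  have hup : x ^ 2 ≤ 4 * (n + 1) / (P ^ 2 * (2 * n + 1) ^ 2) := by
    rw [hx2, div_le_div_iff₀ (by positivity) (by positivity)]
    rw [div_mul_eq_mul_div, div_le_iff₀ (by positivity)] at hW2
    nlinarith [mul_le_mul_of_nonneg_left hW2 (by positivity : (0 : ℝ) ≤ 2 * n + 1)]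
  have hdiff : x ^ 2 - (1 / (P * S)) ^ 2 ≤ 8 / (P ^ 2 * (2 * n + 1) * S ^ 2) := by
    have : 4 * ((n : ℝ) + 1) / (P ^ 2 * (2 * n + 1) ^ 2) ≤
        (1 / (P * S)) ^ 2 + 8 / (P ^ 2 * (2 * n + 1) * S ^ 2) := by
      have e : (1 / (P * S)) ^ 2 + 8 / (P ^ 2 * (2 * n + 1) * S ^ 2) =
          (2 * n + 9) / (P ^ 2 * (2 * n + 1) * S ^ 2) := by field_simp; ring
      rw [e, hS2, div_le_div_iff₀ (by positivity) (by positivity)]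
      have : (0 : ℝ) ≤ P ^ 2 * (2 * n + 1) := by positivity
      nlinarith [mul_nonneg this hn]
    linarith
  rw [abs_of_nonneg (by linarith)]
  have hmul : (x - 1 / (P * S)) * (1 / (P * S)) ≤ 8 / (P ^ 2 * (2 * n + 1) * S ^ 2) := by
    have hy : 0 < 1 / (P * S) := by positivity
    nlinarith [mul_nonneg (sub_nonneg.2 hlow) hx0.le]
  have hmul2 : x - 1 / (P * S) ≤ 8 / (P * (2 * n + 1) * S) := by
    have := mul_le_mul_of_nonneg_right hmul (by positivity : 0 ≤ P * S)
    have e1 : (x - 1 / (P * S)) * (1 / (P * S)) * (P * S) = x - 1 / (P * S) := by field_simp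
    have e2 : 8 / (P ^ 2 * (2 * n + 1) * S ^ 2) * (P * S) = 8 / (P * (2 * n + 1) * S) := by
      field_simp
    rwa [e1, e2] at this
  refine hmul2.trans ?_
  rw [div_le_div_iff₀ (by positivity) (by positivity)]
  have h1 : (2 * (n : ℝ) + 1) ≤ P * (2 * n + 1) * S := by
    have : 1 * (2 * (n : ℝ) + 1) * 1 ≤ P * (2 * n + 1) * S := by gcongr
    linarith
  linarith

/-- `[uᵐ] (1-u)^{1/2} = -(m+1)^{-3/2} / (2√π) + O((m+1)^{-2})`, from Wallis' inequalities. -/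
theorem norm_taylorCoeff_sqrt_add_le (m : ℕ) :
    ‖taylorCoeff (fun u : ℂ => (1 - u) ^ (1 / 2 : ℂ)) m +
      ((1 / (2 * Real.sqrt Real.pi) * sqrtDecay m : ℝ) : ℂ)‖ ≤ 20 / ((m : ℝ) + 1) ^ 2 := by
  have hP1 : 1 ≤ Real.sqrt Real.pi := Real.one_le_sqrt.2 (by linarith [Real.pi_gt_three])
  rcases m with _ | n
  · have h0 : taylorCoeff (fun u : ℂ => (1 - u) ^ (1 / 2 : ℂ)) 0 = 1 := by
      rw [taylorCoeff_one_sub_cpow]; simp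
    have h1 : sqrtDecay 0 = 1 := by simp [sqrtDecay]
    rw [h0, h1]
    refine (norm_add_le _ _).trans ?_
    rw [Complex.norm_real, Real.norm_eq_abs, abs_of_nonneg (by positivity), norm_one]
    have : 1 / (2 * Real.sqrt Real.pi) ≤ 1 := by
      rw [div_le_one (by positivity)]; linarith
    norm_num at this ⊢
    linarith
  · have hn : (0 : ℝ) ≤ n := Nat.cast_nonneg n
    have hS1 : 1 ≤ Real.sqrt ((n : ℝ) + 2) := Real.one_le_sqrt.2 (by linarith)
    have hc := abs_wallisRatio_sub_le n
    rw [taylorCoeff_sqrt_succ, ← Complex.ofReal_add, Complex.norm_real, Real.norm_eq_abs, sqrtDecay]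
    push_cast
    have e2 : (n : ℝ) + 1 + 1 = n + 2 := by ring
    rw [e2]
    set x := wallisRatio n
    set P := Real.sqrt Real.pi
    set S := Real.sqrt ((n : ℝ) + 2)
    have e : -(x / (2 * (n + 1))) + 1 / (2 * P) * (1 / ((n + 2) * S)) =
        -((x - 1 / (P * S)) / (2 * (n + 1))) - 1 / (P * S) / (2 * (n + 1) * (n + 2)) := by
      field_simp
      ring
    rw [e]
    refine (abs_sub _ _).trans ?_
    rw [abs_neg, abs_div, abs_of_pos (by positivity : (0 : ℝ) < 2 * (n + 1)),
      abs_of_pos (by positivity : (0 : ℝ) < 1 / (P * S) / (2 * (n + 1) * (n + 2)))]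
    have h1 : |x - 1 / (P * S)| / (2 * (n + 1)) ≤ 16 / ((n : ℝ) + 2) / (2 * (n + 1)) := by gcongr
    have h2 : 1 / (P * S) / (2 * (n + 1) * (n + 2)) ≤ 1 / (2 * ((n : ℝ) + 1) * (n + 2)) := by
      gcongr
      rw [div_le_one (by positivity)]
      nlinarith
    refine (add_le_add h1 h2).trans ?_
    have e3 : 16 / ((n : ℝ) + 2) / (2 * (n + 1)) + 1 / (2 * ((n : ℝ) + 1) * (n + 2)) =
        17 / (2 * ((n : ℝ) + 1) * (n + 2)) := by field_simp; ring
    rw [e3, div_le_div_iff₀ (by positivity) (by positivity)]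
    nlinarith

/-! ### Coefficient decay from growth at the singular point -/

/-- The disk of radius `1 + H` with the outward sector `re (u - 1) ≥ c ‖u - 1‖` at the point `1`
removed. -/
def sectorDisk (c H : ℝ) : Set ℂ := {u | ‖u‖ < 1 + H ∧ (u - 1).re < c * ‖u - 1‖}

theorem isOpen_sectorDisk (c H : ℝ) : IsOpen (sectorDisk c H) := by
  have h1 : Continuous fun u : ℂ => (u - 1).re := Complex.continuous_re.comp (by fun_prop)
  have h2 : Continuous fun u : ℂ => c * ‖u - 1‖ := by fun_prop
  exact (isOpen_lt continuous_norm continuous_const).inter (isOpen_lt h1 h2)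

theorem mem_sectorDisk_of_norm_lt_one {c H : ℝ} (hc : 0 < c) (hH : 0 < H) {u : ℂ}
    (hu : ‖u‖ < 1) : u ∈ sectorDisk c H := by
  refine ⟨by linarith, ?_⟩
  have h1 : (u - 1).re < 0 := by
    have := Complex.re_le_norm u
    simp; linarith
  have : 0 ≤ c * ‖u - 1‖ := by positivity
  linarith

theorem one_sub_mem_slitPlane {c H : ℝ} (hc : c < 1) {u : ℂ} (hu : u ∈ sectorDisk c H) :
    1 - u ∈ Complex.slitPlane := by
  have h := hu.2
  rw [Complex.mem_slitPlane_iff]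
  by_contra! hcon
  have h3 : ‖u - 1‖ = (u - 1).re := by
    rw [← Complex.abs_re_eq_norm.2 (by simpa using hcon.2)]
    exact abs_of_nonneg (by have := hcon.1; simp at this ⊢; linarith)
  rw [h3] at h
  have : 0 ≤ (u - 1).re := by rw [← h3]; exact norm_nonneg _
  nlinarith

theorem closedBall_subset_sectorDisk {c H : ℝ} (hc : 0 < c) (hc1 : c < 1) (hH : 0 < H) {u : ℂ}
    (hu : ‖u‖ < 1) {θ : ℝ} (hθc : θ ≤ c / 3) (hθH : θ ≤ H / 3) :
    closedBall u (θ * ‖1 - u‖) ⊆ sectorDisk c H := by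
  intro v hv
  rw [mem_closedBall, dist_eq_norm] at hv
  have hpos : 0 < ‖1 - u‖ := by
    rw [norm_pos_iff, sub_ne_zero]
    rintro rfl
    simp at hu
  have h2 : ‖1 - u‖ ≤ 2 := by
    have := norm_sub_le 1 u
    rw [norm_one] at this; linarith
  have h3 : ‖v - u‖ ≤ c / 3 * ‖1 - u‖ := hv.trans (by gcongr)
  have h4 : ‖v - u‖ ≤ H / 3 * ‖1 - u‖ := hv.trans (by gcongr)
  constructor
  · have : ‖v‖ ≤ ‖u‖ + ‖v - u‖ := by
      have := norm_add_le u (v - u); simpa using this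
    nlinarith
  · have h5 : ‖1 - u‖ ≤ ‖v - 1‖ + ‖v - u‖ := by
      have := norm_sub_le (v - u) (v - 1)
      have e : v - u - (v - 1) = 1 - u := by ring
      rw [e] at this; linarith
    have h6 : (v - 1).re ≤ (u - 1).re + ‖v - u‖ := by
      have := Complex.re_le_norm (v - u)
      simp at this ⊢; linarith
    have h7 : (u - 1).re < 0 := by
      have := Complex.re_le_norm u
      simp; linarith
    have h8 := mul_le_mul_of_nonneg_left h5 hc.le
    have h9 := mul_le_mul_of_nonneg_left h3 hc.le
    have h10 : c * (c / 3 * ‖1 - u‖) ≤ 1 * (c / 3 * ‖1 - u‖) := by gcongr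
    have h11 : 0 < c * ‖1 - u‖ := by positivity
    linarith

/-- If `g = O(|1-u|²)` on the indented disk, Cauchy's estimate on disks of radius proportional to
`|1-u|` bounds `g''` on the unit disk, and two integrations give coefficients `O((m+1)⁻²)`. -/
theorem exists_norm_taylorCoeff_le {c H : ℝ} (hc : 0 < c) (hc1 : c < 1) (hH : 0 < H) :
    ∃ K : ℝ, 0 < K ∧ ∀ (g : ℂ → ℂ) (B : ℝ), DifferentiableOn ℂ g (sectorDisk c H) → 0 ≤ B →
      (∀ u ∈ sectorDisk c H, ‖g u‖ ≤ B * ‖1 - u‖ ^ 2) →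
      ∀ m : ℕ, ‖taylorCoeff g m‖ ≤ K * B / ((m : ℝ) + 1) ^ 2 := by
  set θ := min (min (c / 3) (H / 3)) 1 with hθ
  have hθ0 : 0 < θ := by positivity
  have hθ1 : θ ≤ 1 := min_le_right _ _
  refine ⟨100 / θ ^ 2, by positivity, fun g B hg hB hgB m => ?_⟩
  have key : ∀ u : ℂ, ‖u‖ < 1 → ∀ k : ℕ,
      ‖iteratedDeriv k g u‖ ≤ k.factorial * (4 * B * ‖1 - u‖ ^ 2) / (θ * ‖1 - u‖) ^ k := by
    intro u hu k
    have hpos : 0 < ‖1 - u‖ := by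
      rw [norm_pos_iff, sub_ne_zero]
      rintro rfl
      simp at hu
    have hsub := closedBall_subset_sectorDisk hc hc1 hH hu
      (θ := θ) ((min_le_left _ _).trans (min_le_left _ _))
      ((min_le_left _ _).trans (min_le_right _ _))
    refine Complex.norm_iteratedDeriv_le_of_forall_mem_sphere_norm_le k (by positivity) ?_ ?_
    · exact DifferentiableOn.diffContOnCl_ball (U := sectorDisk c H) hg hsub
    · intro v hv
      refine (hgB v (hsub (sphere_subset_closedBall hv))).trans ?_
      have : ‖1 - v‖ ≤ 2 * ‖1 - u‖ := by
        have h1 := norm_sub_le (1 - u) (v - u)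
        rw [mem_sphere, dist_eq_norm] at hv
        have e : 1 - u - (v - u) = 1 - v := by ring
        rw [e, hv] at h1
        nlinarith
      calc B * ‖1 - v‖ ^ 2 ≤ B * (2 * ‖1 - u‖) ^ 2 := by gcongr
        _ = _ := by ring
  have hsmall : ∀ k : ℕ, k < 2 → ‖taylorCoeff g k‖ ≤ 100 / θ ^ 2 * B / ((k : ℝ) + 1) ^ 2 := by
    intro k hk
    have h0 := key 0 (by simp) k
    simp only [sub_zero, norm_one, mul_one, one_pow] at h0
    rw [taylorCoeff, norm_div, Complex.norm_natCast, div_le_iff₀ (by positivity)]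
    refine h0.trans ?_
    interval_cases k
    · norm_num
      have : B ≤ B / θ ^ 2 := by
        rw [le_div_iff₀ (by positivity)]
        nlinarith [pow_le_one₀ (n := 2) hθ0.le hθ1]
      have e : 100 / θ ^ 2 * B = 100 * (B / θ ^ 2) := by ring
      rw [e]
      nlinarith
    · norm_num
      have : B / θ ≤ B / θ ^ 2 := by
        gcongr
        nlinarith
      have e : 100 / θ ^ 2 * B / 4 = 25 * (B / θ ^ 2) := by ring
      have e2 : 4 * B / θ = 4 * (B / θ) := by ring
      rw [e, e2]
      have : 0 ≤ B / θ ^ 2 := by positivity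
      nlinarith
  rcases lt_or_ge m 2 with hm | hm
  · exact hsmall m hm
  obtain ⟨n, rfl⟩ := Nat.exists_eq_add_of_le' hm
  set B2 := 8 * B / θ ^ 2 with hB2
  have hB2' : 0 ≤ B2 := by positivity
  have h2 : ∀ u : ℂ, ‖u‖ < 1 → ‖iteratedDeriv 2 g u‖ ≤ B2 := by
    intro u hu
    have hpos : 0 < ‖1 - u‖ := by
      rw [norm_pos_iff, sub_ne_zero]
      rintro rfl
      simp at hu
    refine (key u hu 2).trans (le_of_eq ?_)
    rw [hB2, Nat.factorial_two]; push_cast; field_simp; ring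
  have hd2 : DifferentiableOn ℂ (iteratedDeriv 2 g) (ball 0 1) := by
    have ha : AnalyticOnNhd ℂ g (ball 0 1) :=
      (hg.mono fun u hu => mem_sectorDisk_of_norm_lt_one hc hH
        (by simpa using hu)).analyticOnNhd isOpen_ball
    rw [iteratedDeriv_eq_iterate]
    exact (ha.iterated_deriv 2).differentiableOn
  have h3 : ∀ r : ℝ, 0 < r → r < 1 →
      ‖iteratedDeriv n (iteratedDeriv 2 g) 0‖ * r ^ n ≤ n.factorial * B2 := by
    intro r hr hr1
    rw [← le_div_iff₀ (by positivity)]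
    refine Complex.norm_iteratedDeriv_le_of_forall_mem_sphere_norm_le n hr ?_ ?_
    · exact DifferentiableOn.diffContOnCl_ball hd2 (closedBall_subset_ball hr1)
    · intro v hv
      exact h2 v (by rw [mem_sphere_zero_iff_norm] at hv; linarith)
  have h4 : ‖iteratedDeriv n (iteratedDeriv 2 g) 0‖ ≤ n.factorial * B2 := by
    have ht : Tendsto (fun r : ℝ => ‖iteratedDeriv n (iteratedDeriv 2 g) 0‖ * r ^ n) (𝓝[<] 1)
        (𝓝 (‖iteratedDeriv n (iteratedDeriv 2 g) 0‖ * 1 ^ n)) :=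
      (Continuous.tendsto (by fun_prop) 1).mono_left nhdsWithin_le_nhds
    rw [one_pow, mul_one] at ht
    refine le_of_tendsto ht ?_
    filter_upwards [Ioo_mem_nhdsLT (show (0 : ℝ) < 1 by norm_num)] with r hr
    exact h3 r hr.1 hr.2
  have h5 : iteratedDeriv (n + 2) g 0 = iteratedDeriv n (iteratedDeriv 2 g) 0 := by
    simp only [iteratedDeriv_eq_iterate, Function.iterate_add_apply]
  rw [taylorCoeff, h5, norm_div, Complex.norm_natCast, div_le_iff₀ (by positivity)]
  refine h4.trans ?_
  rw [Nat.factorial_succ, Nat.factorial_succ, hB2]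
  push_cast
  have hf : (0 : ℝ) < n.factorial := by positivity
  have e : 100 / θ ^ 2 * B / ((n : ℝ) + 2 + 1) ^ 2 * ((n + 1 + 1) * ((n + 1) * n.factorial)) =
      n.factorial * (B / θ ^ 2) * (100 * ((n + 2) * (n + 1)) / ((n : ℝ) + 3) ^ 2) := by
    field_simp
    ring
  have e2 : (n.factorial : ℝ) * (8 * B / θ ^ 2) = n.factorial * (B / θ ^ 2) * 8 := by ring
  rw [e, e2]
  refine mul_le_mul_of_nonneg_left ?_ (by positivity)
  rw [le_div_iff₀ (by positivity)]
  have hn : (0 : ℝ) ≤ n := Nat.cast_nonneg n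
  nlinarith

/-! ### Square-root jets and their powers -/

/-- The majorant norm at radius `r` of a cubic jet in `t` with fourth-order error constant `E`.  It
is submultiplicative. -/
noncomputable def jetNorm (r : ℝ) (a₀ a₁ a₂ a₃ : ℂ) (E : ℝ) : ℝ :=
  ‖a₀‖ + ‖a₁‖ * r + ‖a₂‖ * r ^ 2 + ‖a₃‖ * r ^ 3 + E * r ^ 4

/-- Products of jets: the coefficients of order `0` and `1` are explicit, the remaining ones and the
error constant are controlled by the product of the majorant norms. -/
theorem exists_jet_mul {r : ℝ} (hr : 0 ≤ r) (a₀ a₁ a₂ a₃ b₀ b₁ b₂ b₃ : ℂ) {E F : ℝ} (hE : 0 ≤ E)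
    (hF : 0 ≤ F) : ∃ (c₂ c₃ : ℂ) (G : ℝ), 0 ≤ G ∧
      jetNorm r (a₀ * b₀) (a₀ * b₁ + a₁ * b₀) c₂ c₃ G ≤
        jetNorm r a₀ a₁ a₂ a₃ E * jetNorm r b₀ b₁ b₂ b₃ F ∧
      ∀ t x y : ℂ, ‖t‖ ≤ r → ‖x - (a₀ + a₁ * t + a₂ * t ^ 2 + a₃ * t ^ 3)‖ ≤ E * ‖t‖ ^ 4 →
        ‖y - (b₀ + b₁ * t + b₂ * t ^ 2 + b₃ * t ^ 3)‖ ≤ F * ‖t‖ ^ 4 →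
        ‖x * y - (a₀ * b₀ + (a₀ * b₁ + a₁ * b₀) * t + c₂ * t ^ 2 + c₃ * t ^ 3)‖ ≤
          G * ‖t‖ ^ 4 := by
  refine ⟨a₀ * b₂ + a₁ * b₁ + a₂ * b₀, a₀ * b₃ + a₁ * b₂ + a₂ * b₁ + a₃ * b₀,
    (‖a₁‖ * ‖b₃‖ + ‖a₂‖ * ‖b₂‖ + ‖a₃‖ * ‖b₁‖) + (‖a₂‖ * ‖b₃‖ + ‖a₃‖ * ‖b₂‖) * r +
      ‖a₃‖ * ‖b₃‖ * r ^ 2 + E * jetNorm r b₀ b₁ b₂ b₃ 0 + jetNorm r a₀ a₁ a₂ a₃ 0 * F +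
      E * F * r ^ 4, ?_, ?_, ?_⟩
  · unfold jetNorm; positivity
  · have h1 : ‖a₀ * b₁ + a₁ * b₀‖ ≤ ‖a₀‖ * ‖b₁‖ + ‖a₁‖ * ‖b₀‖ := by
      simpa using norm_add_le (a₀ * b₁) (a₁ * b₀)
    have h2 : ‖a₀ * b₂ + a₁ * b₁ + a₂ * b₀‖ ≤ ‖a₀‖ * ‖b₂‖ + ‖a₁‖ * ‖b₁‖ + ‖a₂‖ * ‖b₀‖ := by
      simpa using norm_add₃_le (a := a₀ * b₂) (b := a₁ * b₁) (c := a₂ * b₀)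
    have h3 : ‖a₀ * b₃ + a₁ * b₂ + a₂ * b₁ + a₃ * b₀‖ ≤
        ‖a₀‖ * ‖b₃‖ + ‖a₁‖ * ‖b₂‖ + ‖a₂‖ * ‖b₁‖ + ‖a₃‖ * ‖b₀‖ := by
      simpa using norm_add₄_le (a := a₀ * b₃) (b := a₁ * b₂) (c := a₂ * b₁) (d := a₃ * b₀)
    have h1' := mul_le_mul_of_nonneg_right h1 hr
    have h2' := mul_le_mul_of_nonneg_right h2 (pow_nonneg hr 2)
    have h3' := mul_le_mul_of_nonneg_right h3 (pow_nonneg hr 3)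
    unfold jetNorm
    rw [norm_mul]
    linarith
  · intro t x y ht hx hy
    set P := a₀ + a₁ * t + a₂ * t ^ 2 + a₃ * t ^ 3 with hP
    set Q := b₀ + b₁ * t + b₂ * t ^ 2 + b₃ * t ^ 3 with hQ
    set T := ‖t‖ with hT
    have hT0 : 0 ≤ T := norm_nonneg t
    have hjet : ∀ d₀ d₁ d₂ d₃ : ℂ, ‖d₀ + d₁ * t + d₂ * t ^ 2 + d₃ * t ^ 3‖ ≤
        jetNorm r d₀ d₁ d₂ d₃ 0 := by
      intro d₀ d₁ d₂ d₃
      refine norm_add₄_le.trans ?_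
      simp only [norm_mul, norm_pow, jetNorm, zero_mul, add_zero]
      gcongr
    have hPn := hjet a₀ a₁ a₂ a₃
    have hQn := hjet b₀ b₁ b₂ b₃
    have hA : 0 ≤ jetNorm r a₀ a₁ a₂ a₃ 0 := (norm_nonneg _).trans hPn
    have hB : 0 ≤ jetNorm r b₀ b₁ b₂ b₃ 0 := (norm_nonneg _).trans hQn
    have e : x * y - (a₀ * b₀ + (a₀ * b₁ + a₁ * b₀) * t + (a₀ * b₂ + a₁ * b₁ + a₂ * b₀) * t ^ 2 +
        (a₀ * b₃ + a₁ * b₂ + a₂ * b₁ + a₃ * b₀) * t ^ 3) =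
        ((a₁ * b₃ + a₂ * b₂ + a₃ * b₁) * t ^ 4 + (a₂ * b₃ + a₃ * b₂) * t ^ 5 +
          a₃ * b₃ * t ^ 6) + (x - P) * Q + P * (y - Q) + (x - P) * (y - Q) := by
      rw [hP, hQ]; ring
    rw [e]
    have i1 : ‖(a₁ * b₃ + a₂ * b₂ + a₃ * b₁) * t ^ 4 + (a₂ * b₃ + a₃ * b₂) * t ^ 5 +
          a₃ * b₃ * t ^ 6‖ ≤ ((‖a₁‖ * ‖b₃‖ + ‖a₂‖ * ‖b₂‖ + ‖a₃‖ * ‖b₁‖) +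
          (‖a₂‖ * ‖b₃‖ + ‖a₃‖ * ‖b₂‖) * r + ‖a₃‖ * ‖b₃‖ * r ^ 2) * T ^ 4 := by
      have j1 : ‖a₁ * b₃ + a₂ * b₂ + a₃ * b₁‖ ≤ ‖a₁‖ * ‖b₃‖ + ‖a₂‖ * ‖b₂‖ + ‖a₃‖ * ‖b₁‖ := by
        simpa using norm_add₃_le (a := a₁ * b₃) (b := a₂ * b₂) (c := a₃ * b₁)
      have j2 : ‖a₂ * b₃ + a₃ * b₂‖ ≤ ‖a₂‖ * ‖b₃‖ + ‖a₃‖ * ‖b₂‖ := by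
        simpa using norm_add_le (a₂ * b₃) (a₃ * b₂)
      refine norm_add₃_le.trans ?_
      simp only [norm_mul, norm_pow]
      calc _ ≤ (‖a₁‖ * ‖b₃‖ + ‖a₂‖ * ‖b₂‖ + ‖a₃‖ * ‖b₁‖) * T ^ 4 +
            (‖a₂‖ * ‖b₃‖ + ‖a₃‖ * ‖b₂‖) * (r * T ^ 4) + ‖a₃‖ * ‖b₃‖ * (r ^ 2 * T ^ 4) := by
            have k5 : T ^ 5 ≤ r * T ^ 4 := by
              rw [pow_succ']; gcongr
            have k6 : T ^ 6 ≤ r ^ 2 * T ^ 4 := by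
              rw [show T ^ 6 = T ^ 2 * T ^ 4 by ring]; gcongr
            gcongr
        _ = _ := by ring
    have i2 : ‖(x - P) * Q‖ ≤ E * T ^ 4 * jetNorm r b₀ b₁ b₂ b₃ 0 := by
      rw [norm_mul]; gcongr
    have i3 : ‖P * (y - Q)‖ ≤ jetNorm r a₀ a₁ a₂ a₃ 0 * (F * T ^ 4) := by
      rw [norm_mul]; gcongr
    have i4 : ‖(x - P) * (y - Q)‖ ≤ E * r ^ 4 * (F * T ^ 4) := by
      rw [norm_mul]
      have : ‖x - P‖ ≤ E * r ^ 4 := hx.trans (by gcongr)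
      gcongr
    refine norm_add₄_le.trans ?_
    linarith

/-- Powers of a jet: the coefficient of order `1` is `p a₁ a₀^{p-1}`, and the majorant norm grows at
most like the `p`-th power. -/
theorem exists_jet_pow {r : ℝ} (hr : 0 ≤ r) (a₀ a₁ a₂ a₃ : ℂ) {E : ℝ} (hE : 0 ≤ E) (p : ℕ) :
    ∃ (c₂ c₃ : ℂ) (G : ℝ), 0 ≤ G ∧
      jetNorm r (a₀ ^ p) (p * a₁ * a₀ ^ (p - 1)) c₂ c₃ G ≤ jetNorm r a₀ a₁ a₂ a₃ E ^ p ∧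
      ∀ t x : ℂ, ‖t‖ ≤ r → ‖x - (a₀ + a₁ * t + a₂ * t ^ 2 + a₃ * t ^ 3)‖ ≤ E * ‖t‖ ^ 4 →
        ‖x ^ p - (a₀ ^ p + p * a₁ * a₀ ^ (p - 1) * t + c₂ * t ^ 2 + c₃ * t ^ 3)‖ ≤
          G * ‖t‖ ^ 4 := by
  induction p with
  | zero =>
    refine ⟨0, 0, 0, le_rfl, ?_, ?_⟩
    · simp [jetNorm]
    · intro t x _ _; simp
  | succ p ih =>
    obtain ⟨c₂, c₃, G, hG, hn, hb⟩ := ih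
    obtain ⟨d₂, d₃, G', hG', hn', hb'⟩ := exists_jet_mul hr (a₀ ^ p) (p * a₁ * a₀ ^ (p - 1)) c₂ c₃
      a₀ a₁ a₂ a₃ hG hE
    have e : a₀ ^ p * a₁ + p * a₁ * a₀ ^ (p - 1) * a₀ =
        ((p + 1 : ℕ) : ℂ) * a₁ * a₀ ^ (p + 1 - 1) := by
      rcases p with _ | p
      · simp
      · simp only [Nat.add_sub_cancel]; push_cast; ring
    rw [e, ← pow_succ] at hn'
    simp only [e, ← pow_succ] at hb'
    refine ⟨d₂, d₃, G', hG', hn'.trans ?_, fun t x ht hx => hb' t _ _ ht (hb t x ht hx) hx⟩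
    rw [pow_succ]
    refine mul_le_mul_of_nonneg_right hn ?_
    unfold jetNorm; positivity

/-- Uniform transfer for powers: a bounded function on the indented disk with a square-root jet at
`1` has powers whose coefficients follow the square-root profile, with an error controlled by the
`p`-th power of the majorant `ν`. -/
theorem exists_transfer_pow {c H r : ℝ} (hc : 0 < c) (hc1 : c < 1) (hH : 0 < H) (hr : 0 < r) :
    ∃ K : ℝ, 0 < K ∧ ∀ (f : ℂ → ℂ) (ν E : ℝ) (a₀ a₁ a₂ a₃ : ℂ),
      DifferentiableOn ℂ f (sectorDisk c H) → 0 ≤ E →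
      (∀ u ∈ sectorDisk c H, ‖f u‖ ≤ ν) → jetNorm r a₀ a₁ a₂ a₃ E ≤ ν →
      (∀ u ∈ sectorDisk c H, ‖1 - u‖ < r ^ 2 →
        ‖f u - (a₀ + a₁ * (1 - u) ^ (1 / 2 : ℂ) + a₂ * (1 - u) + a₃ * (1 - u) ^ (3 / 2 : ℂ))‖ ≤
          E * ‖1 - u‖ ^ 2) →
      ∀ p m : ℕ, ‖taylorCoeff (fun u => f u ^ p) m +
        p * a₁ * a₀ ^ (p - 1) * ((1 / (2 * Real.sqrt Real.pi) * sqrtDecay m : ℝ) : ℂ)‖ ≤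
          K * ν ^ p / ((m : ℝ) + 1) ^ 2 := by
  obtain ⟨K, hK, hmain⟩ := exists_norm_taylorCoeff_le hc hc1 hH
  refine ⟨K * (2 / r ^ 4) + (6 + 20 / r + 6 / r ^ 2 + 6 / r ^ 3), by positivity, ?_⟩
  intro f ν E a₀ a₁ a₂ a₃ hf hE hfν hν hjet p m
  have hj0 : 0 ≤ jetNorm r a₀ a₁ a₂ a₃ E := by unfold jetNorm; positivity
  have hν0 : 0 ≤ ν := hj0.trans hν
  obtain ⟨c₂, c₃, G, hG, hn, hb⟩ := exists_jet_pow hr.le a₀ a₁ a₂ a₃ hE p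
  replace hn := hn.trans (pow_le_pow_left₀ hj0 hν p)
  set b₁ : ℂ := p * a₁ * a₀ ^ (p - 1) with hb₁
  set b₀ : ℂ := a₀ ^ p with hb₀
  set N := ν ^ p with hN
  have hN0 : 0 ≤ N := by positivity
  have ht2 : ∀ δ : ℂ, (δ ^ (1 / 2 : ℂ)) ^ 2 = δ := by
    intro δ
    rw [← Complex.cpow_nat_mul]; norm_num
  have ht3 : ∀ δ : ℂ, (δ ^ (1 / 2 : ℂ)) ^ 3 = δ ^ (3 / 2 : ℂ) := by
    intro δ
    rw [← Complex.cpow_nat_mul]; norm_num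
  set g : ℂ → ℂ := fun u => f u ^ p + (-(b₀) * (1 - u) ^ (0 : ℂ) + (-b₁ * (1 - u) ^ (1 / 2 : ℂ) +
    (-c₂ * (1 - u) ^ (1 : ℂ) + -c₃ * (1 - u) ^ (3 / 2 : ℂ)))) with hg
  have hpow : ∀ a : ℂ, DifferentiableOn ℂ (fun u : ℂ => (1 - u) ^ a) (sectorDisk c H) := by
    intro a u hu
    refine DifferentiableAt.differentiableWithinAt ?_
    exact DifferentiableAt.cpow_const (by fun_prop) (one_sub_mem_slitPlane hc1 hu)
  have hgd : DifferentiableOn ℂ g (sectorDisk c H) :=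
    (hf.pow p).add (((hpow _).const_mul _).add (((hpow _).const_mul _).add
      (((hpow _).const_mul _).add ((hpow _).const_mul _))))
  have hgB : ∀ u ∈ sectorDisk c H, ‖g u‖ ≤ 2 / r ^ 4 * N * ‖1 - u‖ ^ 2 := by
    intro u hu
    set t := (1 - u) ^ (1 / 2 : ℂ) with ht
    have hgu : g u = f u ^ p - (b₀ + b₁ * t + c₂ * t ^ 2 + c₃ * t ^ 3) := by
      simp only [hg, Complex.cpow_zero, Complex.cpow_one, ht, ht2, ht3]
      ring
    have htn : ‖1 - u‖ = ‖t‖ ^ 2 := by rw [← norm_pow, ht, ht2]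
    have hT0 : 0 ≤ ‖t‖ := norm_nonneg t
    rw [hgu, htn, ← pow_mul]
    rcases lt_or_ge ‖t‖ r with hlt | hge
    · have h1 := hjet u hu (by rw [htn]; gcongr)
      rw [htn, ← pow_mul, ← ht3, ← ht] at h1
      have h1' : ‖f u - (a₀ + a₁ * t + a₂ * t ^ 2 + a₃ * t ^ 3)‖ ≤ E * ‖t‖ ^ 4 := by
        have e : t ^ 2 = 1 - u := ht2 _
        rw [e]; exact h1
      refine (hb t (f u) hlt.le h1').trans ?_
      have : G * r ^ 4 ≤ N := by
        refine le_trans ?_ hn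
        unfold jetNorm
        have : 0 ≤ ‖b₀‖ + ‖b₁‖ * r + ‖c₂‖ * r ^ 2 + ‖c₃‖ * r ^ 3 := by positivity
        linarith
      have hG2 : G ≤ 2 / r ^ 4 * N := by
        rw [div_mul_eq_mul_div, le_div_iff₀ (by positivity)]; linarith
      exact mul_le_mul_of_nonneg_right hG2 (by positivity)
    · have hq : 1 ≤ ‖t‖ / r := by rwa [one_le_div hr]
      set Q := ‖t‖ / r with hQ
      have htQ : ‖t‖ = r * Q := by rw [hQ]; field_simp
      have hpoly : ‖b₀ + b₁ * t + c₂ * t ^ 2 + c₃ * t ^ 3‖ ≤ N * Q ^ 4 := by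
        refine norm_add₄_le.trans ?_
        simp only [norm_mul, norm_pow, htQ, mul_pow]
        have q0 : (1 : ℝ) ≤ Q ^ 4 := one_le_pow₀ hq
        have q1 : Q ≤ Q ^ 4 := le_self_pow₀ hq (by norm_num)
        have q2 : Q ^ 2 ≤ Q ^ 4 := pow_le_pow_right₀ hq (by norm_num)
        have q3 : Q ^ 3 ≤ Q ^ 4 := pow_le_pow_right₀ hq (by norm_num)
        calc _ ≤ ‖b₀‖ * Q ^ 4 + ‖b₁‖ * (r * Q ^ 4) + ‖c₂‖ * (r ^ 2 * Q ^ 4) +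
              ‖c₃‖ * (r ^ 3 * Q ^ 4) := by
              gcongr
              exact le_mul_of_one_le_right (norm_nonneg _) q0
          _ = (‖b₀‖ + ‖b₁‖ * r + ‖c₂‖ * r ^ 2 + ‖c₃‖ * r ^ 3) * Q ^ 4 := by ring
          _ ≤ N * Q ^ 4 := by
              refine mul_le_mul_of_nonneg_right (le_trans ?_ hn) (by positivity)
              unfold jetNorm
              have : 0 ≤ G * r ^ 4 := by positivity
              linarith
      have hfp : ‖f u ^ p‖ ≤ N * Q ^ 4 := by
        rw [norm_pow]
        refine (pow_le_pow_left₀ (norm_nonneg _) (hfν u hu) p).trans ?_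
        exact le_mul_of_one_le_right hN0 (one_le_pow₀ hq)
      refine (norm_sub_le _ _).trans ((add_le_add hfp hpoly).trans (le_of_eq ?_))
      rw [htQ]; field_simp; ring
  have hgm := hmain g (2 / r ^ 4 * N) hgd (by positivity) hgB m
  have hpa : ∀ a : ℂ, AnalyticAt ℂ (fun u : ℂ => (1 - u) ^ a) 0 := by
    intro a
    exact (analyticAt_const.sub analyticAt_id).cpow analyticAt_const (by simp)
  have hca : ∀ k a : ℂ, AnalyticAt ℂ (fun u : ℂ => k * (1 - u) ^ a) 0 := fun k a =>
    analyticAt_const.mul (hpa a)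
  have hfa : AnalyticAt ℂ (fun u => f u ^ p) 0 :=
    ((hf.analyticAt ((isOpen_sectorDisk c H).mem_nhds
      (mem_sectorDisk_of_norm_lt_one hc hH (by simp)))).pow p)
  have hsum : taylorCoeff g m = taylorCoeff (fun u => f u ^ p) m +
      (-b₀ * taylorCoeff (fun u : ℂ => (1 - u) ^ (0 : ℂ)) m +
      (-b₁ * taylorCoeff (fun u : ℂ => (1 - u) ^ (1 / 2 : ℂ)) m +
      (-c₂ * taylorCoeff (fun u : ℂ => (1 - u) ^ (1 : ℂ)) m +
      -c₃ * taylorCoeff (fun u : ℂ => (1 - u) ^ (3 / 2 : ℂ)) m))) := by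
    have h1 := (hca (-c₂) 1).fun_add (hca (-c₃) (3 / 2))
    have h2 := (hca (-b₁) (1 / 2)).fun_add h1
    have h3 := (hca (-b₀) 0).fun_add h2
    rw [hg, taylorCoeff_add hfa h3, taylorCoeff_add (hca _ _) h2, taylorCoeff_add (hca _ _) h1,
      taylorCoeff_add (hca _ _) (hca _ _)]
    simp only [taylorCoeff_const_mul]
  have h0 : ‖taylorCoeff (fun u : ℂ => (1 - u) ^ (0 : ℂ)) m‖ ≤ 6 / ((m : ℝ) + 1) ^ 2 := by
    rw [taylorCoeff_one_sub_cpow]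
    rcases m with _ | m
    · simp
    · rw [Finset.prod_eq_zero (i := 0) (by simp) (by simp)]; simp; positivity
  have h1 : ‖taylorCoeff (fun u : ℂ => (1 - u) ^ (1 : ℂ)) m‖ ≤ 6 / ((m : ℝ) + 1) ^ 2 := by
    rw [taylorCoeff_one_sub_cpow]
    rcases m with _ | _ | m
    · simp
    · norm_num
    · rw [Finset.prod_eq_zero (i := 1) (by simp) (by simp)]; simp; positivity
  have h3 := norm_taylorCoeff_three_halves_le m
  have h2 := norm_taylorCoeff_sqrt_add_le m
  have e : taylorCoeff (fun u => f u ^ p) m +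
      b₁ * ((1 / (2 * Real.sqrt Real.pi) * sqrtDecay m : ℝ) : ℂ) =
      taylorCoeff g m + (b₀ * taylorCoeff (fun u : ℂ => (1 - u) ^ (0 : ℂ)) m +
      (b₁ * (taylorCoeff (fun u : ℂ => (1 - u) ^ (1 / 2 : ℂ)) m +
        ((1 / (2 * Real.sqrt Real.pi) * sqrtDecay m : ℝ) : ℂ)) +
      (c₂ * taylorCoeff (fun u : ℂ => (1 - u) ^ (1 : ℂ)) m +
      c₃ * taylorCoeff (fun u : ℂ => (1 - u) ^ (3 / 2 : ℂ)) m))) := by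
    rw [hsum]; ring
  rw [e]
  have n0 : ‖b₀‖ ≤ N ∧ ‖b₁‖ ≤ N / r ∧ ‖c₂‖ ≤ N / r ^ 2 ∧ ‖c₃‖ ≤ N / r ^ 3 := by
    unfold jetNorm at hn
    have i0 := norm_nonneg b₀
    have i1 : 0 ≤ ‖b₁‖ * r := by positivity
    have i2 : 0 ≤ ‖c₂‖ * r ^ 2 := by positivity
    have i3 : 0 ≤ ‖c₃‖ * r ^ 3 := by positivity
    have i4 : 0 ≤ G * r ^ 4 := by positivity
    refine ⟨by linarith, ?_, ?_, ?_⟩ <;> rw [le_div_iff₀ (by positivity)] <;> linarith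
  obtain ⟨n0, n1, n2, n3⟩ := n0
  calc _ ≤ K * (2 / r ^ 4 * N) / ((m : ℝ) + 1) ^ 2 + (N * (6 / ((m : ℝ) + 1) ^ 2) +
        (N / r * (20 / ((m : ℝ) + 1) ^ 2) + (N / r ^ 2 * (6 / ((m : ℝ) + 1) ^ 2) +
          N / r ^ 3 * (6 / ((m : ℝ) + 1) ^ 2)))) := by
        refine (norm_add_le _ _).trans (add_le_add hgm ?_)
        refine (norm_add_le _ _).trans (add_le_add ?_ ?_)
        · rw [norm_mul]; gcongr
        refine (norm_add_le _ _).trans (add_le_add ?_ ?_)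
        · rw [norm_mul]; gcongr
        refine (norm_add_le _ _).trans (add_le_add ?_ ?_)
        · rw [norm_mul]; gcongr
        · rw [norm_mul]; gcongr
    _ = _ := by ring

/-! ### Vectors and operators on `ℓ²` -/

/-- The square summable sequence with a given absolutely summable sequence of entries, as a sum of
multiples of the standard basis vectors. -/
noncomputable def ellTwoOfSummable (f : ℕ → ℂ) : EllTwo := ∑' k, lp.single 2 k (f k)

theorem norm_single_two (k : ℕ) (x : ℂ) : ‖(lp.single 2 k x : EllTwo)‖ = ‖x‖ :=
  lp.norm_single (E := fun _ : ℕ => ℂ) (p := 2) two_pos k x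

theorem hasSum_ellTwoOfSummable {f : ℕ → ℂ} (hf : Summable fun k => ‖f k‖) :
    HasSum (fun k => (lp.single 2 k (f k) : EllTwo)) (ellTwoOfSummable f) :=
  (Summable.of_norm (by simpa only [norm_single_two] using hf)).hasSum

theorem ellTwoOfSummable_apply {f : ℕ → ℂ} (hf : Summable fun k => ‖f k‖) (j : ℕ) :
    ellTwoOfSummable f j = f j := by
  have h := (hasSum_ellTwoOfSummable hf).mapL (lp.evalCLM ℂ (fun _ : ℕ => ℂ) 2 j)
  refine h.unique ?_
  have h2 := hasSum_single (f := fun k => lp.evalCLM ℂ (fun _ : ℕ => ℂ) 2 j (lp.single 2 k (f k))) j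
    (fun k hk => lp.single_apply_ne (E := fun _ : ℕ => ℂ) 2 k (f k) (Ne.symm hk))
  have e : lp.evalCLM ℂ (fun _ : ℕ => ℂ) 2 j (lp.single 2 j (f j)) = f j :=
    lp.single_apply_self (E := fun _ : ℕ => ℂ) 2 j (f j)
  rwa [e] at h2

theorem norm_ellTwoOfSummable_le {f : ℕ → ℂ} {b : ℕ → ℝ} (hb : Summable b)
    (hf : ∀ k, ‖f k‖ ≤ b k) : ‖ellTwoOfSummable f‖ ≤ ∑' k, b k :=
  tsum_of_norm_bounded hb.hasSum fun k => by rw [norm_single_two]; exact hf k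

theorem summable_one_div_succ_sq : Summable fun j : ℕ => 1 / ((j : ℝ) + 1) ^ 2 := by
  simpa using summable_pow_div_add (1 : ℝ) 2 1 (by norm_num) |>.congr fun j => by
    rw [Real.norm_of_nonneg (by positivity)]; simp

theorem summable_sqrtDecay : Summable sqrtDecay := by
  refine ((Real.summable_one_div_nat_add_rpow 1 (3 / 2)).2 (by norm_num)).congr fun j => ?_
  have h : (0 : ℝ) ≤ (j : ℝ) + 1 := by positivity
  rw [sqrtDecay, abs_of_nonneg h, show (3 / 2 : ℝ) = 1 + 1 / 2 by norm_num,
    Real.rpow_add (by positivity), Real.rpow_one, ← Real.sqrt_eq_rpow]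

/-- A sequence that is `O(1/(j+1))` is an `ℓ²` vector of norm `O(1)`. -/
theorem exists_ellTwo_of_norm_le {f : ℕ → ℂ} {B : ℝ} (hB : 0 ≤ B)
    (hf : ∀ j, ‖f j‖ ≤ B / ((j : ℝ) + 1)) : ∃ v : EllTwo, (∀ j, v j = f j) ∧
      ‖v‖ ≤ B * Real.sqrt (∑' j : ℕ, 1 / ((j : ℝ) + 1) ^ 2) := by
  have hb : ∀ j, ‖f j‖ ^ 2 ≤ B ^ 2 * (1 / ((j : ℝ) + 1) ^ 2) := by
    intro j
    calc ‖f j‖ ^ 2 ≤ (B / ((j : ℝ) + 1)) ^ 2 := pow_le_pow_left₀ (norm_nonneg _) (hf j) 2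
      _ = _ := by rw [div_pow]; ring
  have hs := summable_one_div_succ_sq.mul_left (B ^ 2)
  have hs2 : Summable fun j => ‖f j‖ ^ 2 := Summable.of_nonneg_of_le (fun j => by positivity) hb hs
  have hm : Memℓp f 2 := memℓp_gen (by simpa using hs2)
  refine ⟨⟨f, hm⟩, fun j => rfl, ?_⟩
  refine lp.norm_le_of_tsum_le (by norm_num) (by positivity) ?_
  simp only [ENNReal.toReal_ofNat, Real.rpow_two]
  rw [mul_pow, Real.sq_sqrt (tsum_nonneg fun j => by positivity), ← tsum_mul_left]
  exact hs2.tsum_le_tsum hb hs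

open InnerProductSpace in
/-- An operator with columns `conj (d k) • h + c k` has the Gram operator `‖h‖² d ⊗ d`, up to an
error controlled by the norms of the `c k` and by their overlaps with `h`. -/
theorem exists_gram_decomposition (h d : EllTwo) (c : ℕ → EllTwo)
    (hc : Summable fun k => ‖c k‖) (hi : Summable fun k => ‖(inner ℂ h (c k) : ℂ)‖) :
    ∃ T : EllTwo →L[ℂ] EllTwo,
      (∀ k, T (lp.single 2 k (1 : ℂ)) = (starRingEnd ℂ) (d k) • h + c k) ∧
      ‖(ContinuousLinearMap.adjoint T).comp T - ((‖h‖ ^ 2 : ℝ) : ℂ) • rankOne ℂ d d‖ ≤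
        2 * (‖d‖ * ∑' k, ‖(inner ℂ h (c k) : ℂ)‖) + (∑' k, ‖c k‖) ^ 2 := by
  set e : ℕ → EllTwo := fun k => lp.single 2 k (1 : ℂ) with he
  have hen : ∀ k, ‖e k‖ = 1 := fun k => by rw [he, norm_single_two, norm_one]
  have hsum : Summable fun k => rankOne ℂ (c k) (e k) :=
    Summable.of_norm (by simpa [hen] using hc)
  set E : EllTwo →L[ℂ] EllTwo := ∑' k, rankOne ℂ (c k) (e k) with hE
  have hEn : ‖E‖ ≤ ∑' k, ‖c k‖ :=
    tsum_of_norm_bounded hc.hasSum fun k => by simp [hen]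
  have hEe : ∀ k, E (e k) = c k := by
    intro k
    have h1 := hsum.hasSum.mapL (ContinuousLinearMap.apply ℂ EllTwo (e k))
    refine h1.unique ?_
    have h2 := hasSum_single (f := fun i => ContinuousLinearMap.apply ℂ EllTwo (e k)
      (rankOne ℂ (c i) (e i))) k (fun i hi => by
        simp only [ContinuousLinearMap.apply_apply, rankOne_apply, he]
        rw [lp.inner_single_left, lp.single_apply_ne 2 k _ hi]; simp)
    have e2 : ContinuousLinearMap.apply ℂ EllTwo (e k) (rankOne ℂ (c k) (e k)) = c k := by
      simp only [ContinuousLinearMap.apply_apply, rankOne_apply, he]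
      rw [lp.inner_single_left, lp.single_apply_self]; simp
    rwa [e2] at h2
  have hcross : ‖(rankOne ℂ d h).comp E‖ ≤ ‖d‖ * ∑' k, ‖(inner ℂ h (c k) : ℂ)‖ := by
    have h1 := hsum.hasSum.mapL
      (ContinuousLinearMap.compL ℂ EllTwo EllTwo EllTwo (rankOne ℂ d h))
    have h2 : (rankOne ℂ d h).comp E = ∑' k, (rankOne ℂ d h).comp (rankOne ℂ (c k) (e k)) :=
      h1.tsum_eq.symm
    rw [h2]
    refine tsum_of_norm_bounded (hi.hasSum.mul_left ‖d‖) fun k => ?_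
    rw [rankOne_comp_rankOne, norm_smul, norm_rankOne, hen, mul_one, mul_comm]
  have hcross' : ‖(ContinuousLinearMap.adjoint E).comp (rankOne ℂ h d)‖ ≤
      ‖d‖ * ∑' k, ‖(inner ℂ h (c k) : ℂ)‖ := by
    have e1 : (ContinuousLinearMap.adjoint E).comp (rankOne ℂ h d) =
        ContinuousLinearMap.adjoint ((rankOne ℂ d h).comp E) := by
      rw [ContinuousLinearMap.adjoint_comp, adjoint_rankOne]
    rw [e1, LinearIsometryEquiv.norm_map]
    exact hcross
  refine ⟨rankOne ℂ h d + E, fun k => ?_, ?_⟩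
  · change rankOne ℂ h d (e k) + E (e k) = _
    rw [hEe, rankOne_apply, he, lp.inner_single_right]
    simp
  · have e1 : (ContinuousLinearMap.adjoint (rankOne ℂ h d + E)).comp (rankOne ℂ h d + E) -
        ((‖h‖ ^ 2 : ℝ) : ℂ) • rankOne ℂ d d = (rankOne ℂ d h).comp E +
        (ContinuousLinearMap.adjoint E).comp (rankOne ℂ h d) +
        (ContinuousLinearMap.adjoint E).comp E := by
      have e2 : (inner ℂ h h : ℂ) = ((‖h‖ ^ 2 : ℝ) : ℂ) := by
        rw [inner_self_eq_norm_sq_to_K]; push_cast; rfl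
      rw [map_add, adjoint_rankOne, ContinuousLinearMap.add_comp, ContinuousLinearMap.comp_add,
        ContinuousLinearMap.comp_add, rankOne_comp_rankOne, e2]
      abel
    have h3 : ‖(ContinuousLinearMap.adjoint E).comp E‖ ≤ (∑' k, ‖c k‖) ^ 2 := by
      refine (ContinuousLinearMap.opNorm_comp_le _ _).trans ?_
      rw [LinearIsometryEquiv.norm_map, pow_two]
      gcongr
    rw [e1, two_mul]
    exact (norm_add_le _ _).trans (add_le_add ((norm_add_le _ _).trans
      (add_le_add hcross hcross')) h3)

/-! ### The synthesis operator of coefficients with a square-root profile -/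

theorem pow_mul_one_sub_pow_le {y : ℝ} (hy : 0 ≤ y) (hy1 : y ≤ 1) (m k : ℕ) :
    y ^ m * (1 - y ^ k) ≤ k / ((m : ℝ) + 1) := by
  have h1 : (1 - y) * ∑ i ∈ Finset.range k, y ^ i = 1 - y ^ k := mul_neg_geom_sum y k
  have h2 : (1 - y) * ∑ i ∈ Finset.range (m + 1), y ^ i = 1 - y ^ (m + 1) :=
    mul_neg_geom_sum y (m + 1)
  have h3 : ∑ i ∈ Finset.range k, y ^ i ≤ k := by
    simpa using Finset.sum_le_sum (s := Finset.range k) fun i _ => pow_le_one₀ (n := i) hy hy1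
  have h4 : ((m : ℝ) + 1) * y ^ m ≤ ∑ i ∈ Finset.range (m + 1), y ^ i := by
    have := Finset.sum_le_sum (s := Finset.range (m + 1)) (f := fun _ => y ^ m)
      (g := fun i => y ^ i) fun i hi =>
        pow_le_pow_of_le_one hy hy1 (Nat.lt_succ_iff.1 (Finset.mem_range.1 hi))
    simpa using this
  have h5 : ((m : ℝ) + 1) * y ^ m * (1 - y) ≤ 1 := by
    have : 0 ≤ y ^ (m + 1) := by positivity
    nlinarith [mul_le_mul_of_nonneg_right h4 (sub_nonneg.2 hy1)]
  rw [le_div_iff₀ (by positivity), ← h1]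
  have h6 : 0 ≤ ((m : ℝ) + 1) * y ^ m * (1 - y) :=
    mul_nonneg (by positivity) (sub_nonneg.2 hy1)
  calc y ^ m * ((1 - y) * ∑ i ∈ Finset.range k, y ^ i) * (m + 1)
      = ((m : ℝ) + 1) * y ^ m * (1 - y) * ∑ i ∈ Finset.range k, y ^ i := by ring
    _ ≤ ((m : ℝ) + 1) * y ^ m * (1 - y) * k := by gcongr
    _ ≤ 1 * k := by gcongr
    _ = k := one_mul _

theorem one_div_sqrt_sub_le (m k : ℕ) :
    1 / Real.sqrt ((m : ℝ) + 1) - 1 / Real.sqrt ((k : ℝ) + m + 1) ≤ k / ((m : ℝ) + 1) := by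
  have hm : (0 : ℝ) ≤ m := Nat.cast_nonneg m
  have hk : (0 : ℝ) ≤ k := Nat.cast_nonneg k
  set a := Real.sqrt ((m : ℝ) + 1) with ha
  set b := Real.sqrt ((k : ℝ) + m + 1) with hb
  have ha2 : a ^ 2 = m + 1 := Real.sq_sqrt (by positivity)
  have hb2 : b ^ 2 = k + m + 1 := Real.sq_sqrt (by positivity)
  have ha1 : 1 ≤ a := Real.one_le_sqrt.2 (by linarith)
  have hb1 : 1 ≤ b := Real.one_le_sqrt.2 (by linarith)
  have hab : a ≤ b := Real.sqrt_le_sqrt (by linarith)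
  have e : 1 / a - 1 / b = (b - a) / (a * b) := by field_simp
  rw [e, ← ha2, div_le_div_iff₀ (by positivity) (by positivity)]
  have hk2 : (k : ℝ) = (b - a) * (b + a) := by nlinarith
  rw [hk2]
  have h1 : 0 ≤ b - a := sub_nonneg.2 hab
  have h2 : a ^ 2 ≤ (b + a) * (a * b) := by
    nlinarith [mul_pos (by positivity : 0 < a) (by positivity : 0 < b)]
  calc (b - a) * a ^ 2 ≤ (b - a) * ((b + a) * (a * b)) := by gcongr
    _ = _ := by ring

/-- The comparison of the profile of the `k`-th column with the common profile of all columns. -/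
theorem abs_profile_sub_le {y : ℝ} (hy : 0 ≤ y) (hy1 : y ≤ 1) {P s : ℝ} (hP : 0 ≤ P) (hs : 0 ≤ s)
    (m k : ℕ) : y ^ m * |(P + m * s) * sqrtDecay m - s * y ^ k / Real.sqrt ((k : ℝ) + m + 1)| ≤
      (P + s + 2 * s * k) / ((m : ℝ) + 1) := by
  have hm : (0 : ℝ) ≤ m := Nat.cast_nonneg m
  have hk : (0 : ℝ) ≤ k := Nat.cast_nonneg k
  set a := Real.sqrt ((m : ℝ) + 1) with ha
  set b := Real.sqrt ((k : ℝ) + m + 1) with hb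
  have ha1 : 1 ≤ a := Real.one_le_sqrt.2 (by linarith)
  have hb1 : 1 ≤ b := Real.one_le_sqrt.2 (by linarith)
  have hab : a ≤ b := Real.sqrt_le_sqrt (by linarith)
  have hyk : y ^ k ≤ 1 := pow_le_one₀ hy hy1
  have hym : y ^ m ≤ 1 := pow_le_one₀ hy hy1
  have hym0 : 0 ≤ y ^ m := by positivity
  have e : (P + m * s) * sqrtDecay m - s * y ^ k / b =
      (P - s) * sqrtDecay m + s * (1 / a - 1 / b) + s * (1 / b) * (1 - y ^ k) := by
    rw [sqrtDecay, ← ha]; field_simp; ring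
  have hd : sqrtDecay m ≤ 1 / ((m : ℝ) + 1) := by
    rw [sqrtDecay, ← ha]
    exact one_div_le_one_div_of_le (by positivity) (le_mul_of_one_le_right (by positivity) ha1)
  have hd0 : 0 ≤ sqrtDecay m := by rw [sqrtDecay]; positivity
  have h1 : |(P - s) * sqrtDecay m| ≤ (P + s) * (1 / ((m : ℝ) + 1)) := by
    rw [abs_mul, abs_of_nonneg hd0]
    have : |P - s| ≤ P + s := abs_le.2 ⟨by linarith, by linarith⟩
    gcongr
  have h2 : |s * (1 / a - 1 / b)| ≤ s * (k / ((m : ℝ) + 1)) := by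
    rw [abs_mul, abs_of_nonneg hs, abs_of_nonneg
      (sub_nonneg.2 (one_div_le_one_div_of_le (by positivity) hab))]
    exact mul_le_mul_of_nonneg_left (one_div_sqrt_sub_le m k) hs
  have h3 : y ^ m * |s * (1 / b) * (1 - y ^ k)| ≤ s * (k / ((m : ℝ) + 1)) := by
    rw [abs_of_nonneg (mul_nonneg (by positivity) (sub_nonneg.2 hyk))]
    have hb' : 1 / b ≤ 1 := by rw [div_le_one (by positivity)]; exact hb1
    calc y ^ m * (s * (1 / b) * (1 - y ^ k)) = s * (1 / b) * (y ^ m * (1 - y ^ k)) := by ring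
      _ ≤ s * 1 * (k / ((m : ℝ) + 1)) := by
        have := pow_mul_one_sub_pow_le hy hy1 m k
        have h0 : 0 ≤ y ^ m * (1 - y ^ k) := mul_nonneg hym0 (sub_nonneg.2 hyk)
        gcongr
      _ = _ := by ring
  rw [e]
  calc _ ≤ y ^ m * (|(P - s) * sqrtDecay m| + |s * (1 / a - 1 / b)| +
        |s * (1 / b) * (1 - y ^ k)|) := by
        gcongr
        exact abs_add_three _ _ _
    _ = y ^ m * (|(P - s) * sqrtDecay m| + |s * (1 / a - 1 / b)|) +
        y ^ m * |s * (1 / b) * (1 - y ^ k)| := by ring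
    _ ≤ 1 * ((P + s) * (1 / ((m : ℝ) + 1)) + s * (k / ((m : ℝ) + 1))) +
        s * (k / ((m : ℝ) + 1)) := by gcongr
    _ = _ := by ring

theorem blockIndex_cast (s q k : ℕ) : (blockIndex s q k : ℝ) = q + k * s := by
  simp [blockIndex]

theorem one_le_blockIndex {s q : ℕ} (hq : 1 ≤ q) (k : ℕ) : 1 ≤ blockIndex s q k :=
  hq.trans (Nat.le_add_right _ _)

theorem weight_pos {s q : ℕ} (hq : 1 ≤ q) (β : ℝ) {α : ℝ} (hα : 0 < α) (k : ℕ) :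
    0 < weight s q β α k := by
  have := one_le_blockIndex (s := s) hq k
  have h : (0 : ℝ) < blockIndex s q k := by exact_mod_cast this
  unfold weight; positivity

/-- The exponential weight dominates: `ν^{p_k} / (√p_k w_k) ≤ (ν/α)^k`. -/
theorem inv_sqrt_mul_weight_le {s q : ℕ} (hs : 1 ≤ s) (hq : 1 ≤ q) {β α ν : ℝ} (hβ : 0 < β)
    (hν : 0 < ν) (hνα : ν < α) (k : ℕ) :
    1 / (Real.sqrt (blockIndex s q k) * weight s q β α k) * ν ^ blockIndex s q k ≤ (ν / α) ^ k := by
  have hα : 0 < α := hν.trans hνα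
  have hP : (1 : ℝ) ≤ blockIndex s q k := by exact_mod_cast one_le_blockIndex (s := s) hq k
  have h1 : 1 ≤ Real.sqrt (blockIndex s q k) := Real.one_le_sqrt.2 hP
  have h2 : α ^ blockIndex s q k ≤ weight s q β α k :=
    le_mul_of_one_le_left (by positivity) (Real.one_le_rpow hP (by positivity))
  have h3 : α ^ blockIndex s q k ≤ Real.sqrt (blockIndex s q k) * weight s q β α k :=
    h2.trans (le_mul_of_one_le_left (weight_pos hq β hα k).le h1)
  calc _ ≤ 1 / α ^ blockIndex s q k * ν ^ blockIndex s q k := by gcongr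
    _ = (ν / α) ^ blockIndex s q k := by rw [div_pow]; ring
    _ ≤ (ν / α) ^ k := by
      refine pow_le_pow_of_le_one (by positivity) ((div_le_one hα).2 hνα.le) ?_
      unfold blockIndex
      nlinarith

theorem blockIndex_le_mul {s q : ℕ} (hq : q ≤ s) (k : ℕ) :
    (blockIndex s q k : ℝ) ≤ s * (k + 1) := by
  rw [blockIndex_cast]
  have : (q : ℝ) ≤ s := by exact_mod_cast hq
  linarith

theorem norm_spikeEntry_le {s q : ℕ} (hs : 1 ≤ s) (hq : 1 ≤ q) (hqs : q ≤ s) {β α ν K : ℝ}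
    (hβ : 0 < β) (hν : 0 < ν) (hνα : ν < α) (hK : 0 ≤ K) (z : ℂ) {A : ℕ → ℂ}
    (hA : ∀ p : ℕ, 1 ≤ p → ‖A p‖ ≤ K * p * ν ^ p) (k : ℕ) :
    ‖spikeEntry s q β α z A k‖ ≤ K * s ^ 2 * ((k : ℝ) + 1) * (ν / α) ^ k := by
  have hα : 0 < α := hν.trans hνα
  have hw := weight_pos (s := s) hq β hα k
  have hz : ‖z / (‖z‖ : ℂ)‖ ≤ 1 := by
    rw [norm_div, Complex.norm_real, norm_norm]; exact div_self_le_one _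
  have hz' : ‖z / (‖z‖ : ℂ)‖ ^ k ≤ 1 := pow_le_one₀ (norm_nonneg _) hz
  have hP := blockIndex_le_mul hqs k
  have hτ := inv_sqrt_mul_weight_le hs hq hβ hν hνα k
  have hAk := hA _ (one_le_blockIndex (s := s) hq k)
  unfold spikeEntry
  rw [norm_div, norm_mul, norm_mul, norm_pow, RCLike.norm_conj, RCLike.norm_conj,
    Complex.norm_real, Complex.norm_real, Real.norm_of_nonneg hw.le,
    Real.norm_of_nonneg (by positivity)]
  set P := blockIndex s q k
  set w := weight s q β α k
  calc _ ≤ 1 * (s / Real.sqrt P) * (K * P * ν ^ P) / w := by gcongr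
    _ = s * K * P * (1 / (Real.sqrt P * w) * ν ^ P) := by
      rw [← div_div, one_div]; ring
    _ ≤ s * K * (s * (k + 1)) * (ν / α) ^ k := by gcongr
    _ = _ := by ring

theorem summable_poly_mul_geometric {θ : ℝ} (hθ : 0 ≤ θ) (hθ1 : θ < 1) (a : ℕ) :
    Summable fun k : ℕ => ((k : ℝ) + 1) ^ a * θ ^ k := by
  rcases hθ.eq_or_lt with rfl | hpos
  · refine summable_of_ne_finset_zero (s := {0}) fun k hk => ?_
    simp at hk; simp [hk]
  have h := (summable_nat_add_iff 1).2 (summable_pow_mul_geometric_of_norm_lt_one a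
    (r := θ) (by rwa [Real.norm_of_nonneg hθ]))
  refine (h.mul_right θ⁻¹).congr fun k => ?_
  push_cast
  rw [pow_succ]; field_simp

/-- The common profile `z^{-j} (j+1)^{-1/2}` of the columns of the synthesis operator. -/
noncomputable def columnProfile (z : ℂ) (j : ℕ) : ℂ := (z ^ j)⁻¹ * ((1 / Real.sqrt (j + 1) : ℝ) : ℂ)

theorem add_mul_le_six_mul_sq {s k P : ℝ} (hs : 1 ≤ s) (hk : 0 ≤ k) (hP : 0 ≤ P)
    (hPs : P ≤ s * (k + 1)) :
    (P + s) + P * (P + s + 2 * s * k) ≤ 6 * s ^ 2 * (k + 1) ^ 2 := by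
  set X := s * (k + 1) with hX
  have hX1 : 1 ≤ X := by nlinarith
  have u1 : P + s ≤ 2 * X := by nlinarith
  have u2 : P + s + 2 * s * k ≤ 4 * X := by nlinarith
  have u3 : P * (P + s + 2 * s * k) ≤ X * (4 * X) := by gcongr
  have u4 : 6 * s ^ 2 * (k + 1) ^ 2 = 6 * (X * X) := by rw [hX]; ring
  have u5 : 1 * X ≤ X * X := by gcongr
  rw [u4]
  linarith

/-- Each column of the renormalized synthesis operator is a multiple of the common profile, up to
an error which has one half power of decay more. -/
theorem norm_column_sub_le {N : ℕ} (e : Fin N → ℕ) {q : ℕ} (hq : 1 ≤ q) (hqs : q ≤ symIndex e)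
    {β α ν K : ℝ} (hβ : 0 < β) (hν : 0 < ν) (hνα : ν < α) (hK : 0 ≤ K) (ζ : Fin N → ℂ) {z : ℂ}
    (hz : 1 < ‖z‖) {A : ℕ → ℂ}
    (hR : ∀ p m : ℕ, 1 ≤ p → ‖branchCoeff e ζ p m * z ^ m - A p * (sqrtDecay m : ℂ)‖ ≤
      K * ν ^ p / ((m : ℝ) + 1) ^ 2)
    (hA : ∀ p : ℕ, 1 ≤ p → ‖A p‖ ≤ K * p * ν ^ p) (k j : ℕ) :
    ‖gramVector e ζ q (blockIndex (symIndex e) q k) j / (weight (symIndex e) q β α k : ℂ) -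
      (starRingEnd ℂ) (spikeEntry (symIndex e) q β α z A k) * columnProfile z j‖ ≤
      6 * K * (symIndex e) ^ 2 * (((k : ℝ) + 1) ^ 3 * (ν / α) ^ k) / ((j : ℝ) + 1) := by
  set s := symIndex e with hs'
  have hs : 1 ≤ s := hq.trans hqs
  have hsR : (1 : ℝ) ≤ s := by exact_mod_cast hs
  have hα : 0 < α := hν.trans hνα
  have hz0 : z ≠ 0 := by rintro rfl; simp at hz; linarith
  have hy0 : 0 ≤ ‖z‖⁻¹ := by positivity
  have hy1 : ‖z‖⁻¹ ≤ 1 := inv_le_one_of_one_le₀ hz.le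
  have hkR : (0 : ℝ) ≤ k := Nat.cast_nonneg k
  have hθ : 0 ≤ ν / α := by positivity
  rcases lt_or_ge j k with hjk | hjk
  · have h0 : gramVector e ζ q (blockIndex s q k) j = 0 := by
      rw [gramVector, if_neg]
      rw [not_le]
      unfold blockIndex
      have := Nat.mul_lt_mul_of_pos_right hjk (show 0 < s by omega)
      rw [← hs']; omega
    have hd := norm_spikeEntry_le hs hq hqs hβ hν hνα hK z hA k
    have hc : ‖columnProfile z j‖ ≤ ((k : ℝ) + 1) / (j + 1) := by
      have hj1 : (1 : ℝ) ≤ Real.sqrt (j + 1) := Real.one_le_sqrt.2 (by simp)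
      have h1 : (1 : ℝ) ≤ ((k : ℝ) + 1) / (j + 1) := by
        rw [one_le_div (by positivity)]
        have : (j : ℝ) ≤ k := by exact_mod_cast hjk.le
        linarith
      refine le_trans ?_ h1
      rw [columnProfile, norm_mul, Complex.norm_real, Real.norm_of_nonneg (by positivity),
        norm_inv, norm_pow, ← inv_pow]
      exact mul_le_one₀ (pow_le_one₀ hy0 hy1) (by positivity) ((div_le_one (by positivity)).2 hj1)
    rw [h0, zero_div, zero_sub, norm_neg, norm_mul, RCLike.norm_conj]
    calc _ ≤ K * s ^ 2 * ((k : ℝ) + 1) * (ν / α) ^ k * (((k : ℝ) + 1) / (j + 1)) := by gcongr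
      _ = K * s ^ 2 * ((((k : ℝ) + 1) ^ 2 * 1) * (ν / α) ^ k) / (j + 1) := by ring
      _ ≤ 6 * K * s ^ 2 * ((((k : ℝ) + 1) ^ 2 * (k + 1)) * (ν / α) ^ k) / (j + 1) := by
        gcongr
        · linarith
        · linarith
      _ = _ := by ring
  · obtain ⟨m, rfl⟩ := Nat.exists_eq_add_of_le hjk
    have hmR : (0 : ℝ) ≤ m := Nat.cast_nonneg m
    set P := blockIndex s q k with hP
    have hP1 : 1 ≤ P := one_le_blockIndex hq k
    have hPj : blockIndex s q (k + m) = P + m * s := by rw [hP]; unfold blockIndex; ring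
    have hw := weight_pos (s := s) hq β hα k
    have hsP : 0 < Real.sqrt P := Real.sqrt_pos.2 (by exact_mod_cast hP1)
    have hτ := inv_sqrt_mul_weight_le hs hq hβ hν hνα k
    rw [← hP] at hτ
    have hg : gramVector e ζ q P (k + m) = (((P + m * s : ℝ) / Real.sqrt P : ℝ) : ℂ) *
        branchCoeff e ζ P m := by
      rw [gramVector, ← hs', hPj, if_pos (Nat.le_add_right _ _), Nat.add_sub_cancel_left,
        Nat.mul_div_cancel _ (by omega)]
      push_cast; rfl
    set w := weight s q β α k with hw'
    set b := Real.sqrt ((k : ℝ) + m + 1) with hb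
    have hb0 : 0 < b := Real.sqrt_pos.2 (by positivity)
    have hid : gramVector e ζ q P (k + m) / (w : ℂ) -
        (starRingEnd ℂ) (spikeEntry s q β α z A k) * columnProfile z (k + m) =
        ((1 / (Real.sqrt P * w) : ℝ) : ℂ) * ((z ^ m)⁻¹ *
          (((P + m * s : ℝ) : ℂ) * (branchCoeff e ζ P m * z ^ m - A P * (sqrtDecay m : ℂ)) +
          A P * (((P + m * s) * sqrtDecay m - s * ‖z‖⁻¹ ^ k / b : ℝ) : ℂ))) := by
      have hwc : (w : ℂ) ≠ 0 := by exact_mod_cast hw.ne'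
      have hsc : ((Real.sqrt P : ℝ) : ℂ) ≠ 0 := by exact_mod_cast hsP.ne'
      have hbc : (b : ℂ) ≠ 0 := by exact_mod_cast hb0.ne'
      have hzn : (‖z‖ : ℂ) ≠ 0 := by
        exact_mod_cast (norm_pos_iff.2 hz0).ne'
      have hb' : Real.sqrt (((k + m : ℕ) : ℝ) + 1) = b := by rw [hb]; push_cast; rfl
      rw [hg, spikeEntry, columnProfile, ← hP, ← hw', hb']
      simp only [map_div₀, map_mul, map_pow, Complex.conj_conj, Complex.conj_ofReal]
      push_cast
      rw [pow_add, div_pow, inv_pow]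
      field_simp
      ring
    rw [hid, norm_mul, Complex.norm_real, Real.norm_of_nonneg (by positivity), norm_mul, norm_inv,
      norm_pow, ← inv_pow]
    have hm1 : (0 : ℝ) < (m : ℝ) + 1 := by positivity
    have hPs := blockIndex_le_mul hqs k
    rw [← hP] at hPs
    have hPR : (1 : ℝ) ≤ P := by exact_mod_cast hP1
    have i1 : ‖((P + m * s : ℝ) : ℂ) * (branchCoeff e ζ P m * z ^ m - A P * (sqrtDecay m : ℂ))‖ ≤
        (P + s) * K * ν ^ P / ((m : ℝ) + 1) := by
      rw [norm_mul, Complex.norm_real, Real.norm_of_nonneg (by positivity)]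
      calc _ ≤ ((P + s) * ((m : ℝ) + 1)) * (K * ν ^ P / ((m : ℝ) + 1) ^ 2) := by
            have h1 := hR P m hP1
            gcongr
            nlinarith
        _ = _ := by field_simp
    have i2 : ‖z‖⁻¹ ^ m * ‖A P * (((P + m * s) * sqrtDecay m - s * ‖z‖⁻¹ ^ k / b : ℝ) : ℂ)‖ ≤
        K * P * ν ^ P * ((P + s + 2 * s * k) / ((m : ℝ) + 1)) := by
      rw [norm_mul, Complex.norm_real, Real.norm_eq_abs, ← mul_assoc, mul_comm (_ ^ m), mul_assoc]
      have h1 := abs_profile_sub_le hy0 hy1 (P := P) (s := s) (by positivity) (by positivity) m k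
      have h2 := hA P hP1
      gcongr
    have hym : ‖z‖⁻¹ ^ m ≤ 1 := pow_le_one₀ hy0 hy1
    have hym0 : 0 ≤ ‖z‖⁻¹ ^ m := by positivity
    have hdiv : 1 / ((m : ℝ) + 1) ≤ ((k : ℝ) + 1) / ((k + m : ℕ) + 1) := by
      rw [div_le_div_iff₀ (by positivity) (by positivity)]
      push_cast
      nlinarith
    calc _ ≤ 1 / (Real.sqrt P * w) * ((P + s) * K * ν ^ P / ((m : ℝ) + 1) +
          K * P * ν ^ P * ((P + s + 2 * s * k) / ((m : ℝ) + 1))) := by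
          refine mul_le_mul_of_nonneg_left ?_ (by positivity)
          refine (mul_le_mul_of_nonneg_left (norm_add_le _ _) hym0).trans ?_
          rw [mul_add]
          refine add_le_add ?_ i2
          exact (mul_le_of_le_one_left (norm_nonneg _) hym).trans i1
      _ = 1 / (Real.sqrt P * w) * ν ^ P * (K * ((P + s) + P * (P + s + 2 * s * k))) *
          (1 / ((m : ℝ) + 1)) := by ring
      _ ≤ (ν / α) ^ k * (K * (6 * s ^ 2 * ((k : ℝ) + 1) ^ 2)) *
          (((k : ℝ) + 1) / ((k + m : ℕ) + 1)) := by
          refine mul_le_mul (mul_le_mul hτ (mul_le_mul_of_nonneg_left ?_ hK) ?_ ?_) hdiv ?_ ?_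
          · exact add_mul_le_six_mul_sq hsR hkR (by positivity) hPs
          all_goals positivity
      _ = _ := by ring

theorem norm_columnProfile {z : ℂ} (j : ℕ) :
    ‖columnProfile z j‖ = ‖z‖⁻¹ ^ j * (1 / Real.sqrt (j + 1)) := by
  rw [columnProfile, norm_mul, Complex.norm_real, Real.norm_of_nonneg (by positivity), norm_inv,
    norm_pow, inv_pow]

/-- The renormalized block of one parameter value.  The bound on the remainder depends only on the
constants of the coefficient asymptotics. -/
theorem exists_renormalizedGram {N : ℕ} (e : Fin N → ℕ) {q : ℕ} (hq : 1 ≤ q)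
    (hqs : q ≤ symIndex e) {β α ν K : ℝ} (hβ : 0 < β) (hν : 0 < ν) (hνα : ν < α) (hK : 0 ≤ K) :
    ∃ C : ℝ, ∀ (ζ : Fin N → ℂ) (z : ℂ) (A : ℕ → ℂ) (L : ℝ), 1 < ‖z‖ →
      (∀ p m : ℕ, 1 ≤ p → ‖branchCoeff e ζ p m * z ^ m - A p * (sqrtDecay m : ℂ)‖ ≤
        K * ν ^ p / ((m : ℝ) + 1) ^ 2) →
      (∀ p : ℕ, 1 ≤ p → ‖A p‖ ≤ K * p * ν ^ p) →
      |∑' j : ℕ, (‖z‖⁻¹ ^ 2) ^ j / ((j : ℝ) + 1) - L| ≤ 1 →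
      ∃ T : EllTwo →L[ℂ] EllTwo, IsRenormalizedSynthesis e ζ q β α T ∧
        ‖(ContinuousLinearMap.adjoint T).comp T - (L : ℂ) • InnerProductSpace.rankOne ℂ
          (ellTwoOfSummable (spikeEntry (symIndex e) q β α z A))
          (ellTwoOfSummable (spikeEntry (symIndex e) q β α z A))‖ ≤ C := by
  set s := symIndex e with hs'
  have hs : 1 ≤ s := hq.trans hqs
  have hα : 0 < α := hν.trans hνα
  have hθ : 0 ≤ ν / α := by positivity
  have hθ1 : ν / α < 1 := (div_lt_one hα).2 hνα
  set Z := Real.sqrt (∑' j : ℕ, 1 / ((j : ℝ) + 1) ^ 2) with hZ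
  set Z' := ∑' j : ℕ, sqrtDecay j with hZ'
  set B : ℕ → ℝ := fun k => 6 * K * s ^ 2 * (((k : ℝ) + 1) ^ 3 * (ν / α) ^ k) with hB
  have hB0 : ∀ k, 0 ≤ B k := fun k => by positivity
  have hBs : Summable B := (summable_poly_mul_geometric hθ hθ1 3).mul_left _
  set D : ℕ → ℝ := fun k => K * s ^ 2 * ((k : ℝ) + 1) * (ν / α) ^ k with hD
  have hDs : Summable D := by
    refine ((summable_poly_mul_geometric hθ hθ1 1).mul_left (K * s ^ 2)).congr fun k => ?_
    simp only [hD]; ring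
  refine ⟨2 * ((∑' k, D k) * ∑' k, B k * Z') + (∑' k, B k * Z) ^ 2 + (∑' k, D k) ^ 2, ?_⟩
  intro ζ z A L hz hR hA hL
  set d := ellTwoOfSummable (spikeEntry s q β α z A) with hd
  have hdb : ∀ k, ‖spikeEntry s q β α z A k‖ ≤ D k :=
    norm_spikeEntry_le hs hq hqs hβ hν hνα hK z hA
  have hdn : ‖d‖ ≤ ∑' k, D k := norm_ellTwoOfSummable_le hDs hdb
  have hda : ∀ k, d k = spikeEntry s q β α z A k :=
    ellTwoOfSummable_apply (Summable.of_nonneg_of_le (fun _ => norm_nonneg _) hdb hDs)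
  choose c hc hcn using fun k => exists_ellTwo_of_norm_le (hB0 k)
    (norm_column_sub_le e hq hqs hβ hν hνα hK ζ hz hR hA k)
  have hy0 : 0 ≤ ‖z‖⁻¹ := by positivity
  have hy1 : ‖z‖⁻¹ < 1 := inv_lt_one_of_one_lt₀ hz
  have hhb : ∀ j, ‖columnProfile z j‖ ≤ ‖z‖⁻¹ ^ j := by
    intro j
    rw [norm_columnProfile]
    refine mul_le_of_le_one_right (by positivity) ((div_le_one ?_).2 ?_)
    · positivity
    · exact Real.one_le_sqrt.2 (by simp)
  have hhs : Summable fun j => ‖columnProfile z j‖ :=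
    Summable.of_nonneg_of_le (fun _ => norm_nonneg _) hhb (summable_geometric_of_lt_one hy0 hy1)
  set h := ellTwoOfSummable (columnProfile z) with hh
  have hha : ∀ j, h j = columnProfile z j := ellTwoOfSummable_apply hhs
  have hhn : ‖h‖ ^ 2 = ∑' j : ℕ, (‖z‖⁻¹ ^ 2) ^ j / ((j : ℝ) + 1) := by
    have := lp.norm_rpow_eq_tsum (p := 2) (by norm_num) h
    simp only [ENNReal.toReal_ofNat, Real.rpow_two] at this
    rw [this]
    refine tsum_congr fun j => ?_
    rw [hha, norm_columnProfile, mul_pow, div_pow, Real.sq_sqrt (by positivity)]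
    ring
  have hin : ∀ k, ‖(inner ℂ h (c k) : ℂ)‖ ≤ B k * Z' := by
    intro k
    rw [lp.inner_eq_tsum, hZ', ← tsum_mul_left]
    refine tsum_of_norm_bounded (summable_sqrtDecay.mul_left (B k)).hasSum fun j => ?_
    refine (norm_inner_le_norm _ _).trans ?_
    rw [hha, hc, norm_columnProfile, sqrtDecay]
    calc _ ≤ (1 * (1 / Real.sqrt ((j : ℝ) + 1))) * (B k / ((j : ℝ) + 1)) := by
          have h1 := norm_column_sub_le e hq hqs hβ hν hνα hK ζ hz hR hA k j
          have h2 : ‖z‖⁻¹ ^ j ≤ 1 := pow_le_one₀ hy0 hy1.le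
          gcongr
      _ = _ := by
          have : (0 : ℝ) < Real.sqrt ((j : ℝ) + 1) := by positivity
          field_simp
  have hcs : Summable fun k => ‖c k‖ :=
    Summable.of_nonneg_of_le (fun _ => norm_nonneg _) hcn (hBs.mul_right Z)
  have his : Summable fun k => ‖(inner ℂ h (c k) : ℂ)‖ :=
    Summable.of_nonneg_of_le (fun _ => norm_nonneg _) hin (hBs.mul_right Z')
  obtain ⟨T, hT, hTn⟩ := exists_gram_decomposition h d c hcs his
  refine ⟨T, fun k j => ?_, ?_⟩
  · rw [hT]
    change (starRingEnd ℂ) (d k) * h j + c k j = _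
    rw [hha, hc, hda]; ring
  · have hsplit : (ContinuousLinearMap.adjoint T).comp T -
        (L : ℂ) • InnerProductSpace.rankOne ℂ d d =
        ((ContinuousLinearMap.adjoint T).comp T -
          ((‖h‖ ^ 2 : ℝ) : ℂ) • InnerProductSpace.rankOne ℂ d d) +
        ((‖h‖ ^ 2 - L : ℝ) : ℂ) • InnerProductSpace.rankOne ℂ d d := by
      rw [Complex.ofReal_sub, sub_smul]; abel
    rw [hsplit]
    refine (norm_add_le _ _).trans (add_le_add (hTn.trans ?_) ?_)
    · have h1 : ∑' k, ‖(inner ℂ h (c k) : ℂ)‖ ≤ ∑' k, B k * Z' :=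
        his.tsum_le_tsum hin (hBs.mul_right Z')
      have h2 : ∑' k, ‖c k‖ ≤ ∑' k, B k * Z := hcs.tsum_le_tsum hcn (hBs.mul_right Z)
      have h3 : 0 ≤ ∑' k, ‖(inner ℂ h (c k) : ℂ)‖ := tsum_nonneg fun _ => norm_nonneg _
      have h4 : 0 ≤ ∑' k, ‖c k‖ := tsum_nonneg fun _ => norm_nonneg _
      have h5 : 0 ≤ ∑' k, D k := (norm_nonneg _).trans hdn
      gcongr
    · rw [norm_smul, Complex.norm_real, Real.norm_eq_abs, hhn, InnerProductSpace.norm_rankOne]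
      calc _ ≤ 1 * ((∑' k, D k) * ∑' k, D k) := by
            have h5 : 0 ≤ ∑' k, D k := (norm_nonneg _).trans hdn
            gcongr
        _ = _ := by ring

/-! ### The Taylor sheet in the normalized variable -/

/-- `f` is the Taylor sheet in the variable `u = (x / x₀)^s`, which places the dominant singularity
at `u = 1`: it is bounded by `M` on an indented disk and has a square-root jet at `1`, with
coefficients and fourth-order error bounded by `C₀`. -/
structure NormalizedSheet {N : ℕ} (e : Fin N → ℕ) (ζ : Fin N → ℂ) (x₀ lam κ : ℂ)
    (c H η M C₀ : ℝ) (f : ℂ → ℂ) (a₂ a₃ : ℂ) : Prop where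
  differentiableOn : DifferentiableOn ℂ f (sectorDisk c H)
  bound : ∀ u ∈ sectorDisk c H, ‖f u‖ ≤ M
  germ : ∀ᶠ x in 𝓝 (0 : ℂ), f ((x / x₀) ^ symIndex e) = taylorBranch e ζ x
  coeff_le : ‖lam‖ + ‖κ‖ + ‖a₂‖ + ‖a₃‖ ≤ C₀
  jet : ∀ u ∈ sectorDisk c H, ‖1 - u‖ < η →
    ‖f u - (lam + (((Real.sqrt (symIndex e))⁻¹ : ℝ) * κ) * (1 - u) ^ (1 / 2 : ℂ) + a₂ * (1 - u) +
      a₃ * (1 - u) ^ (3 / 2 : ℂ))‖ ≤ C₀ * ‖1 - u‖ ^ 2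

theorem mul_mem_indentedDisk {z : ℂ} (hz : z ≠ 0) {φ η H : ℝ} (hφ : 0 < φ) (hφ2 : φ < Real.pi / 2)
    (hH : H * ‖z‖ ≤ η) {u : ℂ} (hu : u ∈ sectorDisk (Real.cos φ) H) :
    z * u ∈ indentedDisk z φ η := by
  have hzn : 0 < ‖z‖ := norm_pos_iff.2 hz
  have hcos : 0 < Real.cos φ := Real.cos_pos_of_mem_Ioo ⟨by linarith, hφ2⟩
  refine ⟨?_, ?_, ?_⟩
  · rw [norm_mul]
    have := mul_lt_mul_of_pos_left hu.1 hzn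
    linarith
  · intro h
    have h1 : u = 1 := mul_left_cancel₀ hz (by rw [h, mul_one])
    have h2 := hu.2
    rw [h1] at h2
    simp at h2
  · rw [mul_div_cancel_left₀ _ hz]
    by_contra! hcon
    have h2 := hu.2
    have h3 : Real.cos φ ≤ Real.cos (u - 1).arg := by
      rw [← Real.cos_abs (u - 1).arg]
      exact Real.cos_le_cos_of_nonneg_of_le_pi (abs_nonneg _) (by linarith [Real.pi_pos]) hcon
    have h4 : (u - 1).re = ‖u - 1‖ * Real.cos (u - 1).arg := (Complex.norm_mul_cos_arg _).symm
    rw [h4] at h2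
    nlinarith [norm_nonneg (u - 1)]

theorem norm_le_on_indentedDisk {z : ℂ} {φ η M : ℝ} {W : ℂ → ℂ}
    (hW : DiffContOnCl ℂ W (indentedDisk z φ η))
    (hM : ∀ w ∈ frontier (indentedDisk z φ η), ‖W w‖ ≤ M) {w : ℂ} (hw : w ∈ indentedDisk z φ η) :
    ‖W w‖ ≤ M := by
  refine Complex.norm_le_of_forall_mem_frontier_norm_le ?_ hW hM (subset_closure hw)
  refine (isBounded_ball (x := (0 : ℂ)) (r := ‖z‖ + η)).subset fun v hv => ?_
  simpa using hv.1

theorem CriticalApproach.norm_rep {N : ℕ} {e : Fin N → ℕ} {ζ : ℝ → Fin N → ℂ} {xs lam κ : ℝ → ℂ}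
    {ε₁ : ℝ} (h : CriticalApproach e ζ xs lam κ ε₁) {ε : ℝ} (hε : ε ∈ Set.Ico 0 ε₁) :
    ‖xs ε‖ = 1 + ε := by
  rcases hε.1.eq_or_lt with rfl | hpos
  · have h1 := h.critical.1
    rw [h.critical.2.1.1] at h1
    have := congrArg ENNReal.toReal h1
    rw [ENNReal.toReal_ofReal (norm_nonneg _)] at this
    simpa using this
  · have h1 := h.radius ε ⟨hpos, hε.2⟩
    rw [(h.dominant ε ⟨hpos, hε.2⟩).1] at h1
    have := congrArg ENNReal.toReal h1
    rwa [ENNReal.toReal_ofReal (norm_nonneg _), ENNReal.toReal_ofReal (by linarith)] at this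

theorem CriticalApproach.rhoStar_eq {N : ℕ} {e : Fin N → ℕ} {ζ : ℝ → Fin N → ℂ}
    {xs lam κ : ℝ → ℂ} {ε₁ : ℝ} (h : CriticalApproach e ζ xs lam κ ε₁) {ε : ℝ}
    (hε : ε ∈ Set.Ioo 0 ε₁) : rhoStar e (ζ ε) = 1 + ε := by
  rw [rhoStar, h.radius ε hε, ENNReal.toReal_ofReal (by linarith [hε.1])]

theorem CriticalApproach.exists_normalizedSheet {N : ℕ} {e : Fin N → ℕ} {ζ : ℝ → Fin N → ℂ}
    {xs lam κ : ℝ → ℂ} {ε₁ : ℝ} (h : CriticalApproach e ζ xs lam κ ε₁) :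
    ∃ c H η M C₀ c₀ : ℝ, 0 < c ∧ c < 1 ∧ 0 < H ∧ 0 < η ∧ 0 < C₀ ∧ 0 < c₀ ∧
      ∃ (F : ℝ → ℂ → ℂ) (a₂ a₃ : ℝ → ℂ), ∀ᶠ ε in 𝓝[>] (0 : ℝ), c₀ ≤ ‖lam ε‖ ∧ c₀ ≤ ‖κ ε‖ ∧
        NormalizedSheet e (ζ ε) (xs ε) (lam ε) (κ ε) c H η M C₀ (F ε) (a₂ ε) (a₃ ε) := by
  obtain ⟨ε₀, φ, η₀, M, C₀, c₀, hε₀, hφ, hφ2, hη₀, hC₀, hc₀, hmain⟩ := h.continuation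
  have hcos : 0 < Real.cos φ := Real.cos_pos_of_mem_Ioo ⟨by linarith, hφ2⟩
  have hcos1 : Real.cos φ < 1 := by
    have := Real.cos_lt_cos_of_nonneg_of_le_pi le_rfl (by linarith [Real.pi_pos]) hφ
    rwa [Real.cos_zero] at this
  have hsmall : ∀ᶠ ε in 𝓝[>] (0 : ℝ), (1 + ε) ^ symIndex e < 2 := by
    have ht : Tendsto (fun ε : ℝ => (1 + ε) ^ symIndex e) (𝓝[>] 0) (𝓝 ((1 + 0) ^ symIndex e)) :=
      (Continuous.tendsto (by fun_prop) 0).mono_left nhdsWithin_le_nhds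
    exact ht.eventually_lt_const (by norm_num)
  have hev : ∀ᶠ ε in 𝓝[>] (0 : ℝ), ∃ D : (ℂ → ℂ) × ℂ × ℂ, c₀ ≤ ‖lam ε‖ ∧ c₀ ≤ ‖κ ε‖ ∧
      NormalizedSheet e (ζ ε) (xs ε) (lam ε) (κ ε) (Real.cos φ) (η₀ / 4) η₀ M C₀
        D.1 D.2.1 D.2.2 := by
    filter_upwards [hsmall, Ioo_mem_nhdsGT hε₀, Ioo_mem_nhdsGT h.eps_pos] with ε h2 hε hε'
    obtain ⟨W, c, d, hgerm, hW, hM, hl, hk, hcoef, hjet⟩ := hmain ε hε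
    have hxn := h.norm_rep ⟨hε'.1.le, hε'.2⟩
    have hx0 : xs ε ≠ 0 := by
      rw [← norm_pos_iff, hxn]; linarith [hε.1]
    have hz0 : xs ε ^ symIndex e ≠ 0 := pow_ne_zero _ hx0
    have hmem : ∀ u ∈ sectorDisk (Real.cos φ) (η₀ / 4), xs ε ^ symIndex e * u ∈
        indentedDisk (xs ε ^ symIndex e) φ (η₀ / 2) := fun u hu =>
      mul_mem_indentedDisk hz0 hφ hφ2 (by rw [norm_pow, hxn]; nlinarith) hu
    refine ⟨(fun u => W (xs ε ^ symIndex e * u), c, d), hl, hk, ?_, ?_, ?_, hcoef, ?_⟩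
    · exact hW.differentiableOn.comp (by fun_prop) hmem
    · exact fun u hu => norm_le_on_indentedDisk hW hM (hmem u hu)
    · filter_upwards [hgerm] with x hx
      rw [← hx, div_pow, mul_div_cancel₀ _ hz0]
    · intro u hu hδ
      have := hjet _ (hmem u hu) (1 - u) (by rw [mul_div_cancel_left₀ _ hz0]) hδ
      exact this
  obtain ⟨D, hD⟩ := hev.choice
  exact ⟨Real.cos φ, η₀ / 4, η₀, M, C₀, c₀, hcos, hcos1, by positivity, hη₀, hC₀, hc₀,
    fun ε => (D ε).1, fun ε => (D ε).2.1, fun ε => (D ε).2.2, hD⟩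

theorem sectorDisk_mono {c H c' H' : ℝ} (hc : c' ≤ c) (hH : H' ≤ H) :
    sectorDisk c' H' ⊆ sectorDisk c H := fun u hu =>
  ⟨by linarith [hu.1], hu.2.trans_le (by gcongr)⟩

theorem branchCoeff_eq_taylorCoeff {N : ℕ} {e : Fin N → ℕ} {ζ : Fin N → ℂ} {x₀ : ℂ}
    (hx₀ : x₀ ≠ 0) (hs : symIndex e ≠ 0) {f : ℂ → ℂ} (hf : AnalyticAt ℂ f 0)
    (hgerm : ∀ᶠ x in 𝓝 (0 : ℂ), f ((x / x₀) ^ symIndex e) = taylorBranch e ζ x) (p m : ℕ) :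
    branchCoeff e ζ p m * (x₀ ^ symIndex e) ^ m = taylorCoeff (fun u => f u ^ p) m := by
  have h1 : branchCoeff e ζ p m = taylorCoeff (fun x => taylorBranch e ζ x ^ p)
    (m * symIndex e) := rfl
  have h2 : (fun x => taylorBranch e ζ x ^ p) =ᶠ[𝓝 0]
      fun x => (fun y : ℂ => f (y ^ symIndex e) ^ p) (x₀⁻¹ * x) := by
    filter_upwards [hgerm] with x hx
    rw [← hx, div_eq_inv_mul]
  have h3 : AnalyticAt ℂ (fun y : ℂ => f (y ^ symIndex e) ^ p) 0 := by
    refine AnalyticAt.fun_pow (AnalyticAt.fun_comp ?_ (by fun_prop)) p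
    simpa [hs] using hf
  rw [h1, taylorCoeff_congr h2, taylorCoeff_comp_const_mul h3,
    taylorCoeff_comp_pow (f := fun z => f z ^ p) (hf.fun_pow p) hs, ← pow_mul, mul_comm m]
  rw [mul_right_comm, ← mul_pow, inv_mul_cancel₀ hx₀, one_pow, one_mul]

/-! ### Bounds by the supremum on the midpoint circle -/

/-- A function bounded by `M₀` on a circle slightly inside the unit circle, and bounded on a fixed
indented disk, is nearly bounded by `M₀` slightly outside the unit circle, away from `1`.  This is
the Schwarz lemma on disks of fixed radius. -/
theorem exists_norm_le_of_circle {c H M M₀ ν r₀ : ℝ} (hc : 0 < c) (hc1 : c < 1) (hH : 0 < H)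
    (hM : 0 ≤ M) (hν : M₀ < ν) (hr₀ : 0 < r₀) :
    ∃ H' τ₀ : ℝ, 0 < H' ∧ H' ≤ H ∧ 0 < τ₀ ∧ ∀ (f : ℂ → ℂ) (τ : ℝ), 0 < τ → τ < τ₀ →
      DifferentiableOn ℂ f (sectorDisk c H) → (∀ u ∈ sectorDisk c H, ‖f u‖ ≤ M) →
      (∀ u ∈ sphere (0 : ℂ) (1 - τ), ‖f u‖ ≤ M₀) →
      ∀ u ∈ sectorDisk (c / 2) H', r₀ ≤ ‖1 - u‖ → ‖f u‖ ≤ ν := by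
  set R := min (c * r₀ / 4) (H / 2) with hR
  have hR0 : 0 < R := by positivity
  set σ := min (R / 2) ((ν - M₀) * R / (2 * M + 1)) with hσ
  have hσ0 : 0 < σ := by
    have := sub_pos.2 hν
    positivity
  refine ⟨min (σ / 2) (H / 2), min (σ / 2) (1 / 2), by positivity, (min_le_right _ _).trans
    (by linarith), by positivity, ?_⟩
  intro f τ hτ hτ0 hf hfM hf0 u hu hur
  have hτσ : τ < σ / 2 := hτ0.trans_le (min_le_left _ _)
  have hτ1 : τ < 1 / 2 := hτ0.trans_le (min_le_right _ _)
  rcases le_or_gt ‖u‖ (1 - τ) with hle | hgt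
  · have hd : DiffContOnCl ℂ f (ball 0 (1 - τ)) := by
      refine DifferentiableOn.diffContOnCl_ball hf fun v hv => ?_
      exact mem_sectorDisk_of_norm_lt_one hc hH (by
        rw [mem_closedBall_zero_iff] at hv; linarith)
    refine (Complex.norm_le_of_forall_mem_frontier_norm_le isBounded_ball hd (C := M₀) ?_ ?_).trans
      hν.le
    · intro v hv
      rw [frontier_ball _ (by linarith)] at hv
      exact hf0 v hv
    · rw [closure_ball _ (by linarith)]
      simpa using hle
  · have hun : 0 < ‖u‖ := by linarith
    set v : ℂ := ((1 - τ) / ‖u‖ : ℝ) * u with hv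
    have hvn : ‖v‖ = 1 - τ := by
      rw [hv, norm_mul, Complex.norm_real, Real.norm_of_nonneg (by
        have : 0 ≤ 1 - τ := by linarith
        positivity)]
      field_simp
    have huv : ‖v - u‖ = ‖u‖ - (1 - τ) := by
      have e : v - u = -(((‖u‖ - (1 - τ)) / ‖u‖ : ℝ) : ℂ) * u := by
        rw [hv]
        have : (‖u‖ : ℂ) ≠ 0 := by exact_mod_cast hun.ne'
        push_cast
        field_simp
        ring
      rw [e, norm_mul, norm_neg, Complex.norm_real, Real.norm_of_nonneg
        (div_nonneg (by linarith) hun.le)]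
      field_simp
    have huvσ : ‖v - u‖ < σ := by
      rw [huv]
      have := hu.1
      have h2 : min (σ / 2) (H / 2) ≤ σ / 2 := min_le_left _ _
      linarith
    have hball : ball u R ⊆ sectorDisk c H := by
      intro w hw
      rw [mem_ball, dist_eq_norm] at hw
      have hR1 : R ≤ c * r₀ / 4 := min_le_left _ _
      have hR2 : R ≤ H / 2 := min_le_right _ _
      constructor
      · have h1 := norm_add_le u (w - u)
        rw [add_sub_cancel] at h1
        have h2 : min (σ / 2) (H / 2) ≤ H / 2 := min_le_right _ _
        linarith [hu.1]
      · have h1 : (w - 1).re ≤ (u - 1).re + ‖w - u‖ := by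
          have := Complex.re_le_norm (w - u)
          simp at this ⊢; linarith
        have h2 : ‖u - 1‖ ≤ ‖w - 1‖ + ‖w - u‖ := by
          have := norm_sub_le (w - 1) (w - u)
          have e : w - 1 - (w - u) = u - 1 := by ring
          rwa [e] at this
        have h3 := hu.2
        rw [norm_sub_rev] at hur
        have h4 : c * ‖w - u‖ ≤ 1 * ‖w - u‖ := by gcongr
        have h5 := mul_le_mul_of_nonneg_left h2 hc.le
        have h6 := mul_le_mul_of_nonneg_left hur hc.le
        linarith
    have hvR : v ∈ ball u R := by
      rw [mem_ball, dist_eq_norm]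
      have : σ ≤ R / 2 := min_le_left _ _
      linarith
    have hfu := hfM u (hball (mem_ball_self hR0))
    have hmaps : Set.MapsTo f (ball u R) (closedBall (f u) (2 * M + 1)) := by
      intro w hw
      rw [mem_closedBall, dist_eq_norm]
      have := norm_sub_le (f w) (f u)
      have := hfM w (hball hw)
      linarith
    have hS := Complex.dist_le_div_mul_dist_of_mapsTo_ball (hf.mono hball) hmaps hvR
    rw [dist_eq_norm, dist_eq_norm] at hS
    have hfv := hf0 v (by rw [mem_sphere_zero_iff_norm, hvn])
    have h1 : ‖f u‖ ≤ ‖f v‖ + ‖f v - f u‖ := by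
      have := norm_sub_le (f v) (f v - f u)
      rwa [sub_sub_cancel] at this
    have h2 : (2 * M + 1) / R * ‖v - u‖ ≤ ν - M₀ := by
      calc _ ≤ (2 * M + 1) / R * ((ν - M₀) * R / (2 * M + 1)) := by
            have : σ ≤ (ν - M₀) * R / (2 * M + 1) := min_le_right _ _
            gcongr
            linarith
        _ = ν - M₀ := by field_simp
    linarith

/-! ### Uniform coefficient asymptotics along the critical approach -/

section
variable {N : ℕ} {e : Fin N → ℕ} {ζ : Fin N → ℂ} {x₀ lam κ : ℂ} {c H η M C₀ : ℝ} {f : ℂ → ℂ}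
  {a₂ a₃ : ℂ}

theorem div_pow_mem_sectorDisk (hc : 0 < c) (hH : 0 < H) (hs : symIndex e ≠ 0) {x : ℂ}
    (hx : x ∈ ball (0 : ℂ) ‖x₀‖) : (x / x₀) ^ symIndex e ∈ sectorDisk c H := by
  rw [mem_ball_zero_iff] at hx
  have h0 : 0 < ‖x₀‖ := (norm_nonneg x).trans_lt hx
  refine mem_sectorDisk_of_norm_lt_one hc hH ?_
  rw [norm_pow, norm_div]
  exact pow_lt_one₀ (by positivity) ((div_lt_one h0).2 hx) hs

theorem NormalizedSheet.differentiableOn_ball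
    (h : NormalizedSheet e ζ x₀ lam κ c H η M C₀ f a₂ a₃) (hc : 0 < c) (hH : 0 < H)
    (hs : symIndex e ≠ 0) :
    DifferentiableOn ℂ (fun x => f ((x / x₀) ^ symIndex e)) (ball 0 ‖x₀‖) := by
  refine DifferentiableOn.comp h.differentiableOn (f := fun x => (x / x₀) ^ symIndex e)
    (by fun_prop) ?_
  intro x hx
  exact div_pow_mem_sectorDisk hc hH hs hx

theorem NormalizedSheet.isTaylorSheetOn
    (h : NormalizedSheet e ζ x₀ lam κ c H η M C₀ f a₂ a₃) (hc : 0 < c) (hH : 0 < H)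
    (hs : symIndex e ≠ 0) (he : ∀ n, e n ≠ 0) (hx₀ : x₀ ≠ 0) :
    IsTaylorSheetOn e ζ (ball 0 ‖x₀‖) fun x => f ((x / x₀) ^ symIndex e) := by
  have ha := (h.differentiableOn_ball hc hH hs).analyticOnNhd isOpen_ball
  have hU := taylorBranch_spec e he ζ
  have hg := h.germ
  refine ⟨⟨ha 0 (mem_ball_self (norm_pos_iff.2 hx₀)), ?_, ?_⟩, ha⟩
  · exact hg.self_of_nhds.trans hU.2.1
  · filter_upwards [hg, hU.2.2] with x h1 h2
    rw [h1, h2]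

/-- Two continuations of the Taylor branch to a disk coincide. -/
theorem IsTaylorSheetOn.eqOn_ball (he : ∀ n, e n ≠ 0) {r : ℝ} {g₁ g₂ : ℂ → ℂ}
    (h₁ : IsTaylorSheetOn e ζ (ball 0 r) g₁) (h₂ : IsTaylorSheetOn e ζ (ball 0 r) g₂) :
    Set.EqOn g₁ g₂ (ball 0 r) := by
  rcases le_or_gt r 0 with hr | hr
  · simp [ball_eq_empty.2 hr]
  · exact h₁.2.eqOn_of_preconnected_of_eventuallyEq h₂.2
      (convex_ball (0 : ℂ) r).isPreconnected (mem_ball_self hr) (h₁.1.eventuallyEq he h₂.1)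

theorem NormalizedSheet.norm_le_on_circle
    (h : NormalizedSheet e ζ x₀ lam κ c H η M C₀ f a₂ a₃) (hc : 0 < c) (hH : 0 < H)
    (hs : symIndex e ≠ 0) (he : ∀ n, e n ≠ 0) (hx₀ : x₀ ≠ 0) {g : ℂ → ℂ}
    (hg : IsTaylorSheetOn e ζ (ball 0 ‖x₀‖) g) {ρ M₀ : ℝ} (hρ0 : 0 ≤ ρ) (hρ : ρ < ‖x₀‖)
    (hgM : ∀ x ∈ sphere (0 : ℂ) ρ, ‖g x‖ ≤ M₀) :
    ∀ u ∈ sphere (0 : ℂ) ((ρ / ‖x₀‖) ^ symIndex e), ‖f u‖ ≤ M₀ := by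
  intro u hu
  rw [mem_sphere_zero_iff_norm] at hu
  obtain ⟨y, hy⟩ := IsAlgClosed.exists_pow_nat_eq u (Nat.pos_of_ne_zero hs)
  have hxn : 0 < ‖x₀‖ := norm_pos_iff.2 hx₀
  have hyn : ‖y‖ = ρ / ‖x₀‖ := by
    rw [← hy, norm_pow] at hu
    exact (pow_left_inj₀ (norm_nonneg _) (by positivity) hs).1 hu
  have hxy : ‖x₀ * y‖ = ρ := by rw [norm_mul, hyn]; field_simp
  have heq := (h.isTaylorSheetOn hc hH hs he hx₀).eqOn_ball he hg
    (show x₀ * y ∈ ball (0 : ℂ) ‖x₀‖ by rw [mem_ball_zero_iff, hxy]; exact hρ)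
  simp only [mul_div_cancel_left₀ _ hx₀, hy] at heq
  rw [heq]
  exact hgM _ (by rw [mem_sphere_zero_iff_norm, hxy])
end

theorem norm_transferAmplitude_le {s : ℕ} (hs : 1 ≤ s) {κ lam : ℂ} {C ν : ℝ} (hν : 0 < ν)
    (hκ : ‖κ‖ ≤ C) (hl : ‖lam‖ ≤ ν) {p : ℕ} (hp : 1 ≤ p) :
    ‖transferAmplitude s κ lam p‖ ≤ C / ν * p * ν ^ p := by
  obtain ⟨n, rfl⟩ := Nat.exists_eq_add_of_le' hp
  have hs1 : 1 ≤ Real.sqrt s := Real.one_le_sqrt.2 (by exact_mod_cast hs)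
  have hP1 : 1 ≤ Real.sqrt Real.pi := Real.one_le_sqrt.2 (by linarith [Real.pi_gt_three])
  have hC : 0 ≤ C := (norm_nonneg _).trans hκ
  unfold transferAmplitude
  rw [norm_mul, norm_mul, norm_mul, norm_neg, Complex.norm_real, Real.norm_of_nonneg
    (by positivity), norm_pow, Nat.add_sub_cancel, Complex.norm_natCast]
  have h1 : (Real.sqrt s)⁻¹ / (2 * Real.sqrt Real.pi) ≤ 1 := by
    rw [div_le_one (by positivity)]
    exact (inv_le_one_of_one_le₀ hs1).trans (by linarith)
  calc _ ≤ 1 * ((n + 1 : ℕ) : ℝ) * C * ν ^ n := by gcongr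
    _ = _ := by field_simp; ring

theorem tendsto_midpoint_ratio (s : ℕ) :
    Tendsto (fun ε : ℝ => ((1 + ε / 2) / (1 + ε)) ^ s) (𝓝[>] 0) (𝓝 1) := by
  have h1 : ContinuousAt (fun ε : ℝ => ((1 + ε / 2) / (1 + ε)) ^ s) 0 := by
    refine ContinuousAt.pow (ContinuousAt.div (by fun_prop) (by fun_prop) (by norm_num)) s
  have h2 := h1.tendsto.mono_left (nhdsWithin_le_nhds (s := Set.Ioi 0))
  simpa using h2

/-- The coefficients of all powers of the Taylor branch follow the square-root profile, uniformly
along the critical approach and with an error whose growth in the power is slower than `α^p`. -/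
theorem CriticalApproach.exists_coeff_asymptotics {N : ℕ} {e : Fin N → ℕ}
    {ζ : ℝ → Fin N → ℂ} {xs lam κ : ℝ → ℂ} {ε₁ : ℝ} (h : CriticalApproach e ζ xs lam κ ε₁)
    (he : ∀ n, e n ≠ 0) (hs : 1 ≤ symIndex e) {α : ℝ} (hα : AdmissibleWeight e ζ lam α) :
    ∃ ν K : ℝ, 0 < ν ∧ ν < α ∧ 0 ≤ K ∧ ∀ᶠ ε in 𝓝[>] (0 : ℝ),
      (∀ p m : ℕ, 1 ≤ p → ‖branchCoeff e (ζ ε) p m * (xs ε ^ symIndex e) ^ m -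
        transferAmplitude (symIndex e) (κ ε) (lam ε) p * (sqrtDecay m : ℂ)‖ ≤
          K * ν ^ p / ((m : ℝ) + 1) ^ 2) ∧
      ∀ p : ℕ, 1 ≤ p → ‖transferAmplitude (symIndex e) (κ ε) (lam ε) p‖ ≤ K * p * ν ^ p := by
  obtain ⟨c, H, η, M, C₀, c₀, hc, hc1, hH, hη, hC₀, hc₀, F, a₂, a₃, hF⟩ := h.exists_normalizedSheet
  obtain ⟨M₀, L₀, ε₂, hε₂, hmax, hadm⟩ := hα
  have hM : 0 ≤ M := by
    obtain ⟨ε, hε⟩ := hF.exists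
    exact (norm_nonneg _).trans (hε.2.2.bound 0 (mem_sectorDisk_of_norm_lt_one hc hH (by simp)))
  have hL₀ : 0 < L₀ := by
    obtain ⟨ε, hε, hε'⟩ := (hF.and (Ioo_mem_nhdsGT hε₂)).exists
    exact hc₀.trans_le (hε.1.trans (hadm ε hε').2)
  set ν := (max M₀ L₀ + α) / 2 with hν
  have hM₀ν : M₀ < ν := by linarith [le_max_left M₀ L₀]
  have hL₀ν : L₀ < ν := by linarith [le_max_right M₀ L₀]
  have hνα : ν < α := by linarith
  have hν0 : 0 < ν := hL₀.trans hL₀ν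
  -- the radius at which the majorant of the jet of the sheet is at most `ν`
  set r := min (min 1 η) ((ν - L₀) / (4 * C₀)) with hr
  have hr0 : 0 < r := by
    have := sub_pos.2 hL₀ν
    positivity
  have hr1 : r ≤ 1 := (min_le_left _ _).trans (min_le_left _ _)
  have hrη : r ≤ η := (min_le_left _ _).trans (min_le_right _ _)
  have hrν : L₀ + 4 * C₀ * r ≤ ν := by
    have : r ≤ (ν - L₀) / (4 * C₀) := min_le_right _ _
    rw [le_div_iff₀ (by positivity)] at this
    linarith
  obtain ⟨H', τ₀, hH', hH'H, hτ₀, hcircle⟩ := exists_norm_le_of_circle hc hc1 hH hM hM₀ν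
    (pow_pos hr0 2)
  have hc2 : c / 2 < 1 := by linarith
  obtain ⟨K, hK, htransfer⟩ := exists_transfer_pow (half_pos hc) hc2 hH' hr0
  refine ⟨ν, max K (C₀ / ν), hν0, hνα, hK.le.trans (le_max_left _ _), ?_⟩
  have hτev : ∀ᶠ ε in 𝓝[>] (0 : ℝ), 1 - τ₀ < ((1 + ε / 2) / (1 + ε)) ^ symIndex e :=
    (tendsto_midpoint_ratio _).eventually_const_lt (by linarith)
  filter_upwards [hF, Ioo_mem_nhdsGT hε₂, Ioo_mem_nhdsGT h.eps_pos, hτev] with ε hε hεa hε1 hτ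
  obtain ⟨hl, hk, hsheet⟩ := hε
  obtain ⟨⟨g, hg, hgM⟩, hlL⟩ := hadm ε hεa
  have hs0 : symIndex e ≠ 0 := by omega
  have hpos : 0 < ε := hε1.1
  have hxn := h.norm_rep ⟨hε1.1.le, hε1.2⟩
  have hx0 : xs ε ≠ 0 := by rw [← norm_pos_iff, hxn]; linarith
  have hρ := h.rhoStar_eq hε1
  have hmid : midRadius e (ζ ε) = 1 + ε / 2 := by rw [midRadius, hρ]; ring
  rw [hρ, ← hxn] at hg
  rw [hmid] at hgM
  have hcirc := hsheet.norm_le_on_circle hc hH hs0 he hx0 hg (by linarith) (by rw [hxn]; linarith)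
    hgM
  rw [hxn] at hcirc
  have hlt1 : ((1 + ε / 2) / (1 + ε)) ^ symIndex e < 1 :=
    pow_lt_one₀ (by positivity) ((div_lt_one (by linarith)).2 (by linarith)) hs0
  have hfar := hcircle (F ε) (1 - ((1 + ε / 2) / (1 + ε)) ^ symIndex e) (by linarith) (by linarith)
    hsheet.differentiableOn hsheet.bound (by rwa [sub_sub_cancel])
  have hsub : sectorDisk (c / 2) H' ⊆ sectorDisk c H := sectorDisk_mono (by linarith) hH'H
  have hs1 : 1 ≤ Real.sqrt (symIndex e) := Real.one_le_sqrt.2 (by exact_mod_cast hs)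
  set a₁ : ℂ := ((Real.sqrt (symIndex e))⁻¹ : ℝ) * κ ε with ha₁
  have hcoef := hsheet.coeff_le
  have n0 := norm_nonneg (lam ε)
  have n1 := norm_nonneg (κ ε)
  have n2 := norm_nonneg (a₂ ε)
  have n3 := norm_nonneg (a₃ ε)
  have ha₁n : ‖a₁‖ ≤ ‖κ ε‖ := by
    rw [ha₁, norm_mul, Complex.norm_real, Real.norm_of_nonneg (by positivity)]
    exact mul_le_of_le_one_left n1 (inv_le_one_of_one_le₀ hs1)
  have hjetN : jetNorm r (lam ε) a₁ (a₂ ε) (a₃ ε) C₀ ≤ ν := by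
    refine le_trans ?_ hrν
    have r2 : r ^ 2 ≤ r := pow_le_of_le_one hr0.le hr1 (by norm_num)
    have r3 : r ^ 3 ≤ r := pow_le_of_le_one hr0.le hr1 (by norm_num)
    have r4 : r ^ 4 ≤ r := pow_le_of_le_one hr0.le hr1 (by norm_num)
    calc jetNorm r (lam ε) a₁ (a₂ ε) (a₃ ε) C₀
        ≤ L₀ + C₀ * r + C₀ * r + C₀ * r + C₀ * r := by
          unfold jetNorm
          gcongr <;> linarith
      _ = L₀ + 4 * C₀ * r := by ring
  have hjet : ∀ u ∈ sectorDisk (c / 2) H', ‖1 - u‖ < r ^ 2 →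
      ‖F ε u - (lam ε + a₁ * (1 - u) ^ (1 / 2 : ℂ) + a₂ ε * (1 - u) +
        a₃ ε * (1 - u) ^ (3 / 2 : ℂ))‖ ≤ C₀ * ‖1 - u‖ ^ 2 := by
    intro u hu hur
    refine hsheet.jet u (hsub hu) (hur.trans_le ?_)
    exact (pow_le_of_le_one hr0.le hr1 (by norm_num)).trans hrη
  have hbound : ∀ u ∈ sectorDisk (c / 2) H', ‖F ε u‖ ≤ ν := by
    intro u hu
    rcases lt_or_ge ‖1 - u‖ (r ^ 2) with hlt | hge
    · refine le_trans ?_ hjetN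
      have h1 := hjet u hu hlt
      set t := (1 - u) ^ (1 / 2 : ℂ) with ht
      have ht2 : 1 - u = t ^ 2 := by rw [ht, ← Complex.cpow_nat_mul]; norm_num
      have ht3 : (1 - u) ^ (3 / 2 : ℂ) = t ^ 3 := by rw [ht, ← Complex.cpow_nat_mul]; norm_num
      rw [ht3, ht2, norm_pow, ← pow_mul] at h1
      have htr : ‖t‖ ≤ r := by
        rw [ht2, norm_pow] at hlt
        exact (lt_of_pow_lt_pow_left₀ 2 hr0.le hlt).le
      set Q := lam ε + a₁ * t + a₂ ε * t ^ 2 + a₃ ε * t ^ 3 with hQ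
      have h2 : ‖F ε u‖ ≤ ‖Q‖ + ‖F ε u - Q‖ := by
        have := norm_add_le Q (F ε u - Q)
        rwa [add_sub_cancel] at this
      have h3 : ‖Q‖ ≤ ‖lam ε‖ + ‖a₁‖ * r + ‖a₂ ε‖ * r ^ 2 + ‖a₃ ε‖ * r ^ 3 := by
        refine norm_add₄_le.trans ?_
        simp only [norm_mul, norm_pow]
        gcongr
      have h4 : C₀ * ‖t‖ ^ (2 * 2) ≤ C₀ * r ^ 4 := by
        norm_num
        gcongr
      unfold jetNorm
      linarith
    · exact hfar u hu hge
  have hmain := htransfer (F ε) ν C₀ (lam ε) a₁ (a₂ ε) (a₃ ε)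
    (hsheet.differentiableOn.mono hsub) hC₀.le hbound hjetN hjet
  have hfa : AnalyticAt ℂ (F ε) 0 := hsheet.differentiableOn.analyticAt
    ((isOpen_sectorDisk c H).mem_nhds (mem_sectorDisk_of_norm_lt_one hc hH (by simp)))
  refine ⟨fun p m hp => ?_, fun p hp => ?_⟩
  · rw [branchCoeff_eq_taylorCoeff hx0 hs0 hfa hsheet.germ]
    have hA : transferAmplitude (symIndex e) (κ ε) (lam ε) p * (sqrtDecay m : ℂ) =
        -(p * a₁ * lam ε ^ (p - 1) *
          ((1 / (2 * Real.sqrt Real.pi) * sqrtDecay m : ℝ) : ℂ)) := by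
      rw [transferAmplitude, ha₁]
      push_cast
      ring
    rw [hA, sub_neg_eq_add]
    refine (hmain p m).trans ?_
    gcongr
    exact le_max_left _ _
  · refine (norm_transferAmplitude_le hs hν0 (C := C₀) (by linarith)
      (hlL.trans hL₀ν.le) hp).trans ?_
    gcongr
    exact le_max_right _ _

/-! ### Continuity of the branch value and of the square-root coefficient -/

/-- The equation `F = 0` persists on the disk of analyticity. -/
theorem IsTaylorSheetOn.charPoly_eq_zero {N : ℕ} {e : Fin N → ℕ} {ζ : Fin N → ℂ} {r : ℝ}
    {g : ℂ → ℂ} (h : IsTaylorSheetOn e ζ (ball 0 r) g) {x : ℂ} (hx : x ∈ ball (0 : ℂ) r) :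
    charPoly e ζ (g x) x = 0 := by
  have hr : 0 < r := pos_of_mem_ball hx
  have ha : AnalyticOnNhd ℂ (fun x => charPoly e ζ (g x) x) (ball 0 r) := by
    intro y hy
    have := h.2 y hy
    unfold charPoly
    fun_prop
  exact ha.eqOn_zero_of_preconnected_of_eventuallyEq_zero (convex_ball (0 : ℂ) r).isPreconnected
    (mem_ball_self hr) h.1.2.2 hx

/-- Stability of bounded solutions near the origin: for small `x` the equation is a contraction in
the unknown, with a constant depending only on bounds for the parameters and the solutions. -/
theorem norm_sub_le_of_charPoly_eq_zero {N : ℕ} {e : Fin N → ℕ} (he : ∀ n, e n ≠ 0)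
    {ζ₁ ζ₂ : Fin N → ℂ} {B r : ℝ} (hr1 : r ≤ 1)
    (hrB : r * ∑ n, ‖ζ₁ n‖ * (e n * B ^ (e n - 1)) ≤ 1 / 2) {x y₁ y₂ : ℂ} (hx : ‖x‖ ≤ r)
    (h₁ : charPoly e ζ₁ y₁ x = 0) (h₂ : charPoly e ζ₂ y₂ x = 0) (hy₁ : ‖y₁‖ ≤ B)
    (hy₂ : ‖y₂‖ ≤ B) : ‖y₁ - y₂‖ ≤ 2 * ∑ n, ‖ζ₁ n - ζ₂ n‖ * B ^ e n := by
  have hB : 0 ≤ B := (norm_nonneg _).trans hy₁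
  have hr : 0 ≤ r := (norm_nonneg _).trans hx
  have hx1 : ‖x‖ ≤ 1 := hx.trans hr1
  have hid : y₁ - y₂ = ∑ n, ζ₁ n * x ^ e n * (y₁ ^ e n - y₂ ^ e n) +
      ∑ n, (ζ₁ n - ζ₂ n) * x ^ e n * y₂ ^ e n := by
    rw [← Finset.sum_add_distrib]
    have hs : ∑ n, (ζ₁ n * x ^ e n * (y₁ ^ e n - y₂ ^ e n) +
        (ζ₁ n - ζ₂ n) * x ^ e n * y₂ ^ e n) =
        ∑ n, ζ₁ n * x ^ e n * y₁ ^ e n - ∑ n, ζ₂ n * x ^ e n * y₂ ^ e n := by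
      rw [← Finset.sum_sub_distrib]
      exact Finset.sum_congr rfl fun n _ => by ring
    rw [hs]
    simp only [charPoly] at h₁ h₂
    linear_combination h₁ - h₂
  have hpow : ∀ k : ℕ, ‖y₁ ^ k - y₂ ^ k‖ ≤ k * B ^ (k - 1) * ‖y₁ - y₂‖ := by
    intro k
    rw [← (Commute.all y₁ y₂).geom_sum₂_mul, norm_mul]
    refine mul_le_mul_of_nonneg_right ?_ (norm_nonneg _)
    refine (norm_sum_le _ _).trans ?_
    calc ∑ i ∈ Finset.range k, ‖y₁ ^ i * y₂ ^ (k - 1 - i)‖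
        ≤ ∑ i ∈ Finset.range k, B ^ (k - 1) := by
          refine Finset.sum_le_sum fun i hi => ?_
          rw [norm_mul, norm_pow, norm_pow]
          have hik : k - 1 = i + (k - 1 - i) := by
            have := Finset.mem_range.1 hi
            omega
          calc ‖y₁‖ ^ i * ‖y₂‖ ^ (k - 1 - i) ≤ B ^ i * B ^ (k - 1 - i) := by gcongr
            _ = B ^ (k - 1) := by rw [← pow_add, ← hik]
      _ = k * B ^ (k - 1) := by simp
  have hxe : ∀ n, ‖x‖ ^ e n ≤ r := fun n =>
    (pow_le_of_le_one (norm_nonneg _) hx1 (he n)).trans hx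
  have h1 : ‖∑ n, ζ₁ n * x ^ e n * (y₁ ^ e n - y₂ ^ e n)‖ ≤ 1 / 2 * ‖y₁ - y₂‖ := by
    refine (norm_sum_le _ _).trans ?_
    calc _ ≤ ∑ n, (r * (‖ζ₁ n‖ * (e n * B ^ (e n - 1)))) * ‖y₁ - y₂‖ := by
          refine Finset.sum_le_sum fun n _ => ?_
          rw [norm_mul, norm_mul, norm_pow]
          calc ‖ζ₁ n‖ * ‖x‖ ^ e n * ‖y₁ ^ e n - y₂ ^ e n‖
              ≤ ‖ζ₁ n‖ * r * (e n * B ^ (e n - 1) * ‖y₁ - y₂‖) := by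
                gcongr
                · exact hxe n
                · exact hpow _
            _ = _ := by ring
      _ = (r * ∑ n, ‖ζ₁ n‖ * (e n * B ^ (e n - 1))) * ‖y₁ - y₂‖ := by
          rw [← Finset.sum_mul, ← Finset.mul_sum]
      _ ≤ _ := by gcongr
  have h2 : ‖∑ n, (ζ₁ n - ζ₂ n) * x ^ e n * y₂ ^ e n‖ ≤ ∑ n, ‖ζ₁ n - ζ₂ n‖ * B ^ e n := by
    refine (norm_sum_le _ _).trans (Finset.sum_le_sum fun n _ => ?_)
    rw [norm_mul, norm_mul, norm_pow, norm_pow]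
    calc _ ≤ ‖ζ₁ n - ζ₂ n‖ * 1 * B ^ e n := by
          gcongr
          exact (hxe n).trans hr1
      _ = _ := by ring
  have h3 : ‖y₁ - y₂‖ ≤ 1 / 2 * ‖y₁ - y₂‖ + ∑ n, ‖ζ₁ n - ζ₂ n‖ * B ^ e n := by
    conv_lhs => rw [hid]
    exact (norm_add_le _ _).trans (add_le_add h1 h2)
  linarith

/-- Taylor coefficients depend continuously on the parameters, as long as the sheets stay bounded
on the unit disk. -/
theorem tendsto_taylorCoeff_taylorBranch {N : ℕ} {e : Fin N → ℕ} (he : ∀ n, e n ≠ 0)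
    {l : Filter ℝ} {ζ : ℝ → Fin N → ℂ} {ζ₀ : Fin N → ℂ} (hζ : Tendsto ζ l (𝓝 ζ₀))
    {g : ℝ → ℂ → ℂ} {M : ℝ} (hg : ∀ᶠ ε in l, IsTaylorSheetOn e (ζ ε) (ball 0 1) (g ε) ∧
      ∀ x ∈ ball (0 : ℂ) 1, ‖g ε x‖ ≤ M)
    {g₀ : ℂ → ℂ} (hg₀ : IsTaylorSheetOn e ζ₀ (ball 0 1) g₀) (n : ℕ) :
    Tendsto (fun ε => taylorCoeff (g ε) n) l (𝓝 (taylorCoeff g₀ n)) := by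
  -- the limiting sheet is bounded on a smaller closed disk
  obtain ⟨M₁, hM₁⟩ := (isCompact_closedBall (0 : ℂ) (1 / 2)).exists_bound_of_continuousOn
    (f := g₀) (hg₀.2.continuousOn.mono (closedBall_subset_ball (by norm_num)))
  set B := max M M₁ with hB
  set S := ∑ n, (‖ζ₀ n‖ + 1) * (e n * |B| ^ (e n - 1)) with hS
  have hS0 : 0 ≤ S := Finset.sum_nonneg fun n _ => by positivity
  set r := min (1 / 2) (1 / (2 * (S + 1))) with hr
  have hr0 : 0 < r := by positivity
  have hr2 : r ≤ 1 / 2 := min_le_left _ _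
  have hrS : r * S ≤ 1 / 2 := by
    have h1 : r ≤ 1 / (2 * (S + 1)) := min_le_right _ _
    rw [le_div_iff₀ (by positivity)] at h1
    nlinarith
  have hζn : ∀ n, Tendsto (fun ε => ζ ε n) l (𝓝 (ζ₀ n)) := fun n => tendsto_pi_nhds.1 hζ n
  have hζb : ∀ᶠ ε in l, ∀ n, ‖ζ ε n‖ ≤ ‖ζ₀ n‖ + 1 :=
    eventually_all.2 fun n => (hζn n).norm.eventually_le_const (by linarith)
  set Δ : ℝ → ℝ := fun ε => 2 * ∑ n, ‖ζ ε n - ζ₀ n‖ * |B| ^ e n with hΔ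
  have hΔ0 : Tendsto Δ l (𝓝 0) := by
    have h1 : Tendsto Δ l (𝓝 (2 * ∑ n, ‖ζ₀ n - ζ₀ n‖ * |B| ^ e n)) := by
      refine Tendsto.const_mul 2 (tendsto_finsetSum _ fun n _ => ?_)
      exact ((hζn n).sub_const _).norm.mul_const _
    simpa using h1
  have hclose : ∀ᶠ ε in l, ‖taylorCoeff (g ε) n - taylorCoeff g₀ n‖ ≤ Δ ε / r ^ n := by
    filter_upwards [hg, hζb] with ε hε hb
    obtain ⟨hsheet, hM⟩ := hε
    have hpt : ∀ x : ℂ, ‖x‖ ≤ r → ‖g ε x - g₀ x‖ ≤ Δ ε := by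
      intro x hx
      have hx1 : x ∈ ball (0 : ℂ) 1 := by rw [mem_ball_zero_iff]; linarith
      refine norm_sub_le_of_charPoly_eq_zero he (B := |B|) (hr2.trans (by norm_num)) ?_ hx
        (hsheet.charPoly_eq_zero hx1) (hg₀.charPoly_eq_zero hx1) ?_ ?_
      · refine le_trans ?_ hrS
        rw [hS]
        gcongr with n
        exact hb n
      · exact (hM x hx1).trans ((le_max_left _ _).trans (le_abs_self _))
      · refine (hM₁ x ?_).trans ((le_max_right _ _).trans (le_abs_self _))
        rw [mem_closedBall_zero_iff]; linarith
    have hsub : taylorCoeff (g ε) n - taylorCoeff g₀ n =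
        taylorCoeff (fun x => g ε x - g₀ x) n := by
      have h0 : (0 : ℂ) ∈ ball (0 : ℂ) 1 := mem_ball_self one_pos
      have h1 := taylorCoeff_add (hsheet.2 0 h0) ((hg₀.2 0 h0).fun_const_smul (c := (-1 : ℂ))) n
      have h2 := taylorCoeff_const_mul (-1) g₀ n
      simp only [smul_eq_mul] at h1
      rw [h2] at h1
      have e1 : (fun x => g ε x - g₀ x) = fun x => g ε x + -1 * g₀ x := by
        funext x; ring
      rw [e1, h1]; ring
    rw [hsub, taylorCoeff, norm_div, Complex.norm_natCast, div_le_iff₀ (by positivity)]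
    have hd : DifferentiableOn ℂ (fun x => g ε x - g₀ x) (ball 0 1) :=
      hsheet.2.differentiableOn.sub hg₀.2.differentiableOn
    refine (Complex.norm_iteratedDeriv_le_of_forall_mem_sphere_norm_le n hr0
      (hd.diffContOnCl_ball (closedBall_subset_ball (by linarith))) (C := Δ ε) ?_).trans
      (le_of_eq (by ring))
    intro x hx
    exact hpt x (by rw [mem_sphere_zero_iff_norm] at hx; exact hx.le)
  rw [tendsto_iff_norm_sub_tendsto_zero]
  refine squeeze_zero' (Eventually.of_forall fun _ => norm_nonneg _) hclose ?_
  simpa using hΔ0.div_const (r ^ n)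

/-- Convergence of the sheets on the open unit disk, along converging points. -/
theorem tendsto_sheet_apply {N : ℕ} {e : Fin N → ℕ} (he : ∀ n, e n ≠ 0)
    {l : Filter ℝ} [l.IsCountablyGenerated] {ζ : ℝ → Fin N → ℂ} {ζ₀ : Fin N → ℂ}
    (hζ : Tendsto ζ l (𝓝 ζ₀)) {g : ℝ → ℂ → ℂ} {M : ℝ}
    (hg : ∀ᶠ ε in l, IsTaylorSheetOn e (ζ ε) (ball 0 1) (g ε) ∧ ∀ x ∈ ball (0 : ℂ) 1, ‖g ε x‖ ≤ M)
    {g₀ : ℂ → ℂ} (hg₀ : IsTaylorSheetOn e ζ₀ (ball 0 1) g₀) {x : ℝ → ℂ} {x₀ : ℂ}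
    (hx : Tendsto x l (𝓝 x₀)) (hx₀ : ‖x₀‖ < 1) :
    Tendsto (fun ε => g ε (x ε)) l (𝓝 (g₀ x₀)) := by
  obtain ⟨θ, hθ, hθ1⟩ := exists_between hx₀
  have hθ0 : 0 < θ := (norm_nonneg _).trans_lt hθ
  obtain ⟨R, hR, hR1⟩ := exists_between hθ1
  have hR0 : 0 < R := hθ0.trans hR
  have hxθ : ∀ᶠ ε in l, ‖x ε‖ < θ := hx.norm.eventually_lt_const hθ
  have hsum : Summable fun n : ℕ => M * (θ / R) ^ n :=
    (summable_geometric_of_lt_one (by positivity) ((div_lt_one hR0).2 hR)).mul_left M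
  have hmain : Tendsto (fun ε => ∑' n, taylorCoeff (g ε) n * x ε ^ n) l
      (𝓝 (∑' n, taylorCoeff g₀ n * x₀ ^ n)) := by
    refine tendsto_tsum_of_dominated_convergence hsum (fun n => ?_) ?_
    · exact (tendsto_taylorCoeff_taylorBranch he hζ hg hg₀ n).mul (hx.pow n)
    · filter_upwards [hg, hxθ] with ε hε hxε n
      have hc : ‖taylorCoeff (g ε) n‖ ≤ M / R ^ n := by
        rw [taylorCoeff, norm_div, Complex.norm_natCast, div_le_iff₀ (by positivity)]
        refine (Complex.norm_iteratedDeriv_le_of_forall_mem_sphere_norm_le n hR0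
          (hε.1.2.differentiableOn.diffContOnCl_ball (closedBall_subset_ball hR1)) (C := M)
          ?_).trans (le_of_eq (by ring))
        intro y hy
        rw [mem_sphere_zero_iff_norm] at hy
        exact hε.2 y (by rw [mem_ball_zero_iff]; linarith)
      have hM : 0 ≤ M / R ^ n := (norm_nonneg _).trans hc
      rw [norm_mul, norm_pow]
      calc _ ≤ M / R ^ n * θ ^ n := by gcongr
        _ = _ := by rw [div_pow]; ring
  have h0 := (hasSum_taylorCoeff_of_ball hg₀.2.differentiableOn
    (show x₀ ∈ ball (0 : ℂ) 1 by rwa [mem_ball_zero_iff])).tsum_eq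
  rw [h0] at hmain
  refine hmain.congr' ?_
  filter_upwards [hg, hxθ] with ε hε hxε
  exact (hasSum_taylorCoeff_of_ball hε.1.2.differentiableOn
    (show x ε ∈ ball (0 : ℂ) 1 by rw [mem_ball_zero_iff]; linarith)).tsum_eq

theorem tendsto_of_forall_approx {l : Filter ℝ} {f : ℝ → ℂ} {a : ℂ}
    (h : ∀ η : ℝ, 0 < η → ∃ (u : ℝ → ℂ) (b : ℂ), Tendsto u l (𝓝 b) ∧ dist b a < η ∧
      ∀ᶠ ε in l, dist (f ε) (u ε) < η) : Tendsto f l (𝓝 a) := by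
  rw [Metric.tendsto_nhds]
  intro η hη
  obtain ⟨u, b, hu, hb, hfu⟩ := h (η / 3) (by positivity)
  filter_upwards [hfu, Metric.tendsto_nhds.1 hu (η / 3) (by positivity)] with ε h1 h2
  have := dist_triangle4 (f ε) (u ε) b a
  linarith

theorem exists_tendsto_of_forall_approx {l : Filter ℝ} [l.NeBot] {f : ℝ → ℂ}
    (h : ∀ η : ℝ, 0 < η → ∃ (u : ℝ → ℂ) (b : ℂ), Tendsto u l (𝓝 b) ∧
      ∀ᶠ ε in l, dist (f ε) (u ε) < η) : ∃ a, Tendsto f l (𝓝 a) := by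
  refine cauchy_map_iff_exists_tendsto.1 (Metric.cauchy_iff.2 ⟨inferInstance, fun η hη => ?_⟩)
  obtain ⟨u, b, hu, hfu⟩ := h (η / 4) (by positivity)
  refine ⟨ball b (η / 2), ?_, fun x hx y hy => ?_⟩
  · rw [mem_map]
    filter_upwards [hfu, Metric.tendsto_nhds.1 hu (η / 4) (by positivity)] with ε h1 h2
    have := dist_triangle (f ε) (u ε) b
    rw [Set.mem_preimage, mem_ball]
    linarith
  · rw [mem_ball] at hx hy
    have := dist_triangle_right x y b
    linarith

/-- Along the critical approach the branch value and the square-root coefficient converge to nonzero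
limits: on compact subsets of the open disk the sheets converge, and the uniform jet recovers both
quantities, up to a small error, from one value of the sheet near the singular point. -/
theorem CriticalApproach.tendsto_lam_kappa {N : ℕ} {e : Fin N → ℕ}
    {ζ : ℝ → Fin N → ℂ} {xs lam κ : ℝ → ℂ} {ε₁ : ℝ} (h : CriticalApproach e ζ xs lam κ ε₁)
    (he : ∀ n, e n ≠ 0) (hs : 1 ≤ symIndex e) :
    Tendsto lam (𝓝[>] 0) (𝓝 (lam 0)) ∧ lam 0 ≠ 0 ∧
      ∃ κc : ℂ, κc ≠ 0 ∧ Tendsto κ (𝓝[>] 0) (𝓝 κc) := by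
  obtain ⟨c, H, η, M, C₀, c₀, hc, hc1, hH, hη, hC₀, hc₀, F, a₂, a₃, hF⟩ := h.exists_normalizedSheet
  set s := symIndex e with hs'
  have hs0 : s ≠ 0 := by omega
  have h0mem : (0 : ℝ) ∈ Set.Ico 0 ε₁ := ⟨le_rfl, h.eps_pos⟩
  have hx00 : ‖xs 0‖ = 1 := by simpa using h.norm_rep h0mem
  have hle : 𝓝[>] (0 : ℝ) ≤ 𝓝[Set.Ico 0 ε₁] 0 := by
    rw [nhdsWithin_Ico_eq_nhdsGE h.eps_pos]
    exact nhdsWithin_mono _ Set.Ioi_subset_Ici_self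
  have hζ : Tendsto ζ (𝓝[>] 0) (𝓝 (ζ 0)) :=
    (h.path_contDiff.continuousOn 0 h0mem).mono_left hle
  have hxs : Tendsto xs (𝓝[>] 0) (𝓝 (xs 0)) :=
    (h.rep_contDiff.continuousOn 0 h0mem).mono_left hle
  obtain ⟨g₀, hg₀, hg₀lim⟩ := h.critical.2.2.1
  rw [hx00] at hg₀ hg₀lim
  set g : ℝ → ℂ → ℂ := fun ε x => F ε ((x / xs ε) ^ s) with hgdef
  have hIoo : ∀ᶠ ε in 𝓝[>] (0 : ℝ), ε ∈ Set.Ioo 0 ε₁ := Ioo_mem_nhdsGT h.eps_pos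
  have hg : ∀ᶠ ε in 𝓝[>] (0 : ℝ), IsTaylorSheetOn e (ζ ε) (ball 0 1) (g ε) ∧
      ∀ x ∈ ball (0 : ℂ) 1, ‖g ε x‖ ≤ M := by
    filter_upwards [hF, hIoo] with ε hε hε1
    have hxn := h.norm_rep ⟨hε1.1.le, hε1.2⟩
    have hx0 : xs ε ≠ 0 := by rw [← norm_pos_iff, hxn]; linarith [hε1.1]
    have hsub : ball (0 : ℂ) 1 ⊆ ball 0 ‖xs ε‖ := ball_subset_ball (by rw [hxn]; linarith [hε1.1])
    have hsh := hε.2.2.isTaylorSheetOn hc hH hs0 he hx0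
    exact ⟨⟨hsh.1, fun x hx => hsh.2 x (hsub hx)⟩,
      fun x hx => hε.2.2.bound _ (div_pow_mem_sectorDisk hc hH hs0 (hsub hx))⟩
  have hval : ∀ t ∈ Set.Ioo (0 : ℝ) 1,
      Tendsto (fun ε => F ε ((t : ℂ) ^ s)) (𝓝[>] 0) (𝓝 (g₀ (xs 0 * t))) := by
    intro t ht
    have h1 := tendsto_sheet_apply he hζ hg hg₀ (hxs.mul_const (t : ℂ)) (by
      rw [norm_mul, hx00, one_mul, Complex.norm_real, Real.norm_of_nonneg ht.1.le]; exact ht.2)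
    refine h1.congr' ?_
    filter_upwards [hIoo] with ε hε1
    have hxn := h.norm_rep ⟨hε1.1.le, hε1.2⟩
    have hx0 : xs ε ≠ 0 := by rw [← norm_pos_iff, hxn]; linarith [hε1.1]
    simp only [hgdef, mul_div_cancel_left₀ _ hx0]
  -- `τ t = δ^{1/2}` at the point `u = t^s`
  set τ : ℝ → ℂ := fun t => (1 - (t : ℂ) ^ s) ^ (1 / 2 : ℂ) with hτ
  have hτ2 : ∀ t, τ t ^ 2 = 1 - (t : ℂ) ^ s := by
    intro t; rw [hτ]; simp only; rw [← Complex.cpow_nat_mul]; norm_num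
  have hτ3 : ∀ t : ℝ, (1 - (t : ℂ) ^ s) ^ (3 / 2 : ℂ) = τ t ^ 3 := by
    intro t; rw [hτ]; simp only; rw [← Complex.cpow_nat_mul]; norm_num
  have hτlim : Tendsto (fun t => ‖τ t‖) (𝓝[<] 1) (𝓝 0) := by
    have h1 : Tendsto (fun t : ℝ => ‖1 - (t : ℂ) ^ s‖) (𝓝[<] 1) (𝓝 ‖1 - ((1 : ℝ) : ℂ) ^ s‖) :=
      (Continuous.tendsto (by fun_prop) 1).mono_left nhdsWithin_le_nhds
    have h2 := h1.sqrt
    simp only [Complex.ofReal_one, one_pow, sub_self, norm_zero, Real.sqrt_zero] at h2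
    refine h2.congr fun t => ?_
    rw [← hτ2, norm_pow, Real.sqrt_sq (norm_nonneg _)]
  have hτne : ∀ t ∈ Set.Ioo (0 : ℝ) 1, τ t ≠ 0 := by
    intro t ht h0
    have h1 := hτ2 t
    rw [h0] at h1
    have h2 : ((t ^ s : ℝ) : ℂ) = 1 := by push_cast; linear_combination h1
    have h3 : t ^ s = 1 := by exact_mod_cast h2
    exact absurd h3 (pow_lt_one₀ ht.1.le ht.2 hs0).ne
  have hs1 : 1 ≤ Real.sqrt s := Real.one_le_sqrt.2 (by exact_mod_cast hs)
  have hjet : ∀ t ∈ Set.Ioo (0 : ℝ) 1, ‖τ t‖ ≤ 1 → ‖τ t‖ ^ 2 < η → ∀ᶠ ε in 𝓝[>] (0 : ℝ),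
      ‖F ε ((t : ℂ) ^ s) - lam ε - (((Real.sqrt s)⁻¹ : ℝ) * κ ε) * τ t‖ ≤ 3 * C₀ * ‖τ t‖ ^ 2 ∧
      ‖κ ε‖ ≤ C₀ := by
    intro t ht h1 h2
    filter_upwards [hF] with ε hε
    have hmem : (t : ℂ) ^ s ∈ sectorDisk c H := mem_sectorDisk_of_norm_lt_one hc hH (by
      rw [norm_pow, Complex.norm_real, Real.norm_of_nonneg ht.1.le]
      exact pow_lt_one₀ ht.1.le ht.2 hs0)
    have hj := hε.2.2.jet _ hmem (by rw [← hτ2, norm_pow]; exact h2)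
    have hτ1 : (1 - (t : ℂ) ^ s) ^ (1 / 2 : ℂ) = τ t := rfl
    rw [← hs', hτ3, hτ1, ← hτ2, norm_pow, ← pow_mul] at hj
    have hcoef := hε.2.2.coeff_le
    have n0 := norm_nonneg (lam ε)
    have n1 := norm_nonneg (κ ε)
    have n2 := norm_nonneg (a₂ ε)
    have n3 := norm_nonneg (a₃ ε)
    refine ⟨?_, by linarith⟩
    have e1 : F ε ((t : ℂ) ^ s) - lam ε - (((Real.sqrt s)⁻¹ : ℝ) * κ ε) * τ t =
        (F ε ((t : ℂ) ^ s) - (lam ε + (((Real.sqrt s)⁻¹ : ℝ) * κ ε) * τ t +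
          a₂ ε * τ t ^ 2 + a₃ ε * τ t ^ 3)) + (a₂ ε * τ t ^ 2 + a₃ ε * τ t ^ 3) := by ring
    have T0 := norm_nonneg (τ t)
    have i2 : ‖a₂ ε * τ t ^ 2‖ ≤ C₀ * ‖τ t‖ ^ 2 := by
      rw [norm_mul, norm_pow]; gcongr; linarith
    have i3 : ‖a₃ ε * τ t ^ 3‖ ≤ C₀ * ‖τ t‖ ^ 2 := by
      rw [norm_mul, norm_pow]
      have : ‖τ t‖ ^ 3 ≤ ‖τ t‖ ^ 2 := pow_le_pow_of_le_one T0 h1 (by norm_num)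
      gcongr
      linarith
    have i4 : C₀ * ‖τ t‖ ^ (2 * 2) ≤ C₀ * ‖τ t‖ ^ 2 := by
      have : ‖τ t‖ ^ (2 * 2) ≤ ‖τ t‖ ^ 2 := pow_le_pow_of_le_one T0 h1 (by norm_num)
      gcongr
    rw [e1]
    refine (norm_add_le _ _).trans ?_
    have i5 := hj.trans i4
    have i6 := norm_add_le (a₂ ε * τ t ^ 2) (a₃ ε * τ t ^ 3)
    linarith
  have hgood : ∀ b : ℝ, 0 < b → ∀ᶠ t in 𝓝[<] (1 : ℝ), t ∈ Set.Ioo (0 : ℝ) 1 ∧ ‖τ t‖ < b ∧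
      ‖τ t‖ ≤ 1 ∧ ‖τ t‖ ^ 2 < η := by
    intro b hb
    have hsq := hτlim.pow 2
    rw [zero_pow two_ne_zero] at hsq
    filter_upwards [Ioo_mem_nhdsLT (show (0 : ℝ) < 1 by norm_num), hτlim.eventually_lt_const hb,
      hτlim.eventually_le_const one_pos, hsq.eventually_lt_const hη] with t h1 h2 h3 h4
    exact ⟨h1, h2, h3, h4⟩
  have hg₀t : Tendsto (fun t : ℝ => g₀ (xs 0 * t)) (𝓝[<] 1) (𝓝 (lam 0)) := by
    refine hg₀lim.comp (tendsto_nhdsWithin_iff.2 ⟨?_, ?_⟩)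
    · have h1 : Tendsto (fun t : ℝ => xs 0 * (t : ℂ)) (𝓝[<] 1) (𝓝 (xs 0 * ((1 : ℝ) : ℂ))) :=
        (Continuous.tendsto (by fun_prop) 1).mono_left nhdsWithin_le_nhds
      simpa using h1
    · filter_upwards [Ioo_mem_nhdsLT (show (0 : ℝ) < 1 by norm_num)] with t ht
      rw [mem_ball_zero_iff, norm_mul, hx00, one_mul, Complex.norm_real,
        Real.norm_of_nonneg ht.1.le]
      exact ht.2
  have hlam : Tendsto lam (𝓝[>] 0) (𝓝 (lam 0)) := by
    refine tendsto_of_forall_approx fun b hb => ?_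
    obtain ⟨t, ⟨ht, hτb, hτ1, hτη⟩, htl⟩ := ((hgood (b / (4 * C₀)) (by positivity)).and
      (Metric.tendsto_nhds.1 hg₀t b hb)).exists
    refine ⟨_, _, hval t ht, htl, ?_⟩
    filter_upwards [hjet t ht hτ1 hτη] with ε hε
    obtain ⟨h1, h2⟩ := hε
    rw [lt_div_iff₀ (by positivity)] at hτb
    rw [dist_comm, dist_eq_norm]
    have T0 := norm_nonneg (τ t)
    have i1 : ‖(((Real.sqrt s)⁻¹ : ℝ) * κ ε) * τ t‖ ≤ C₀ * ‖τ t‖ := by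
      rw [norm_mul, norm_mul, Complex.norm_real, Real.norm_of_nonneg (by positivity)]
      have : (Real.sqrt s)⁻¹ ≤ 1 := inv_le_one_of_one_le₀ hs1
      calc _ ≤ 1 * C₀ * ‖τ t‖ := by gcongr
        _ = _ := by ring
    have i2 : 3 * C₀ * ‖τ t‖ ^ 2 ≤ 3 * C₀ * ‖τ t‖ := by
      have : ‖τ t‖ ^ 2 ≤ ‖τ t‖ := pow_le_of_le_one T0 hτ1 (by norm_num)
      gcongr
    have i3 := norm_add_le (F ε ((t : ℂ) ^ s) - lam ε - (((Real.sqrt s)⁻¹ : ℝ) * κ ε) * τ t)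
      ((((Real.sqrt s)⁻¹ : ℝ) * κ ε) * τ t)
    rw [sub_add_cancel] at i3
    linarith
  have hκ : ∃ κc, Tendsto κ (𝓝[>] 0) (𝓝 κc) := by
    refine exists_tendsto_of_forall_approx fun b hb => ?_
    obtain ⟨t, ht, hτb, hτ1, hτη⟩ := (hgood (b / (3 * C₀ * Real.sqrt s)) (by positivity)).exists
    refine ⟨fun ε => (Real.sqrt s : ℂ) * ((F ε ((t : ℂ) ^ s) - lam ε) / τ t), _,
      (((hval t ht).sub hlam).div_const _).const_mul _, ?_⟩
    filter_upwards [hjet t ht hτ1 hτη] with ε hε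
    have hsc : ((Real.sqrt s : ℝ) : ℂ) ≠ 0 := by exact_mod_cast (zero_lt_one.trans_le hs1).ne'
    have hne := hτne t ht
    have e1 : κ ε - (Real.sqrt s : ℂ) * ((F ε ((t : ℂ) ^ s) - lam ε) / τ t) =
        -((Real.sqrt s : ℂ) / τ t) *
          (F ε ((t : ℂ) ^ s) - lam ε - (((Real.sqrt s)⁻¹ : ℝ) * κ ε) * τ t) := by
      push_cast
      field_simp
      ring
    have hTpos : 0 < ‖τ t‖ := norm_pos_iff.2 hne
    rw [dist_eq_norm, e1, norm_mul, norm_neg, norm_div, Complex.norm_real,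
      Real.norm_of_nonneg (by positivity)]
    rw [lt_div_iff₀ (by positivity)] at hτb
    calc _ ≤ Real.sqrt s / ‖τ t‖ * (3 * C₀ * ‖τ t‖ ^ 2) := by gcongr; exact hε.1
      _ = ‖τ t‖ * (3 * C₀ * Real.sqrt s) := by field_simp
      _ < b := hτb
  obtain ⟨κc, hκc⟩ := hκ
  refine ⟨hlam, ?_, κc, ?_, hκc⟩
  · have h1 : c₀ ≤ ‖lam 0‖ := ge_of_tendsto hlam.norm (hF.mono fun ε hε => hε.1)
    exact norm_pos_iff.1 (hc₀.trans_le h1)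
  · have h1 : c₀ ≤ ‖κc‖ := ge_of_tendsto hκc.norm (hF.mono fun ε hε => hε.2.1)
    exact norm_pos_iff.1 (hc₀.trans_le h1)

/-! ### The logarithmic scale and the limits of the transfer amplitudes -/

/-- Replacing the ratio `x = ρ_*^{-2s}` by the smaller ratio `η = x ρ^{-2s}`, with `ρ ≤ ρ_*`,
changes the logarithmic series by at most `1`: the change is at most `(x - η) / (1 - x)`. -/
theorem abs_tsum_sub_logScale_le {x y : ℝ} (hy : 0 ≤ y) (hyx : y ≤ x) (hx : x < 1)
    (h : x * x ≤ y) :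
    |∑' j : ℕ, x ^ j / ((j : ℝ) + 1) - ∑' j : ℕ, y ^ j / ((j : ℝ) + 1)| ≤ 1 := by
  have hx0 : 0 ≤ x := hy.trans hyx
  have hsum : ∀ w : ℝ, 0 ≤ w → w < 1 → Summable fun j : ℕ => w ^ j / ((j : ℝ) + 1) := by
    intro w hw hw1
    refine Summable.of_nonneg_of_le (fun j => by positivity) (fun j => ?_)
      (summable_geometric_of_lt_one hw hw1)
    exact div_le_self (by positivity) (by simp)
  have hterm : ∀ j : ℕ, x ^ j / ((j : ℝ) + 1) - y ^ j / ((j : ℝ) + 1) ≤ (1 - x) * x ^ j := by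
    intro j
    rw [← sub_div, div_le_iff₀ (by positivity)]
    rcases j with _ | j
    · simp; linarith
    · have h1 := pow_le_pow_left₀ (mul_nonneg hx0 hx0) h (j + 1)
      have hxj : 0 ≤ x ^ (j + 1) := by positivity
      -- `1 - x^{j+1} ≤ (j+1) (1 - x)`
      have h2 : 1 - x ^ (j + 1) ≤ ((j + 1 : ℕ) : ℝ) * (1 - x) := by
        have := one_add_mul_le_pow (a := x - 1) (by linarith) (j + 1)
        rw [add_sub_cancel] at this
        linarith
      rw [mul_pow] at h1
      have h3 := mul_le_mul_of_nonneg_left h2 hxj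
      have h4 : 0 ≤ x ^ (j + 1) * (1 - x) := mul_nonneg hxj (by linarith)
      push_cast at h3 ⊢
      linarith
  rw [← (hsum x hx0 hx).tsum_sub (hsum y hy (hyx.trans_lt hx)), abs_of_nonneg]
  · refine ((hsum x hx0 hx).sub (hsum y hy (hyx.trans_lt hx))).tsum_le_tsum hterm
      ((summable_geometric_of_lt_one hx0 hx).mul_left (1 - x)) |>.trans ?_
    rw [tsum_mul_left, tsum_geometric_of_lt_one hx0 hx, mul_inv_cancel₀ (by linarith)]
  · refine tsum_nonneg fun j => ?_
    rw [sub_nonneg]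
    gcongr

theorem CriticalApproach.abs_logScale_sub_le {N : ℕ} {e : Fin N → ℕ} {ζ : ℝ → Fin N → ℂ}
    {xs lam κ : ℝ → ℂ} {ε₁ : ℝ} (h : CriticalApproach e ζ xs lam κ ε₁) (hs : symIndex e ≠ 0)
    {ε : ℝ} (hε : ε ∈ Set.Ioo 0 ε₁) :
    |∑' j : ℕ, (‖xs ε ^ symIndex e‖⁻¹ ^ 2) ^ j / ((j : ℝ) + 1) - logScale e (ζ ε)| ≤ 1 := by
  have hpos : 0 < ε := hε.1
  have hxn := h.norm_rep ⟨hε.1.le, hε.2⟩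
  have hρ := h.rhoStar_eq hε
  have hη : etaCut e (ζ ε) = (((1 + ε / 2) * (1 + ε)) ^ (2 * symIndex e))⁻¹ := by
    rw [etaCut, midRadius, hρ]
    congr 3
    ring
  have hx : ‖xs ε ^ symIndex e‖⁻¹ ^ 2 = ((1 + ε) ^ (2 * symIndex e))⁻¹ := by
    rw [norm_pow, hxn, inv_pow, ← pow_mul, mul_comm]
  rw [logScale, hη, hx]
  have h2s : 2 * symIndex e ≠ 0 := by omega
  refine abs_tsum_sub_logScale_le (by positivity) ?_ ?_ ?_
  · refine inv_anti₀ (by positivity) (pow_le_pow_left₀ (by positivity) ?_ _)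
    nlinarith
  · exact inv_lt_one_of_one_lt₀ (one_lt_pow₀ (by linarith) h2s)
  · rw [← mul_inv, ← mul_pow]
    refine inv_anti₀ (by positivity) (pow_le_pow_left₀ (by positivity) ?_ _)
    nlinarith

theorem tendsto_sqrtDecay_mul_rpow :
    Tendsto (fun m : ℕ => sqrtDecay m * (m : ℝ) ^ (3 / 2 : ℝ)) atTop (𝓝 1) := by
  have h1 : Tendsto (fun m : ℕ => ((m : ℝ) / ((m : ℝ) + 1)) ^ (3 / 2 : ℝ)) atTop
      (𝓝 (1 ^ (3 / 2 : ℝ))) :=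
    (tendsto_natCast_div_add_atTop (1 : ℝ)).rpow_const (Or.inr (by norm_num))
  rw [Real.one_rpow] at h1
  refine h1.congr fun m => ?_
  rw [Real.div_rpow (by positivity) (by positivity), sqrtDecay,
    show (((m : ℝ) + 1) ^ (3 / 2 : ℝ)) = ((m : ℝ) + 1) * Real.sqrt (m + 1) by
      rw [show (3 / 2 : ℝ) = 1 + 1 / 2 by norm_num, Real.rpow_add (by positivity), Real.rpow_one,
        ← Real.sqrt_eq_rpow]]
  ring

/-- An error `O((m+1)⁻²)` relative to the square-root profile is negligible on the scale
`m^{-3/2}`. -/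
theorem hasTransferAsymptotics_of_norm_sub_le {N : ℕ} {e : Fin N → ℕ} {ζ : Fin N → ℂ} {x A : ℂ}
    {p : ℕ} {K : ℝ} (h : ∀ m : ℕ, ‖branchCoeff e ζ p m * (x ^ symIndex e) ^ m -
      A * (sqrtDecay m : ℂ)‖ ≤ K / ((m : ℝ) + 1) ^ 2) : HasTransferAsymptotics e ζ x p A := by
  have hK : 0 ≤ K := by
    have := (norm_nonneg _).trans (h 0)
    simpa using this
  have hmain : Tendsto (fun m : ℕ => A * ((sqrtDecay m * (m : ℝ) ^ (3 / 2 : ℝ) : ℝ) : ℂ)) atTop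
      (𝓝 (A * ((1 : ℝ) : ℂ))) :=
    ((Complex.continuous_ofReal.tendsto 1).comp tendsto_sqrtDecay_mul_rpow).const_mul A
  rw [Complex.ofReal_one, mul_one] at hmain
  have herr : Tendsto (fun m : ℕ => (branchCoeff e ζ p m * (x ^ symIndex e) ^ m -
      A * (sqrtDecay m : ℂ)) * (((m : ℝ) ^ (3 / 2 : ℝ) : ℝ) : ℂ)) atTop (𝓝 0) := by
    have hz : Tendsto (fun m : ℕ => K * (1 / Real.sqrt ((m : ℝ) + 1))) atTop (𝓝 (K * 0)) := by
      refine Tendsto.const_mul K ?_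
      simp only [one_div]
      exact tendsto_inv_atTop_zero.comp (Real.tendsto_sqrt_atTop.comp
        (tendsto_atTop_add_const_right _ _ tendsto_natCast_atTop_atTop))
    rw [mul_zero] at hz
    refine squeeze_zero_norm (fun m => ?_) hz
    have hm : (0 : ℝ) < (m : ℝ) + 1 := by positivity
    have hS : 0 < Real.sqrt ((m : ℝ) + 1) := Real.sqrt_pos.2 hm
    have hS2 : Real.sqrt ((m : ℝ) + 1) ^ 2 = m + 1 := Real.sq_sqrt hm.le
    have hpow : (m : ℝ) ^ (3 / 2 : ℝ) ≤ ((m : ℝ) + 1) * Real.sqrt (m + 1) := by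
      calc (m : ℝ) ^ (3 / 2 : ℝ) ≤ ((m : ℝ) + 1) ^ (3 / 2 : ℝ) :=
            Real.rpow_le_rpow (by positivity) (by linarith) (by norm_num)
        _ = _ := by
          rw [show (3 / 2 : ℝ) = 1 + 1 / 2 by norm_num, Real.rpow_add hm, Real.rpow_one,
            ← Real.sqrt_eq_rpow]
    rw [norm_mul, Complex.norm_real, Real.norm_of_nonneg (by positivity)]
    calc _ ≤ K / ((m : ℝ) + 1) ^ 2 * (((m : ℝ) + 1) * Real.sqrt (m + 1)) := by
          gcongr
          exact h m
      _ = K * (1 / Real.sqrt ((m : ℝ) + 1)) := by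
          rw [div_mul_eq_mul_div, mul_one_div, div_eq_div_iff (by positivity) hS.ne']
          linear_combination K * ((m : ℝ) + 1) * hS2
  have := hmain.add herr
  rw [add_zero] at this
  refine this.congr fun m => ?_
  rw [mul_comm m, pow_mul]
  push_cast
  ring

theorem tendsto_transferAmplitude {s : ℕ} {l : Filter ℝ} {κ lam : ℝ → ℂ} {κc lc : ℂ}
    (hκ : Tendsto κ l (𝓝 κc)) (hl : Tendsto lam l (𝓝 lc)) (p : ℕ) :
    Tendsto (fun ε => transferAmplitude s (κ ε) (lam ε) p) l
      (𝓝 (transferAmplitude s κc lc p)) := by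
  unfold transferAmplitude
  exact (hκ.const_mul _).mul (hl.pow (p - 1))

theorem tendsto_spikeEntry {s q : ℕ} {β α : ℝ} {l : Filter ℝ} {z : ℝ → ℂ} {zc : ℂ} (hzc : zc ≠ 0)
    (hz : Tendsto z l (𝓝 zc)) {A : ℝ → ℕ → ℂ} {Ac : ℕ → ℂ} {j : ℕ}
    (hA : Tendsto (fun ε => A ε (blockIndex s q j)) l (𝓝 (Ac (blockIndex s q j)))) :
    Tendsto (fun ε => spikeEntry s q β α (z ε) (A ε) j) l (𝓝 (spikeEntry s q β α zc Ac j)) := by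
  have hconj : ∀ {u : ℝ → ℂ} {a : ℂ}, Tendsto u l (𝓝 a) →
      Tendsto (fun ε => (starRingEnd ℂ) (u ε)) l (𝓝 ((starRingEnd ℂ) a)) := fun {u a} hu =>
    (Complex.continuous_conj.tendsto a).comp hu
  have hn : Tendsto (fun ε => ((‖z ε‖ : ℝ) : ℂ)) l (𝓝 (‖zc‖ : ℂ)) :=
    (Complex.continuous_ofReal.tendsto _).comp hz.norm
  have hdir := hconj (hz.div hn (by exact_mod_cast (norm_pos_iff.2 hzc).ne'))
  unfold spikeEntry
  exact (((hdir.pow j).mul_const _).mul (hconj hA)).div_const _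

/-- Dominated convergence in `ℓ²`. -/
theorem tendsto_ellTwoOfSummable {l : Filter ℝ} {f : ℝ → ℕ → ℂ} {fc : ℕ → ℂ} {b : ℕ → ℝ}
    (hb : Summable b) (hf : ∀ᶠ ε in l, ∀ k, ‖f ε k‖ ≤ b k)
    (hlim : ∀ k, Tendsto (fun ε => f ε k) l (𝓝 (fc k))) :
    Tendsto (fun ε => ellTwoOfSummable (f ε)) l (𝓝 (ellTwoOfSummable fc)) := by
  refine tendsto_tsum_of_dominated_convergence hb (fun k => ?_) ?_
  · exact ((lp.isometry_single (E := fun _ : ℕ => ℂ) (p := 2) k).continuous.tendsto _).comp (hlim k)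
  · filter_upwards [hf] with ε hε k
    rw [norm_single_two]
    exact hε k

end TodaGram

theorem mainTheorem2 {N : ℕ} (e : Fin N → ℕ) (he_two : ∀ n, 2 ≤ e n) (he_mono : StrictMono e)
    (ζ : ℝ → Fin N → ℂ) (xs lam κ : ℝ → ℂ) (ε₁ : ℝ)
    (happroach : TodaGram.CriticalApproach e ζ xs lam κ ε₁)
    (β α : ℝ) (hβ : 0 < β) (hα : TodaGram.AdmissibleWeight e ζ lam α)
    (q : ℕ) (hq_pos : 1 ≤ q) (hq_le : q ≤ TodaGram.symIndex e) :
    ∃ (ε₀ K : ℝ) (κc : ℂ) (G C : ℝ → TodaGram.EllTwo →L[ℂ] TodaGram.EllTwo)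
      (d : ℝ → TodaGram.EllTwo) (dc : TodaGram.EllTwo),
      0 < ε₀ ∧ ε₀ ≤ ε₁ ∧
      -- the decomposition, with uniformly bounded remainder
      (∀ ε ∈ Set.Ioo 0 ε₀,
        TodaGram.IsRenormalizedGram e (ζ ε) q β α (G ε) ∧
        G ε = (TodaGram.logScale e (ζ ε) : ℂ) • InnerProductSpace.rankOne ℂ (d ε) (d ε) + C ε ∧
        ‖C ε‖ ≤ K) ∧
      -- the spike vectors and the transfer amplitudes they are built from
      (∀ ε ∈ Set.Ioo 0 ε₀,
        (∀ p : ℕ, 1 ≤ p → TodaGram.HasTransferAsymptotics e (ζ ε) (xs ε) p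
          (TodaGram.transferAmplitude (TodaGram.symIndex e) (κ ε) (lam ε) p)) ∧
        ∀ j : ℕ, d ε j = TodaGram.spikeEntry (TodaGram.symIndex e) q β α
          (xs ε ^ TodaGram.symIndex e)
          (TodaGram.transferAmplitude (TodaGram.symIndex e) (κ ε) (lam ε)) j) ∧
      -- the critical transfer amplitudes
      κc ≠ 0 ∧ Tendsto κ (𝓝[>] 0) (𝓝 κc) ∧
      (∀ p : ℕ, 1 ≤ p → Tendsto
        (fun ε => TodaGram.transferAmplitude (TodaGram.symIndex e) (κ ε) (lam ε) p) (𝓝[>] 0)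
        (𝓝 (TodaGram.transferAmplitude (TodaGram.symIndex e) κc (lam 0) p))) ∧
      -- convergence of the spike vectors to a nonzero limit
      Tendsto d (𝓝[>] 0) (𝓝 dc) ∧ dc ≠ 0 ∧
      ∀ j : ℕ, dc j = TodaGram.spikeEntry (TodaGram.symIndex e) q β α
        (xs 0 ^ TodaGram.symIndex e)
        (TodaGram.transferAmplitude (TodaGram.symIndex e) κc (lam 0)) j := by
  have he : ∀ n, e n ≠ 0 := fun n => by have := he_two n; omega
  have hs : 1 ≤ TodaGram.symIndex e := hq_pos.trans hq_le
  have hs0 : TodaGram.symIndex e ≠ 0 := by omega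
  obtain ⟨hlam, hlam0, κc, hκc0, hκc⟩ := happroach.tendsto_lam_kappa he hs
  obtain ⟨ν, K, hν, hνα, hK, hcoeff⟩ := happroach.exists_coeff_asymptotics he hs hα
  obtain ⟨C, hC⟩ := TodaGram.exists_renormalizedGram e hq_pos hq_le hβ hν hνα hK
  obtain ⟨ε₂, hε₂, hcoeff₂⟩ := (mem_nhdsGT_iff_exists_Ioo_subset' (zero_lt_one' ℝ)).1 hcoeff
  have hα0 : 0 < α := hν.trans hνα
  have hamp : ∀ p : ℕ, Tendsto
      (fun ε => TodaGram.transferAmplitude (TodaGram.symIndex e) (κ ε) (lam ε) p) (𝓝[>] 0)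
      (𝓝 (TodaGram.transferAmplitude (TodaGram.symIndex e) κc (lam 0) p)) := fun p =>
    TodaGram.tendsto_transferAmplitude hκc hlam p
  have hmem : (0 : ℝ) ∈ Set.Ico 0 ε₁ := ⟨le_rfl, happroach.eps_pos⟩
  have hxs : Tendsto xs (𝓝[>] 0) (𝓝 (xs 0)) := by
    refine (happroach.rep_contDiff.continuousOn 0 hmem).mono_left ?_
    rw [nhdsWithin_Ico_eq_nhdsGE happroach.eps_pos]
    exact nhdsWithin_mono _ Set.Ioi_subset_Ici_self
  have hx0 : xs 0 ≠ 0 := by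
    rw [← norm_pos_iff, happroach.norm_rep hmem]; norm_num
  set s := TodaGram.symIndex e with hsdef
  set spike : ℝ → ℕ → ℂ := fun ε => TodaGram.spikeEntry s q β α (xs ε ^ s)
    (TodaGram.transferAmplitude s (κ ε) (lam ε)) with hspike
  set spikec : ℕ → ℂ := TodaGram.spikeEntry s q β α (xs 0 ^ s)
    (TodaGram.transferAmplitude s κc (lam 0)) with hspikec
  set b : ℕ → ℝ := fun k => K * s ^ 2 * ((k : ℝ) + 1) * (ν / α) ^ k with hb
  have hbs : Summable b := by
    refine ((TodaGram.summable_poly_mul_geometric (θ := ν / α) (by positivity)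
      ((div_lt_one hα0).2 hνα) 1).mul_left (K * s ^ 2)).congr fun k => ?_
    simp only [hb]; ring
  have hspikeb : ∀ ε ∈ Set.Ioo 0 ε₂, ∀ k, ‖spike ε k‖ ≤ b k := fun ε hε =>
    TodaGram.norm_spikeEntry_le hs hq_pos hq_le hβ hν hνα hK _ (hcoeff₂ hε).2
  have hspikel : ∀ k, Tendsto (fun ε => spike ε k) (𝓝[>] 0) (𝓝 (spikec k)) := fun k =>
    TodaGram.tendsto_spikeEntry (pow_ne_zero _ hx0) (hxs.pow s) (hamp _)
  have hev : ∀ᶠ ε in 𝓝[>] (0 : ℝ), ε ∈ Set.Ioo 0 ε₂ := Ioo_mem_nhdsGT hε₂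
  have hspikecb : ∀ k, ‖spikec k‖ ≤ b k := fun k =>
    le_of_tendsto (hspikel k).norm (hev.mono fun ε hε => hspikeb ε hε k)
  have hcapply : ∀ j, TodaGram.ellTwoOfSummable spikec j = spikec j :=
    TodaGram.ellTwoOfSummable_apply
      (Summable.of_nonneg_of_le (fun _ => norm_nonneg _) hspikecb hbs)
  have hblock : ∀ ε, ∃ T : TodaGram.EllTwo →L[ℂ] TodaGram.EllTwo, ε ∈ Set.Ioo 0 (min ε₁ ε₂) →
      TodaGram.IsRenormalizedSynthesis e (ζ ε) q β α T ∧
        ‖(ContinuousLinearMap.adjoint T).comp T - (TodaGram.logScale e (ζ ε) : ℂ) •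
          InnerProductSpace.rankOne ℂ (TodaGram.ellTwoOfSummable (spike ε))
            (TodaGram.ellTwoOfSummable (spike ε))‖ ≤ C := by
    intro ε
    by_cases hε : ε ∈ Set.Ioo 0 (min ε₁ ε₂)
    · have hε1 : ε ∈ Set.Ioo 0 ε₁ := ⟨hε.1, hε.2.trans_le (min_le_left _ _)⟩
      have hε2 : ε ∈ Set.Ioo 0 ε₂ := ⟨hε.1, hε.2.trans_le (min_le_right _ _)⟩
      have hz : 1 < ‖xs ε ^ s‖ := by
        rw [norm_pow, happroach.norm_rep ⟨hε1.1.le, hε1.2⟩]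
        exact one_lt_pow₀ (by linarith [hε1.1]) hs0
      obtain ⟨T, hT⟩ := hC (ζ ε) (xs ε ^ s) _ _ hz (hcoeff₂ hε2).1 (hcoeff₂ hε2).2
        (happroach.abs_logScale_sub_le hs0 hε1)
      exact ⟨T, fun _ => hT⟩
    · exact ⟨0, fun h => absurd h hε⟩
  choose T hT using hblock
  refine ⟨min ε₁ ε₂, C, κc, fun ε => (ContinuousLinearMap.adjoint (T ε)).comp (T ε),
    fun ε => (ContinuousLinearMap.adjoint (T ε)).comp (T ε) -
      (TodaGram.logScale e (ζ ε) : ℂ) • InnerProductSpace.rankOne ℂ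
        (TodaGram.ellTwoOfSummable (spike ε)) (TodaGram.ellTwoOfSummable (spike ε)),
    fun ε => TodaGram.ellTwoOfSummable (spike ε), TodaGram.ellTwoOfSummable spikec,
    lt_min happroach.eps_pos hε₂, min_le_left _ _, ?_, ?_, hκc0, hκc, fun p _ => hamp p, ?_, ?_,
    hcapply⟩
  · intro ε hε
    exact ⟨⟨T ε, (hT ε hε).1, rfl⟩, (add_sub_cancel _ _).symm, (hT ε hε).2⟩
  · intro ε hε
    have hε2 : ε ∈ Set.Ioo 0 ε₂ := ⟨hε.1, hε.2.trans_le (min_le_right _ _)⟩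
    exact ⟨fun p hp => TodaGram.hasTransferAsymptotics_of_norm_sub_le
        fun m => (hcoeff₂ hε2).1 p m hp,
      TodaGram.ellTwoOfSummable_apply
        (Summable.of_nonneg_of_le (fun _ => norm_nonneg _) (hspikeb ε hε2) hbs)⟩
  · exact TodaGram.tendsto_ellTwoOfSummable hbs (hev.mono hspikeb) hspikel
  · -- the entry of index `0` does not vanish
    intro h0
    have h1 : spikec 0 = 0 := by rw [← hcapply, h0]; rfl
    have hq0 : (q : ℝ) ≠ 0 := by
      have : (1 : ℝ) ≤ q := by exact_mod_cast hq_pos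
      positivity
    have hw : (TodaGram.weight s q β α 0 : ℂ) ≠ 0 := by
      exact_mod_cast (TodaGram.weight_pos hq_pos β hα0 0).ne'
    have hsR : (0 : ℝ) < s := by exact_mod_cast hs
    have hP : 0 < Real.sqrt (TodaGram.blockIndex s q 0) :=
      Real.sqrt_pos.2 (by exact_mod_cast TodaGram.one_le_blockIndex (s := s) hq_pos 0)
    have hfac : ((s / Real.sqrt (TodaGram.blockIndex s q 0) : ℝ) : ℂ) ≠ 0 := by
      exact_mod_cast (div_pos hsR hP).ne'
    have hA : TodaGram.transferAmplitude s κc (lam 0) (TodaGram.blockIndex s q 0) ≠ 0 := by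
      have hconst : (((Real.sqrt s)⁻¹ / (2 * Real.sqrt Real.pi) : ℝ) : ℂ) ≠ 0 := by
        have h3 : 0 < Real.sqrt Real.pi := Real.sqrt_pos.2 Real.pi_pos
        have h4 : 0 < Real.sqrt s := Real.sqrt_pos.2 hsR
        exact_mod_cast (by positivity : (Real.sqrt s)⁻¹ / (2 * Real.sqrt Real.pi) ≠ 0)
      have hp : ((TodaGram.blockIndex s q 0 : ℕ) : ℂ) ≠ 0 := by
        have := TodaGram.one_le_blockIndex (s := s) hq_pos 0
        exact_mod_cast (by omega : TodaGram.blockIndex s q 0 ≠ 0)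
      exact mul_ne_zero (mul_ne_zero (mul_ne_zero (neg_ne_zero.2 hconst) hp) hκc0)
        (pow_ne_zero _ hlam0)
    rw [hspikec, TodaGram.spikeEntry, pow_zero, one_mul] at h1
    exact div_ne_zero (mul_ne_zero hfac ((map_ne_zero _).2 hA)) hw h1
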